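/- Let $M$ be a finite-dimensional Hausdorff smooth manifold with a Poisson bracket $\{\cdot,\cdot\}$ on $C^\infty(M)$, let $\mathcal P(M)$ be the group of diffeomorphisms $\phi$ of $M$ with $\{f\circ\phi,g\circ\phi\}=\{f,g\}\circ\phi$ for all $f,g\in C^\infty(M)$, and let $A\subset\mathcal P(M)$ be a subgroup. Definitions. A family $\mathcal D$ of smooth vector fields, each defined on an open subset of $M$, generates the pseudogroup $G_{\mathcal D}$ of all maps $\mathcal F_T=F^1_{t_1}\circ\dots\circ F^k_{t_k}$ ($k\ge1$, $F^i$ the flow of some $X_i\in\mathcal D$, $t_i\in\mathbb R$) with their natural domains $\mathrm{Dom}(\mathcal F_T)$, and spans the generalized distribution $D(z)=\mathrm{span}\{X(z)\mid X\in\mathcal D,\ z\in\mathrm{Dom}(X)\}$. The distribution $D$ is integrable if through every point there is a leaf, that is, a connected immersed submanifold $N$ with $T_zN=D(z)$ for all $z\in N$ that equals every other such submanifold containing it; $M/D$ is the space of leaves. An integrable $D$ spanned by $\mathcal D$ is Poisson if every element of $G_{\mathcal D}$ is a local Poisson diffeomorphism, that is, a diffeomorphism between open subsets of $M$ that preserves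 the restricted brackets. The standard polar family of $A$ is $\mathcal A'=\{X_f\mid f\in C^\infty(U)^A,\ U\subset M\text{ open and }A\text{-invariant}\}$, where $X_f$ is the Hamiltonian vector field of $f$; the distribution $A'$ that it spans is the polar distribution of $A$, and $G_{\mathcal A'}$ is the standard polar pseudogroup. For a quotient $\pi:M\to Q$ with the quotient topology ($Q=M/A$ with projection $\pi_A$, or $Q=M/A'$ with projection $\pi_{A'}$) and $V\subset Q$ open, $C^\infty(V)$ is the algebra of continuous $f:V\to\mathbb R$ with $f\circ\pi\in C^\infty(\pi^{-1}(V))$, and $\{f,g\}_V(\pi(m))=\{f\circ\pi,g\circ\pi\}(m)$. If this is a well-defined Poisson bracket on $C^\infty(V)$, then $V$ is called a Poisson variety. A local Poisson diffeomorphism of $Q$ is a homeomorphism $V\to W$ between open subsets of $Q$ such that pullback by it is a bijection $C^\infty(W)\to C^\infty(V)$ that preserves the brackets; it is a Poisson diffeomorphism of $Q$ if $V=W=Q$. Proposition 3.8. Then: (i) The group $A$ commutes with $G_{\mathcal A'}$: for every $(\mathcal F_T,\mathrm{Dom}(\mathcal F_T))\in G_{\mathcal A'}$ the domain $\mathrm{Dom}(\mathcal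 F_T)$ is open and $A$-invariant, and for every $\phi\in A$ one has $\mathcal F_T\circ\phi=\phi\circ\mathcal F_T$, both sides having the domain $\mathrm{Dom}(\mathcal F_T)$. (ii) Every open subset of $M/A$ is a Poisson variety, and every $(\mathcal F_T,\mathrm{Dom}(\mathcal F_T))\in G_{\mathcal A'}$ induces a local Poisson diffeomorphism $(\bar{\mathcal F}_T,\pi_A(\mathrm{Dom}(\mathcal F_T)))$ of $M/A$, uniquely determined by $\bar{\mathcal F}_T\circ\pi_A=\pi_A\circ\mathcal F_T$. The assignment $\mathcal F_T\mapsto\bar{\mathcal F}_T$ respects the identity and compositions, that is, $G_{\mathcal A'}$ acts canonically on $M/A$. (iii) The polar distribution $A'$ is integrable and Poisson, and the leaf space $M/A'$ is a Poisson variety. (iv) $A$ acts canonically on $M/A'$: for every $\phi\in A$ there is a Poisson diffeomorphism $\bar\phi$ of $M/A'$, uniquely determined by $\bar\phi\circ\pi_{A'}=\pi_{A'}\circ\phi$, and $\phi\mapsto\bar\phi$ is a group homomorphism. -/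

import Mathlib

open Set Filter Topology
open scoped Manifold ContDiff

noncomputable section

namespace Polar

/-- A Poisson bracket on a commutative `ℝ`-algebra: a bilinear alternating operation that satisfies
the Jacobi identity and is a derivation in its first (hence in each) argument. -/
structure PoissonBracket (R : Type*) [CommRing R] [Algebra ℝ R] where
  br : R →ₗ[ℝ] R →ₗ[ℝ] R
  alternating : ∀ f, br f f = 0
  jacobi : ∀ f g h, br f (br g h) + br g (br h f) + br h (br f g) = 0
  leibniz : ∀ f g h, br (f * g) h = f * br g h + br f h * g

universe u

variable {E : Type*} [NormedAddCommGroup E] [NormedSpace ℝ E]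
  {M : Type u} [TopologicalSpace M] [ChartedSpace E M]

/-! ### Poisson manifolds -/

/-- The algebra `C^∞(M)`. -/
abbrev Smooth (E : Type*) [NormedAddCommGroup E] [NormedSpace ℝ E]
    (M : Type*) [TopologicalSpace M] [ChartedSpace E M] : Type _ :=
  C^∞⟮𝓘(ℝ, E), M; ℝ⟯

/-- A Poisson structure on the manifold `M`: a Poisson bracket on `C^∞(M)`. -/
abbrev PoissonStructure (E : Type*) [NormedAddCommGroup E] [NormedSpace ℝ E]
    (M : Type*) [TopologicalSpace M] [ChartedSpace E M] : Type _ :=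
  PoissonBracket (Smooth E M)

/-- `f ∈ C^∞(U)`. Only the values of `f` on `U` matter (`U` is always an open set). -/
def SmoothOn (E : Type*) [NormedAddCommGroup E] [NormedSpace ℝ E]
    {M : Type*} [TopologicalSpace M] [ChartedSpace E M] (U : Set M) (f : M → ℝ) : Prop :=
  ContMDiffOn 𝓘(ℝ, E) 𝓘(ℝ, ℝ) ∞ f U

open Classical in
/-- The value at `x` of the restriction of the bracket to an open neighbourhood `U` of `x`, for
functions `f`, `g` that are smooth on `U`: it is `{f', g'}(x)` for any `f', g' ∈ C^∞(M)` that
coincide with `f`, `g` near `x`. (Such `f'`, `g'` exist on a Hausdorff finite-dimensional manifold,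
and the value does not depend on them.) -/
def localBracket (P : PoissonStructure E M) (f g : M → ℝ) (x : M) : ℝ :=
  if h : ∃ p : Smooth E M × Smooth E M, (p.1 : M → ℝ) =ᶠ[𝓝 x] f ∧ (p.2 : M → ℝ) =ᶠ[𝓝 x] g then
    P.br h.choose.1 h.choose.2 x
  else 0

/-- `φ` belongs to the group `𝒫(M)` of Poisson automorphisms: it is a diffeomorphism of `M` with
`{f ∘ φ, g ∘ φ} = {f, g} ∘ φ`. -/
def IsPoissonAut (P : PoissonStructure E M) (φ : Equiv.Perm M) : Prop :=
  ∃ Φ : M ≃ₘ⟮𝓘(ℝ, E), 𝓘(ℝ, E)⟯ M, (∀ x, Φ x = φ x) ∧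
    ∀ f g : Smooth E M,
      P.br (f.comp (Φ : C^∞⟮𝓘(ℝ, E), M; 𝓘(ℝ, E), M⟯)) (g.comp Φ) = (P.br f g).comp Φ

/-! ### Local maps

A map defined on a part of `X` is a partial function `F : X →. X`, with domain `F.Dom`; the
composition `PFun.comp G F` has domain `F⁻¹(Dom G) ∩ Dom F`. -/

/-- The partial function `F` is the homeomorphism `Φ.source → Φ.target` given by `Φ`. -/
def Represents {X : Type*} [TopologicalSpace X] (Φ : OpenPartialHomeomorph X X) (F : X →. X) :
    Prop :=
  ∀ x y, y ∈ F x ↔ x ∈ Φ.source ∧ Φ x = y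

/-- `(F, Dom F)` belongs to the pseudogroup `𝒫_L(M)` of local Poisson diffeomorphisms: it is a
diffeomorphism `U → V` between open sets, with `{f ∘ F, g ∘ F}_U = {f, g}_V ∘ F` for
`f, g ∈ C^∞(V)`. -/
def IsLocalPoissonDiffeo (P : PoissonStructure E M) (F : M →. M) : Prop :=
  ∃ Φ : OpenPartialHomeomorph M M, Represents Φ F ∧
    ContMDiffOn 𝓘(ℝ, E) 𝓘(ℝ, E) ∞ Φ Φ.source ∧
    ContMDiffOn 𝓘(ℝ, E) 𝓘(ℝ, E) ∞ Φ.symm Φ.target ∧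
    ∀ f g : M → ℝ, SmoothOn E Φ.target f → SmoothOn E Φ.target g → ∀ x ∈ Φ.source,
      localBracket P (f ∘ Φ) (g ∘ Φ) x = localBracket P f g (Φ x)

/-! ### Quotients as Poisson varieties

Orbit spaces and leaf spaces are quotients `Quot r`, with the quotient topology and with projection
`Quot.mk r : M → Quot r`. -/

/-- `f ∈ C^∞(V)` for an open subset `V` of the quotient: `f` is continuous on `V` and its pullback
by the projection is smooth on the preimage of `V`. Only the values of `f` on `V` matter. -/
def QuotSmoothOn (E : Type*) [NormedAddCommGroup E] [NormedSpace ℝ E]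
    {M : Type*} [TopologicalSpace M] [ChartedSpace E M] (r : M → M → Prop)
    (V : Set (Quot r)) (f : Quot r → ℝ) : Prop :=
  ContinuousOn f V ∧ SmoothOn E (Quot.mk r ⁻¹' V) (f ∘ Quot.mk r)

/-- The bracket of the quotient, `{f, g}(π m) = {f ∘ π, g ∘ π}(m)`, computed at some representative
`m`. Its independence of the representative is the clause `apply_mk` of `IsPoissonVariety`. -/
def quotBracket (P : PoissonStructure E M) (r : M → M → Prop) (f g : Quot r → ℝ) : Quot r → ℝ :=
  fun q => localBracket P (f ∘ Quot.mk r) (g ∘ Quot.mk r) q.out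

/-- `(C^∞(V), {·,·}_V)` is a Poisson variety: the formula `{f, g}_V(π m) = {f ∘ π, g ∘ π}(m)` is a
well-defined operation on `C^∞(V)`, which is a Poisson bracket. -/
structure IsPoissonVariety (P : PoissonStructure E M) (r : M → M → Prop) (V : Set (Quot r)) :
    Prop where
  apply_mk : ∀ f g, QuotSmoothOn E r V f → QuotSmoothOn E r V g → ∀ m, Quot.mk r m ∈ V →
    quotBracket P r f g (Quot.mk r m) = localBracket P (f ∘ Quot.mk r) (g ∘ Quot.mk r) m
  smooth : ∀ f g, QuotSmoothOn E r V f → QuotSmoothOn E r V g →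
    QuotSmoothOn E r V (quotBracket P r f g)
  add_left : ∀ f g h, QuotSmoothOn E r V f → QuotSmoothOn E r V g → QuotSmoothOn E r V h →
    EqOn (quotBracket P r (f + g) h) (quotBracket P r f h + quotBracket P r g h) V
  smul_left : ∀ (c : ℝ) (f g), QuotSmoothOn E r V f → QuotSmoothOn E r V g →
    EqOn (quotBracket P r (c • f) g) (c • quotBracket P r f g) V
  antisymm : ∀ f g, QuotSmoothOn E r V f → QuotSmoothOn E r V g →
    EqOn (quotBracket P r f g) (-quotBracket P r g f) V
  jacobi : ∀ f g h, QuotSmoothOn E r V f → QuotSmoothOn E r V g → QuotSmoothOn E r V h →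
    EqOn (quotBracket P r f (quotBracket P r g h) + quotBracket P r g (quotBracket P r h f) +
      quotBracket P r h (quotBracket P r f g)) 0 V
  leibniz : ∀ f g h, QuotSmoothOn E r V f → QuotSmoothOn E r V g → QuotSmoothOn E r V h →
    EqOn (quotBracket P r (f * g) h) (f * quotBracket P r g h + quotBracket P r f h * g) V

/-- `(F, Dom F)` is a local Poisson diffeomorphism of the quotient: a homeomorphism `V → W` between
open sets such that the pullbacks by it and by its inverse exchange `C^∞(W)` and `C^∞(V)`, and
`{f ∘ F, g ∘ F}_V = {f, g}_W ∘ F` for `f, g ∈ C^∞(W)`. -/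
def IsLocalPoissonDiffeoQuot (P : PoissonStructure E M) (r : M → M → Prop)
    (F : Quot r →. Quot r) : Prop :=
  ∃ Φ : OpenPartialHomeomorph (Quot r) (Quot r), Represents Φ F ∧
    (∀ f, QuotSmoothOn E r Φ.target f → QuotSmoothOn E r Φ.source (f ∘ Φ)) ∧
    (∀ f, QuotSmoothOn E r Φ.source f → QuotSmoothOn E r Φ.target (f ∘ Φ.symm)) ∧
    ∀ f g, QuotSmoothOn E r Φ.target f → QuotSmoothOn E r Φ.target g → ∀ q ∈ Φ.source,
      quotBracket P r (f ∘ Φ) (g ∘ Φ) q = quotBracket P r f g (Φ q)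

/-! ### Families of local vector fields, their flows and their pseudogroups -/

/-- A smooth vector field defined on an open subset of `M` (the values of `vec` outside of `dom`
are irrelevant). -/
structure LocalVectorField (E : Type*) [NormedAddCommGroup E] [NormedSpace ℝ E]
    (M : Type*) [TopologicalSpace M] [ChartedSpace E M] [IsManifold 𝓘(ℝ, E) ∞ M] where
  dom : Set M
  isOpen_dom : IsOpen dom
  vec : (x : M) → TangentSpace 𝓘(ℝ, E) x
  smooth : ContMDiffOn 𝓘(ℝ, E) 𝓘(ℝ, E).tangent ∞
    (fun x => (⟨x, vec x⟩ : TangentBundle 𝓘(ℝ, E) M)) dom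

variable [IsManifold 𝓘(ℝ, E) ∞ M]

/-- `y = F_t(x)`: some integral curve of `X`, inside `Dom X` and defined on an open interval around
`0` and `t`, goes from `x` at time `0` to `y` at time `t`. -/
def FlowsTo (X : LocalVectorField E M) (t : ℝ) (x y : M) : Prop :=
  ∃ (γ : ℝ → M) (a b : ℝ), 0 ∈ Ioo a b ∧ t ∈ Ioo a b ∧ MapsTo γ (Ioo a b) X.dom ∧
    IsMIntegralCurveOn (I := 𝓘(ℝ, E)) γ X.vec (Ioo a b) ∧ γ 0 = x ∧ γ t = y

/-- The time `t` map `F_t` of the flow of `X`, on its maximal domain. -/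
def flow (X : LocalVectorField E M) (t : ℝ) : M →. M :=
  fun x => ⟨∃ y, FlowsTo X t x y, fun h => h.choose⟩

/-- The pseudogroup `G_𝒟`: the maps `F¹_{t₁} ∘ ⋯ ∘ Fᵏ_{tₖ}`, `k ≥ 1`, where `Fⁱ` is the flow of a
member of the family `𝒟`. -/
inductive pseudogroup (𝒟 : Set (LocalVectorField E M)) : Set (M →. M)
  | flow {X : LocalVectorField E M} (hX : X ∈ 𝒟) (t : ℝ) : pseudogroup 𝒟 (Polar.flow X t)
  | comp {X : LocalVectorField E M} (hX : X ∈ 𝒟) (t : ℝ) {F : M →. M} (hF : pseudogroup 𝒟 F) :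
      pseudogroup 𝒟 ((Polar.flow X t).comp F)

/-! ### Generalized distributions -/

/-- The generalized distribution spanned by `𝒟`: `D(z) = span {X(z) | X ∈ 𝒟, z ∈ Dom X}`. -/
def distribution (𝒟 : Set (LocalVectorField E M)) (z : M) :
    Submodule ℝ (TangentSpace 𝓘(ℝ, E) z) :=
  Submodule.span ℝ {v | ∃ X ∈ 𝒟, z ∈ X.dom ∧ X.vec z = v}

/-- A connected (hence nonempty) immersed submanifold of `M`, as an injective immersion
`incl : N → M`; the submanifold is the subset `range incl` with the structure carried over from `N`.
(If `M` is Hausdorff then so is `N`, and if `M` is moreover second countable then so is the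
connected `N`.) -/
structure ImmersedSubmanifold (E : Type*) [NormedAddCommGroup E] [NormedSpace ℝ E]
    (M : Type u) [TopologicalSpace M] [ChartedSpace E M] where
  N : Type u
  [top : TopologicalSpace N]
  dim : ℕ
  [charted : ChartedSpace (EuclideanSpace ℝ (Fin dim)) N]
  [isManifold : IsManifold (𝓡 dim) ∞ N]
  [connected : ConnectedSpace N]
  incl : N → M
  smooth : ContMDiff (𝓡 dim) 𝓘(ℝ, E) ∞ incl
  injective : Function.Injective incl
  immersion : ∀ p, Function.Injective (mfderiv (𝓡 dim) 𝓘(ℝ, E) incl p)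

attribute [instance] ImmersedSubmanifold.top ImmersedSubmanifold.charted
  ImmersedSubmanifold.isManifold ImmersedSubmanifold.connected

/-- The tangent space of the immersed submanifold at the point `incl p`, as a subspace of that of
`M`. -/
def ImmersedSubmanifold.tangent {E : Type*} [NormedAddCommGroup E] [NormedSpace ℝ E]
    {M : Type u} [TopologicalSpace M] [ChartedSpace E M] (L : ImmersedSubmanifold E M) (p : L.N) :
    Submodule ℝ (TangentSpace 𝓘(ℝ, E) (L.incl p)) :=
  LinearMap.range (mfderiv (𝓡 L.dim) 𝓘(ℝ, E) L.incl p).toLinearMap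

/-- `L` is an integral submanifold of `D` that is everywhere of maximal dimension. -/
def IsIntegralOfMaxDim (D : (z : M) → Submodule ℝ (TangentSpace 𝓘(ℝ, E) z))
    (L : ImmersedSubmanifold E M) : Prop :=
  ∀ p : L.N, L.tangent p = D (L.incl p)

/-- `L` is a maximal integral submanifold (a leaf) of `D`. -/
def IsLeaf (D : (z : M) → Submodule ℝ (TangentSpace 𝓘(ℝ, E) z))
    (L : ImmersedSubmanifold E M) : Prop :=
  IsIntegralOfMaxDim D L ∧
    ∀ L' : ImmersedSubmanifold E M, IsIntegralOfMaxDim D L' → range L.incl ⊆ range L'.incl →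
      range L'.incl = range L.incl

/-- `D` is integrable: through every point there is a maximal integral submanifold of `D`. -/
def IsIntegrable (D : (z : M) → Submodule ℝ (TangentSpace 𝓘(ℝ, E) z)) : Prop :=
  ∀ z, ∃ L : ImmersedSubmanifold E M, IsLeaf D L ∧ z ∈ range L.incl

/-- `x` and `y` lie in the same leaf of `D`; the leaf space `M/D` is `Quot (SameLeaf D)`. -/
def SameLeaf (D : (z : M) → Submodule ℝ (TangentSpace 𝓘(ℝ, E) z)) (x y : M) : Prop :=
  ∃ L : ImmersedSubmanifold E M, IsLeaf D L ∧ x ∈ range L.incl ∧ y ∈ range L.incl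

/-- For an integrable distribution spanned by `𝒟`, to be Poisson means that the pseudogroup `G_𝒟`
lies in `𝒫_L(M)`. -/
def IsPoissonFamily (P : PoissonStructure E M) (𝒟 : Set (LocalVectorField E M)) : Prop :=
  ∀ F ∈ pseudogroup 𝒟, IsLocalPoissonDiffeo P F

/-! ### Groups of transformations and polarity -/

/-- `U` is `A`-invariant. -/
def IsInvariant (A : Subgroup (Equiv.Perm M)) (U : Set M) : Prop :=
  ∀ φ ∈ A, ∀ x ∈ U, φ x ∈ U

/-- `x` and `y` lie in the same `A`-orbit; the orbit space `M/A` is `Quot (SameOrbit A)`. -/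
def SameOrbit (A : Subgroup (Equiv.Perm M)) (x y : M) : Prop :=
  ∃ φ ∈ A, φ x = y

/-- `X` is the Hamiltonian vector field `X_f` on `Dom X` of `f ∈ C^∞(Dom X)`: `dg(X) = {g, f}` on
`Dom X` for every `g ∈ C^∞(M)`. -/
def IsHamiltonian (P : PoissonStructure E M) (f : M → ℝ) (X : LocalVectorField E M) : Prop :=
  SmoothOn E X.dom f ∧ ∀ x ∈ X.dom, ∀ g : Smooth E M,
    mfderiv 𝓘(ℝ, E) 𝓘(ℝ, ℝ) g x (X.vec x) = localBracket P g f x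

/-- The standard polar family `𝒜' = {X_f | f ∈ C^∞(U)^A, U ⊆ M open and A-invariant}`. -/
def polarFamily (P : PoissonStructure E M) (A : Subgroup (Equiv.Perm M)) :
    Set (LocalVectorField E M) :=
  {X | IsInvariant A X.dom ∧ ∃ f : M → ℝ, (∀ φ ∈ A, ∀ x ∈ X.dom, f (φ x) = f x) ∧
    IsHamiltonian P f X}

/-- The polar distribution `A'`. -/
def polarDistribution (P : PoissonStructure E M) (A : Subgroup (Equiv.Perm M)) :
    (z : M) → Submodule ℝ (TangentSpace 𝓘(ℝ, E) z) :=
  distribution (polarFamily P A)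

/-- The standard polar pseudogroup `G_{𝒜'}`. -/
def polarPseudogroup (P : PoissonStructure E M) (A : Subgroup (Equiv.Perm M)) : Set (M →. M) :=
  pseudogroup (polarFamily P A)

end Polar

end

/-!
The polar family is defined by `A`-invariant functions, and `A` consists of Poisson automorphisms.
A map that preserves the bracket carries the Hamiltonian vector field of `g ∘ Θ` to that of `g`
(`IsPoissonAt.mfderiv_vec`), so each `φ ∈ A` maps the members of the polar family to themselves and
their integral curves to integral curves. This is the commutation of `A` with the pseudogroup
(`polar_equivariant`).

Conversely, a flow `F_t` of a Hamiltonian vector field is a local Poisson diffeomorphism. By the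
Jacobi identity the bracket of two functions that are transported by the flow is itself transported
(`chartBracket_transport`), so that `{p ∘ F_t, q ∘ F_t}` and `{p, q} ∘ F_t` agree for short times
(`IsHamiltonian.exists_local_poisson_flow`), and then for all times by connectedness of the time
interval (`IsHamiltonian.exists_germ_of_flowsTo`). This needs local flows that are jointly smooth
in time and space, which are obtained by solving the integral equation of the flow with the inverse
function theorem in a space of continuous curves (`exists_local_flow`).

Both facts give that the pseudogroup preserves the polar distribution: if `F` belongs to it and `f`
is an invariant function on an invariant open set, then so is `f ∘ F⁻¹`, and `F` maps the vector
field of the one to that of the other (`mfderiv_mem_polarDistribution`). Integrability is then the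
orbit theorem. Near a point `z`, compositions of flows of fields that span the distribution at `z`
form a chart (`exists_foliatedParam`) whose plaques lie in orbits of the pseudogroup and are tangent
to the distribution. A map that is tangent to the distribution, in a region where its dimension is
that of the plaques, has locally constant transversal coordinates
(`IsFoliatedParam.eventually_snd_eq`). Therefore the plaques are an atlas of the orbit, the orbit is
an integral manifold of maximal dimension, and every other one lies in a single orbit
(`IsIntegralOfMaxDim.polarRel`). So the leaves are the orbits of the pseudogroup (`sameLeaf_iff`).

Both quotients are then of the same kind: related points are exchanged by germs of Poisson maps that
move each point to a related one, elements of `A` in one case and of the pseudogroup in the other.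
For such a relation brackets of pullbacks are again pullbacks
(`IsPoissonRelation.isPoissonVariety`), and Poisson maps that are compatible with the relation
descend (`IsPoissonRelation.isLocalPoissonDiffeoQuot`).
-/

set_option linter.unusedSectionVars false

noncomputable section

namespace Polar

/-! ### Spaces of curves, extension of smooth germs, Hadamard's lemma -/

section Superposition

universe v
variable {K : Type*} [TopologicalSpace K] [CompactSpace K]

/-- Pointwise application of a continuous family of linear maps to a continuous family of vectors,
as a bounded operator. -/
def pointwiseApply (K : Type*) [TopologicalSpace K] [CompactSpace K] (E F : Type*)
    [NormedAddCommGroup E] [NormedSpace ℝ E] [NormedAddCommGroup F] [NormedSpace ℝ F] :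
    C(K, E →L[ℝ] F) →L[ℝ] C(K, E) →L[ℝ] C(K, F) :=
  LinearMap.mkContinuous₂
    (LinearMap.mk₂ ℝ (fun (A : C(K, E →L[ℝ] F)) (u : C(K, E)) => (⟨fun k => A k (u k), by fun_prop⟩ : C(K, F)))
      (fun A B u => by ext; simp) (fun c A u => by ext; simp)
      (fun A u v => by ext; simp) (fun c A u => by ext; simp)) 1 (by
    intro A u
    rw [ContinuousMap.norm_le _ (by positivity)]
    intro k
    simp only [LinearMap.mk₂_apply, ContinuousMap.coe_mk, one_mul]
    exact (A k).le_of_opNorm_le_of_le (A.norm_coe_le_norm k) (u.norm_coe_le_norm k))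

@[simp] lemma pointwiseApply_apply {E F : Type*} [NormedAddCommGroup E] [NormedSpace ℝ E]
    [NormedAddCommGroup F] [NormedSpace ℝ F] (A : C(K, E →L[ℝ] F)) (u : C(K, E)) (k : K) :
    pointwiseApply K E F A u k = A k (u k) := rfl

/-- The superposition operator `u ↦ f ∘ u`. -/
def superpose (K : Type*) [TopologicalSpace K] {E F : Type*} [TopologicalSpace E]
    [TopologicalSpace F] (f : E → F) (hf : Continuous f) (u : C(K, E)) : C(K, F) :=
  (⟨f, hf⟩ : C(E, F)).comp u

variable {E F : Type v} [NormedAddCommGroup E] [NormedSpace ℝ E]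
  [NormedAddCommGroup F] [NormedSpace ℝ F]

/-- The derivative of a superposition operator is given by the superposition operator of the
derivative. -/
lemma hasFDerivAt_superpose {f : E → F} (hf : ContDiff ℝ 1 f) (u : C(K, E)) :
    HasFDerivAt (superpose K f hf.continuous)
      (pointwiseApply K E F (superpose K (fderiv ℝ f) (hf.continuous_fderiv one_ne_zero) u)) u := by
  have hc : Continuous (superpose K (fderiv ℝ f) (hf.continuous_fderiv one_ne_zero)) :=
    ContinuousMap.continuous_postcomp _
  rw [hasFDerivAt_iff_isLittleO_nhds_zero, Asymptotics.isLittleO_iff]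
  intro ε hε
  obtain ⟨δ, hδ, h⟩ := Metric.mem_nhds_iff.1
    (hc.tendsto u (Metric.ball_mem_nhds
      (superpose K (fderiv ℝ f) (hf.continuous_fderiv one_ne_zero) u) hε))
  filter_upwards [Metric.ball_mem_nhds (0 : C(K, E)) hδ] with w hw
  rw [mem_ball_zero_iff] at hw
  rw [ContinuousMap.norm_le _ (by positivity)]
  intro k
  have key : ∀ x ∈ segment ℝ (u k) (u k + w k), ‖fderiv ℝ f x - fderiv ℝ f (u k)‖ ≤ ε := by
    intro x hx
    rw [segment_eq_image'] at hx
    obtain ⟨s, hs, rfl⟩ := hx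
    have h1 : dist (u + s • w) u < δ := by
      rw [dist_eq_norm, add_sub_cancel_left, norm_smul, Real.norm_of_nonneg hs.1]
      calc s * ‖w‖ ≤ 1 * ‖w‖ := by gcongr; exact hs.2
        _ < δ := by simpa using hw
    have h2 : ‖_‖ ≤ ε := (ContinuousMap.norm_coe_le_norm
      (superpose K (fderiv ℝ f) (hf.continuous_fderiv one_ne_zero) (u + s • w) -
        superpose K (fderiv ℝ f) (hf.continuous_fderiv one_ne_zero) u) k).trans
          (by rw [← dist_eq_norm]; exact (Metric.mem_ball.1 (h h1)).le)
    simpa [superpose] using h2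
  have := (convex_segment (u k) (u k + w k)).norm_image_sub_le_of_norm_fderiv_le'
    (fun x _ => (hf.differentiable one_ne_zero) x) key (left_mem_segment ℝ _ _)
      (right_mem_segment ℝ _ _)
  rw [add_sub_cancel_left] at this
  calc _ = ‖f (u k + w k) - f (u k) - fderiv ℝ f (u k) (w k)‖ := by simp [superpose]
    _ ≤ ε * ‖w k‖ := this
    _ ≤ ε * ‖w‖ := by gcongr; exact w.norm_coe_le_norm k

/-- The induction replaces `f` by its derivative, hence the quantification over the target space. -/
lemma contDiff_superpose_nat (n : ℕ) : ∀ {F : Type v} [NormedAddCommGroup F] [NormedSpace ℝ F]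
    {f : E → F} (hf : ContDiff ℝ ∞ f), ContDiff ℝ n (superpose K f hf.continuous) := by
  induction n with
  | zero =>
    intro F _ _ f hf
    exact contDiff_zero.2 (ContinuousMap.continuous_postcomp _)
  | succ n ih =>
    intro F _ _ f hf
    have hd := fun u => hasFDerivAt_superpose (K := K) (hf.of_le (by exact_mod_cast le_top)) u
    push_cast
    rw [contDiff_succ_iff_fderiv]
    refine ⟨fun u => (hd u).differentiableAt, by simp, ?_⟩
    rw [funext fun u => (hd u).fderiv]
    exact (pointwiseApply K E F).contDiff.comp (ih (f := fderiv ℝ f) (hf.fderiv_right (by simp)))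

/-- Superposition with a smooth map is a smooth operator between spaces of continuous maps. -/
lemma contDiff_superpose {f : E → F} (hf : ContDiff ℝ ∞ f) :
    ContDiff ℝ ∞ (superpose K f hf.continuous) :=
  contDiff_infty.2 fun n => contDiff_superpose_nat n hf

end Superposition

section Integral

variable {E : Type*} [NormedAddCommGroup E] [NormedSpace ℝ E]

/-- The extension by constants of a continuous curve on `[-1, 1]`. -/
def extendCurve (u : C(Icc (-1 : ℝ) 1, E)) : ℝ → E :=
  Set.IccExtend (by norm_num) u

lemma continuous_extendCurve (u : C(Icc (-1 : ℝ) 1, E)) : Continuous (extendCurve u) :=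
  u.continuous.Icc_extend'

lemma extendCurve_of_mem (u : C(Icc (-1 : ℝ) 1, E)) {s : ℝ} (hs : s ∈ Icc (-1 : ℝ) 1) :
    extendCurve u s = u ⟨s, hs⟩ := Set.IccExtend_of_mem _ _ hs

lemma norm_extendCurve_le (u : C(Icc (-1 : ℝ) 1, E)) (s : ℝ) : ‖extendCurve u s‖ ≤ ‖u‖ :=
  u.norm_coe_le_norm _

/-- The integration operator `(J u)(s) = ∫₀ˢ u` on continuous curves over `[-1, 1]`. -/
def integrateCurve (E : Type*) [NormedAddCommGroup E] [NormedSpace ℝ E] :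
    C(Icc (-1 : ℝ) 1, E) →L[ℝ] C(Icc (-1 : ℝ) 1, E) :=
  LinearMap.mkContinuous
    { toFun := fun u => ⟨fun s => ∫ r in (0 : ℝ)..s, extendCurve u r,
        (intervalIntegral.continuous_primitive
          (fun a b => (continuous_extendCurve u).intervalIntegrable a b) 0).comp
            continuous_subtype_val⟩
      map_add' := fun u v => by
        ext s
        simp only [ContinuousMap.coe_mk, ContinuousMap.coe_add, Pi.add_apply]
        rw [← intervalIntegral.integral_add ((continuous_extendCurve u).intervalIntegrable _ _)
          ((continuous_extendCurve v).intervalIntegrable _ _)]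
        rfl
      map_smul' := fun c u => by
        ext s
        simp only [ContinuousMap.coe_mk, ContinuousMap.coe_smul, Pi.smul_apply, RingHom.id_apply]
        rw [← intervalIntegral.integral_smul]
        rfl } 1 (by
    intro u
    rw [ContinuousMap.norm_le _ (by positivity)]
    intro s
    refine (intervalIntegral.norm_integral_le_of_norm_le_const
      (fun x _ => norm_extendCurve_le u x)).trans ?_
    have : |(s : ℝ) - 0| ≤ 1 := by rw [sub_zero, abs_le]; exact s.2
    nlinarith [norm_nonneg u])

lemma integrateCurve_apply (u : C(Icc (-1 : ℝ) 1, E)) (s : Icc (-1 : ℝ) 1) :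
    integrateCurve E u s = ∫ r in (0 : ℝ)..s, extendCurve u r := rfl

end Integral

section Extension

variable {E : Type*} [NormedAddCommGroup E] [NormedSpace ℝ E] [FiniteDimensional ℝ E]
  {F : Type*} [NormedAddCommGroup F] [NormedSpace ℝ F]

/-- A map that is smooth near a point coincides near the point with a globally smooth map. -/
lemma exists_contDiff_eventuallyEq {f : E → F} {U : Set E} (hU : IsOpen U)
    (hf : ContDiffOn ℝ ∞ f U) {x : E} (hx : x ∈ U) :
    ∃ g : E → F, ContDiff ℝ ∞ g ∧ g =ᶠ[𝓝 x] f := by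
  obtain ⟨r, hr, hrU⟩ := Metric.isOpen_iff.1 hU x hx
  let φ : ContDiffBump x := ⟨r / 3, r / 2, by positivity, by linarith⟩
  refine ⟨fun y => φ y • f y, ?_, ?_⟩
  · rw [contDiff_iff_contDiffAt]
    intro y
    by_cases hy : y ∈ Metric.ball x r
    · exact φ.contDiffAt.smul (hf.contDiffAt (hU.mem_nhds (hrU hy)))
    · have : y ∉ tsupport φ := by
        rw [φ.tsupport_eq, Metric.mem_closedBall]
        rw [Metric.mem_ball] at hy
        change ¬ dist y x ≤ r / 2
        linarith
      have h0 : (fun y => φ y • f y) =ᶠ[𝓝 y] fun _ => (0 : F) := by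
        filter_upwards [notMem_tsupport_iff_eventuallyEq.1 this] with z hz
        simp [hz]
      exact contDiffAt_const.congr_of_eventuallyEq h0
  · filter_upwards [φ.eventuallyEq_one] with y hy
    simp [hy]

end Extension

section Hadamard

universe v
variable {E : Type v} [NormedAddCommGroup E] [NormedSpace ℝ E]

/-- Hadamard's lemma: `f y = f x + A(y) (y - x)` with a smooth `A` such that `A(x) = Df(x)`. -/
lemma exists_hadamard {f : E → ℝ} (hf : ContDiff ℝ ∞ f) (x : E) :
    ∃ A : E → E →L[ℝ] ℝ, ContDiff ℝ ∞ A ∧ A x = fderiv ℝ f x ∧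
      ∀ y, f y = f x + A y (y - x) := by
  have hd : ContDiff ℝ ∞ (fderiv ℝ f) := hf.fderiv_right (by simp)
  -- the segment from `x` to `y`, parametrized over `[-1, 1]`, as an affine function of `y`
  let σ : C(Icc (-1 : ℝ) 1, ℝ) := ⟨fun s => s, continuous_subtype_val⟩
  let Λ : E →L[ℝ] C(Icc (-1 : ℝ) 1, E) :=
    (LinearMap.mkContinuous
      { toFun := fun w => ⟨fun s => (s : ℝ) • w, by fun_prop⟩
        map_add' := fun a b => by ext; simp
        map_smul' := fun c a => by ext; simp [smul_comm c] } 1 (by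
      intro w
      rw [ContinuousMap.norm_le _ (by positivity)]
      intro s
      have : |(s : ℝ)| ≤ 1 := abs_le.2 s.2
      simp only [LinearMap.coe_mk, AddHom.coe_mk, ContinuousMap.coe_mk, norm_smul, Real.norm_eq_abs]
      gcongr))
  let γ : E → C(Icc (-1 : ℝ) 1, E) := fun y => ContinuousMap.const _ x + Λ (y - x)
  have hγ : ContDiff ℝ ∞ γ := contDiff_const.add (Λ.contDiff.comp (contDiff_id.sub contDiff_const))
  let ev : C(Icc (-1 : ℝ) 1, E →L[ℝ] ℝ) →L[ℝ] (E →L[ℝ] ℝ) :=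
    ContinuousMap.evalCLM ℝ (⟨1, by norm_num⟩ : Icc (-1 : ℝ) 1)
  let A : E → E →L[ℝ] ℝ := fun y =>
    ev (integrateCurve _ (superpose _ (fderiv ℝ f) hd.continuous (γ y)))
  have hA : ∀ y, A y = ∫ s in (0 : ℝ)..1, fderiv ℝ f (x + s • (y - x)) := by
    intro y
    change ∫ r in (0 : ℝ)..1, _ = _
    refine intervalIntegral.integral_congr fun s hs => ?_
    rw [uIcc_of_le zero_le_one] at hs
    have hs' : s ∈ Icc (-1 : ℝ) 1 := ⟨by linarith [hs.1], hs.2⟩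
    rw [extendCurve_of_mem _ hs']
    rfl
  refine ⟨A, ?_, ?_, ?_⟩
  · exact (ev.contDiff.comp (integrateCurve _).contDiff).comp ((contDiff_superpose hd).comp hγ)
  · simp [hA]
  · intro y
    have hder : ∀ s : ℝ, HasDerivAt (fun s : ℝ => f (x + s • (y - x)))
        (fderiv ℝ f (x + s • (y - x)) (y - x)) s := by
      intro s
      have h1 : HasDerivAt (fun s : ℝ => x + s • (y - x)) (y - x) s := by
        simpa using ((hasDerivAt_id s).smul_const (y - x)).const_add x
      exact ((hf.differentiable (by simp)).differentiableAt.hasFDerivAt).comp_hasDerivAt s h1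
    have hcont : Continuous fun s : ℝ => fderiv ℝ f (x + s • (y - x)) :=
      hd.continuous.comp (by fun_prop)
    have := intervalIntegral.integral_eq_sub_of_hasDerivAt (a := 0) (b := 1)
      (fun s _ => hder s) ((hcont.clm_apply continuous_const).intervalIntegrable _ _)
    rw [hA, ← ContinuousLinearMap.apply_apply (y - x) (∫ s in (0 : ℝ)..1, _),
      ← ContinuousLinearMap.intervalIntegral_comp_comm _ (hcont.intervalIntegrable _ _)]
    simp only [ContinuousLinearMap.apply_apply]
    rw [this]
    simp

end Hadamard

/-! ### Smooth local flows -/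

section LocalFlow

variable {E : Type*} [NormedAddCommGroup E] [NormedSpace ℝ E]

/-- The constant curves on `[-1, 1]`. -/
def constCurve (E : Type*) [NormedAddCommGroup E] [NormedSpace ℝ E] :
    E →L[ℝ] C(Icc (-1 : ℝ) 1, E) :=
  LinearMap.mkContinuous
    { toFun := fun x => ContinuousMap.const _ x
      map_add' := fun _ _ => rfl
      map_smul' := fun _ _ => rfl } 1 (by
    intro x
    rw [ContinuousMap.norm_le _ (by positivity)]
    intro s
    exact (one_mul ‖x‖).ge)

@[simp] lemma constCurve_apply (x : E) (s : Icc (-1 : ℝ) 1) : constCurve E x s = x := rfl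

/-- The integral equation `u = x + λ ∫₀ v(u)` of the flow of `v`, rescaled to the time interval
`[-1, 1]`. The parameter `λ` is the time. -/
def integralEquation {v : E → E} (hv : ContDiff ℝ ∞ v)
    (p : (E × ℝ) × C(Icc (-1 : ℝ) 1, E)) : C(Icc (-1 : ℝ) 1, E) :=
  p.2 - constCurve E p.1.1 - p.1.2 • integrateCurve E (superpose _ v hv.continuous p.2)

lemma contDiff_integralEquation {v : E → E} (hv : ContDiff ℝ ∞ v) :
    ContDiff ℝ ∞ (integralEquation hv) := by
  refine (contDiff_snd.sub ((constCurve E).contDiff.comp (contDiff_fst.comp contDiff_fst))).sub ?_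
  exact (contDiff_snd.comp contDiff_fst).smul
    ((integrateCurve E).contDiff.comp ((contDiff_superpose hv).comp contDiff_snd))

lemma integralEquation_eq_zero_iff {v : E → E} (hv : ContDiff ℝ ∞ v) {x : E} {l : ℝ}
    {u : C(Icc (-1 : ℝ) 1, E)} : integralEquation hv ((x, l), u) = 0 ↔
      ∀ s : Icc (-1 : ℝ) 1, u s = x + l • ∫ r in (0 : ℝ)..s, v (extendCurve u r) := by
  rw [integralEquation, ContinuousMap.ext_iff]
  refine forall_congr' fun s => ?_
  simp only [ContinuousMap.coe_sub, ContinuousMap.coe_smul, Pi.sub_apply, Pi.smul_apply,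
    constCurve_apply, integrateCurve_apply, ContinuousMap.coe_zero, Pi.zero_apply]
  rw [sub_sub, sub_eq_zero]
  rfl

/-- At time zero the partial derivative of the integral equation with respect to the unknown curve
is the identity, so that the inverse function theorem applies to it. -/
lemma hasFDerivAt_integralEquation {v : E → E} (hv : ContDiff ℝ ∞ v) (x : E) :
    ∃ L : E × ℝ →L[ℝ] C(Icc (-1 : ℝ) 1, E),
      HasFDerivAt (fun p => (p.1, integralEquation hv p))
        (((ContinuousLinearEquiv.refl ℝ (E × ℝ)).skewProd
          (ContinuousLinearEquiv.refl ℝ C(Icc (-1 : ℝ) 1, E)) L :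
          ((E × ℝ) × C(Icc (-1 : ℝ) 1, E)) ≃L[ℝ] _) :
          ((E × ℝ) × C(Icc (-1 : ℝ) 1, E)) →L[ℝ] (E × ℝ) × C(Icc (-1 : ℝ) 1, E))
        ((x, 0), constCurve E x) := by
  set w := integrateCurve E (superpose _ v hv.continuous (constCurve E x)) with hw
  refine ⟨-(constCurve E).comp (ContinuousLinearMap.fst ℝ E ℝ) -
    (ContinuousLinearMap.snd ℝ E ℝ).smulRight w, ?_⟩
  have hS : DifferentiableAt ℝ (fun p : (E × ℝ) × C(Icc (-1 : ℝ) 1, E) =>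
      integrateCurve E (superpose _ v hv.continuous p.2)) ((x, 0), constCurve E x) :=
    (((integrateCurve E).contDiff.comp ((contDiff_superpose hv).comp contDiff_snd)).differentiable
      (by simp)).differentiableAt
  have h1 : HasFDerivAt (fun p : (E × ℝ) × C(Icc (-1 : ℝ) 1, E) => p.1.2)
      ((ContinuousLinearMap.snd ℝ E ℝ).comp (ContinuousLinearMap.fst ℝ _ _))
      ((x, 0), constCurve E x) := hasFDerivAt_snd.comp _ hasFDerivAt_fst
  have h2 : HasFDerivAt (fun p : (E × ℝ) × C(Icc (-1 : ℝ) 1, E) => constCurve E p.1.1)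
      ((constCurve E).comp ((ContinuousLinearMap.fst ℝ E ℝ).comp (ContinuousLinearMap.fst ℝ _ _)))
      ((x, 0), constCurve E x) :=
    (constCurve E).hasFDerivAt.comp _ (hasFDerivAt_fst.comp _ hasFDerivAt_fst)
  have h3 := hasFDerivAt_fst.prodMk ((hasFDerivAt_snd.sub h2).sub (h1.smul hS.hasFDerivAt))
  refine HasFDerivAt.congr_fderiv h3 ?_
  refine ContinuousLinearMap.ext fun p => ?_
  simp only [ContinuousLinearMap.prod_apply, ContinuousLinearEquiv.coe_coe,
    ContinuousLinearEquiv.skewProd_apply]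
  refine Prod.ext rfl ?_
  simp [← hw]
  abel

/-- Smooth vector fields on Banach spaces have local flows that are jointly smooth in time and
space. -/
theorem exists_local_flow_of_contDiff [CompleteSpace E] {v : E → E} (hv : ContDiff ℝ ∞ v) (x₀ : E) :
    ∃ ε > 0, ∃ U : Set E, IsOpen U ∧ x₀ ∈ U ∧ ∃ θ : ℝ × E → E,
      ContDiffOn ℝ ∞ θ (Ioo (-ε) ε ×ˢ U) ∧ (∀ x ∈ U, θ (0, x) = x) ∧
      ∀ x ∈ U, ∀ t ∈ Ioo (-ε) ε, HasDerivAt (fun s => θ (s, x)) (v (θ (t, x))) t := by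
  classical
  set C := C(Icc (-1 : ℝ) 1, E)
  set H : (E × ℝ) × C → (E × ℝ) × C := fun p => (p.1, integralEquation hv p) with hH
  have hHs : ContDiff ℝ ∞ H := contDiff_fst.prodMk (contDiff_integralEquation hv)
  obtain ⟨L, hL⟩ := hasFDerivAt_integralEquation hv x₀
  have hL' := hHs.contDiffAt.hasStrictFDerivAt' hL (by simp)
  set Φ := hL'.toOpenPartialHomeomorph H
  have hΦ : ∀ p, Φ p = H p := fun p => rfl
  set p₀ : (E × ℝ) × C := ((x₀, 0), constCurve E x₀)
  have hp₀ : p₀ ∈ Φ.source := hL'.mem_toOpenPartialHomeomorph_source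
  have hHp₀ : H p₀ = ((x₀, 0), 0) := by
    refine Prod.ext rfl ?_
    change integralEquation hv ((x₀, 0), constCurve E x₀) = 0
    rw [integralEquation_eq_zero_iff]
    simp
  -- the points near `p₀` where `H` is a local diffeomorphism
  have hopen : IsOpen {p | fderiv ℝ H p ∈ range (ContinuousLinearEquiv.toContinuousLinearMap :
      (((E × ℝ) × C) ≃L[ℝ] ((E × ℝ) × C)) → _)} :=
    ContinuousLinearEquiv.isOpen.preimage (hHs.continuous_fderiv (by simp))
  have hmem : p₀ ∈ {p | fderiv ℝ H p ∈ range (ContinuousLinearEquiv.toContinuousLinearMap :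
      (((E × ℝ) × C) ≃L[ℝ] ((E × ℝ) × C)) → _)} := ⟨_, hL.fderiv.symm⟩
  obtain ⟨r, hr, hrN⟩ := Metric.isOpen_iff.1 (hopen.inter Φ.open_source) p₀ ⟨hmem, hp₀⟩
  have htgt : ((x₀, (0 : ℝ)), (0 : C)) ∈ Φ.target := by
    rw [← hHp₀, ← hΦ]; exact Φ.map_source hp₀
  have hsymm : Φ.symm ((x₀, (0 : ℝ)), (0 : C)) = p₀ := by
    rw [← hHp₀, ← hΦ]; exact Φ.left_inv hp₀
  have hnear : Φ.target ∩ Φ.symm ⁻¹' (Metric.ball p₀ r) ∈ 𝓝 ((x₀, (0 : ℝ)), (0 : C)) := by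
    refine inter_mem (Φ.open_target.mem_nhds htgt) ?_
    refine (Φ.continuousAt_symm htgt).preimage_mem_nhds ?_
    rw [hsymm]
    exact Metric.ball_mem_nhds _ hr
  obtain ⟨δ, hδ, hδN⟩ := Metric.mem_nhds_iff.1 hnear
  have hin : ∀ x ∈ Metric.ball x₀ δ, ∀ l ∈ Ioo (-δ) δ,
      (((x, l), (0 : C)) ∈ Φ.target ∧ Φ.symm ((x, l), (0 : C)) ∈ Metric.ball p₀ r) := by
    intro x hx l hl
    refine hδN ?_
    rw [Metric.mem_ball, Prod.dist_eq, Prod.dist_eq]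
    simp only [dist_self, max_lt_iff, hδ, and_true]
    exact ⟨hx, by rw [Real.dist_eq, sub_zero, abs_lt]; exact hl⟩
  -- `ψ x l` is the integral curve through `x` in the time scale `l`
  set ψ : E → ℝ → C := fun x l => (Φ.symm ((x, l), 0)).2 with hψ
  have hΦψ : ∀ x ∈ Metric.ball x₀ δ, ∀ l ∈ Ioo (-δ) δ, Φ.symm ((x, l), 0) = ((x, l), ψ x l) ∧
      integralEquation hv ((x, l), ψ x l) = 0 := by
    intro x hx l hl
    have h1 := Φ.right_inv (hin x hx l hl).1
    rw [hΦ] at h1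
    have h2 : (Φ.symm ((x, l), 0)).1 = (x, l) := congrArg Prod.fst h1
    have h3 : Φ.symm ((x, l), 0) = ((x, l), ψ x l) := Prod.ext h2 rfl
    refine ⟨h3, ?_⟩
    rw [h3] at h1
    exact congrArg Prod.snd h1
  have hψball : ∀ x ∈ Metric.ball x₀ δ, ∀ l ∈ Ioo (-δ) δ,
      dist x x₀ < r ∧ |l| < r ∧ dist (ψ x l) (constCurve E x₀) < r := by
    intro x hx l hl
    have := (hin x hx l hl).2
    rw [(hΦψ x hx l hl).1, Metric.mem_ball, Prod.dist_eq, Prod.dist_eq] at this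
    simp only [max_lt_iff, p₀] at this
    exact ⟨this.1.1, by simpa using this.1.2, this.2⟩
  set one : Icc (-1 : ℝ) 1 := ⟨1, by norm_num⟩
  -- rescaling of time, by uniqueness of the solution of the integral equation
  have hscale : ∀ x ∈ Metric.ball x₀ δ, ∀ l ∈ Ioo (-δ) δ, ∀ s : Icc (-1 : ℝ) 1,
      ψ x (l * s) one = ψ x l s := by
    intro x hx l hl s
    have hs1 : |(s : ℝ)| ≤ 1 := abs_le.2 s.2
    have hls : |l * s| ≤ |l| := by
      rw [abs_mul]; nlinarith [abs_nonneg l]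
    have hl' : l * s ∈ Ioo (-δ) δ := by
      exact abs_lt.1 (hls.trans_lt (abs_lt.2 hl))
    have hmul : ∀ k : Icc (-1 : ℝ) 1, (s : ℝ) * k ∈ Icc (-1 : ℝ) 1 := by
      intro k
      refine abs_le.1 ?_
      rw [abs_mul]
      have := abs_le.2 k.2
      nlinarith [abs_nonneg (s : ℝ), abs_nonneg (k : ℝ)]
    let w : C := ⟨fun k => ψ x l ⟨s * k, hmul k⟩, by fun_prop⟩
    have hw0 : integralEquation hv ((x, l * s), w) = 0 := by
      rw [integralEquation_eq_zero_iff]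
      intro k
      change ψ x l ⟨s * k, hmul k⟩ = _
      rw [(integralEquation_eq_zero_iff hv).1 (hΦψ x hx l hl).2, mul_smul]
      congr 2
      have := intervalIntegral.smul_integral_comp_mul_left (a := 0) (b := (k : ℝ))
        (fun r => v (extendCurve (ψ x l) r)) (s : ℝ)
      rw [mul_zero] at this
      rw [← this]
      congr 1
      refine intervalIntegral.integral_congr fun a ha => ?_
      have ha' : a ∈ Icc (-1 : ℝ) 1 :=
        (uIcc_subset_Icc (by norm_num) k.2) ha
      rw [extendCurve_of_mem _ ha', extendCurve_of_mem _ (hmul ⟨a, ha'⟩)]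
      rfl
    have hwsrc : ((x, l * s), w) ∈ Φ.source := by
      refine (hrN ?_).2
      obtain ⟨b1, b2, b3⟩ := hψball x hx l hl
      rw [Metric.mem_ball, Prod.dist_eq, Prod.dist_eq]
      simp only [max_lt_iff, p₀]
      refine ⟨⟨b1, by simpa using hls.trans_lt b2⟩, ?_⟩
      refine lt_of_le_of_lt ?_ b3
      rw [ContinuousMap.dist_le dist_nonneg]
      intro k
      exact ContinuousMap.dist_apply_le_dist (f := ψ x l) (g := constCurve E x₀) ⟨s * k, hmul k⟩
    have hψsrc : ((x, l * s), ψ x (l * s)) ∈ Φ.source := by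
      rw [← (hΦψ x hx _ hl').1]; exact Φ.map_target (hin x hx _ hl').1
    have heq : Φ ((x, l * s), w) = Φ ((x, l * s), ψ x (l * s)) := by
      rw [hΦ, hΦ]
      simp only [hH, hw0, (hΦψ x hx _ hl').2]
    have hwψ : w = ψ x (l * s) := congrArg Prod.snd (Φ.injOn hwsrc hψsrc heq)
    rw [← hwψ]
    change ψ x l _ = _
    congr 1
    exact Subtype.ext (mul_one _)
  refine ⟨δ, hδ, Metric.ball x₀ δ, Metric.isOpen_ball, Metric.mem_ball_self hδ,
    fun p => ψ p.2 p.1 one, ?_, ?_, ?_⟩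
  · rintro ⟨t, x⟩ ⟨ht, hx⟩
    have hb := hrN (hin x hx t ht).2
    obtain ⟨e, he⟩ := hb.1
    have hd : HasFDerivAt Φ (e : ((E × ℝ) × C) →L[ℝ] _) (Φ.symm ((x, t), 0)) := by
      rw [he]
      exact (hHs.differentiable (by simp)).differentiableAt.hasFDerivAt
    have h1 : ContDiffAt ℝ ∞ Φ.symm ((x, t), (0 : C)) :=
      Φ.contDiffAt_symm (hin x hx t ht).1 hd hHs.contDiffAt
    have h2 : ContDiffAt ℝ ∞ (fun p : ℝ × E => Φ.symm ((p.2, p.1), (0 : C))) (t, x) :=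
      ContDiffAt.comp (t, x) h1
        ((contDiff_snd.prodMk contDiff_fst).prodMk contDiff_const).contDiffAt
    exact ((ContinuousMap.evalCLM ℝ one).contDiff.contDiffAt.comp (t, x)
      (contDiff_snd.contDiffAt.comp (t, x) h2)).contDiffWithinAt
  · intro x hx
    have h0 : (0 : ℝ) ∈ Ioo (-δ) δ := ⟨by linarith, hδ⟩
    change ψ x 0 one = x
    rw [(integralEquation_eq_zero_iff hv).1 (hΦψ x hx 0 h0).2, zero_smul, add_zero]
  · intro x hx t ht
    obtain ⟨l, htl, hlδ⟩ := exists_between (abs_lt.2 ht)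
    have hl0 : 0 < l := (abs_nonneg t).trans_lt htl
    have hl : l ∈ Ioo (-δ) δ := ⟨by linarith, hlδ⟩
    have hdiv : ∀ a ∈ Ioo (-l) l, a / l ∈ Icc (-1 : ℝ) 1 := by
      intro a ha
      rw [mem_Icc, le_div_iff₀ hl0, div_le_iff₀ hl0]
      constructor <;> linarith [ha.1, ha.2]
    have hval : ∀ a (ha : a ∈ Ioo (-l) l), ψ x a one = ψ x l ⟨a / l, hdiv a ha⟩ := by
      intro a ha
      rw [← hscale x hx l hl]
      congr 2
      field_simp
    set g : ℝ → E := fun r => v (extendCurve (ψ x l) r)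
    have hg : Continuous g := hv.continuous.comp (continuous_extendCurve _)
    have hform : (fun a => ψ x a one) =ᶠ[𝓝 t] fun a => x + l • ∫ r in (0 : ℝ)..(l⁻¹ * a), g r := by
      filter_upwards [isOpen_Ioo.mem_nhds (abs_lt.1 htl)] with a ha
      rw [hval a ha, (integralEquation_eq_zero_iff hv).1 (hΦψ x hx l hl).2]
      simp only [g, div_eq_inv_mul]
    have h1 : HasDerivAt (fun a : ℝ => l⁻¹ * a) l⁻¹ t := by
      simpa using (hasDerivAt_id t).const_mul l⁻¹
    have h2 := (intervalIntegral.integral_hasDerivAt_right (hg.intervalIntegrable 0 (l⁻¹ * t))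
      (hg.stronglyMeasurableAtFilter _ _) hg.continuousAt).scomp t h1
    have h3 := ((h2.const_smul l).const_add x).congr_of_eventuallyEq hform
    have h4 : l • l⁻¹ • g (l⁻¹ * t) = v (ψ x t one) := by
      rw [smul_smul, mul_inv_cancel₀ hl0.ne', one_smul, hval t (abs_lt.1 htl)]
      simp only [g]
      rw [← div_eq_inv_mul, extendCurve_of_mem _ (hdiv t (abs_lt.1 htl))]
    rw [h4] at h3
    exact h3

/-- The local flow of a vector field that is smooth on an open subset of a finite-dimensional
space. -/
theorem exists_local_flow [FiniteDimensional ℝ E] {O : Set E} (hO : IsOpen O) {v : E → E}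
    (hv : ContDiffOn ℝ ∞ v O) {x₀ : E} (hx₀ : x₀ ∈ O) :
    ∃ ε > 0, ∃ U : Set E, IsOpen U ∧ x₀ ∈ U ∧ ∃ θ : ℝ × E → E,
      ContDiffOn ℝ ∞ θ (Ioo (-ε) ε ×ˢ U) ∧ (∀ x ∈ U, θ (0, x) = x) ∧
      MapsTo θ (Ioo (-ε) ε ×ˢ U) O ∧
      ∀ x ∈ U, ∀ t ∈ Ioo (-ε) ε, HasDerivAt (fun s => θ (s, x)) (v (θ (t, x))) t := by
  have : CompleteSpace E := FiniteDimensional.complete ℝ E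
  obtain ⟨w, hw, hwv⟩ := exists_contDiff_eventuallyEq hO hv hx₀
  obtain ⟨O', hO'sub, hO', hx₀'⟩ := mem_nhds_iff.1 (inter_mem (hO.mem_nhds hx₀) hwv)
  obtain ⟨ε, hε, U, hU, hxU, θ, hθ, hθ0, hθd⟩ := exists_local_flow_of_contDiff hw x₀
  have hopen : IsOpen (Ioo (-ε) ε ×ˢ U) := isOpen_Ioo.prod hU
  have h0 : (0, x₀) ∈ Ioo (-ε) ε ×ˢ U := ⟨⟨by linarith, hε⟩, hxU⟩
  have hnear : (Ioo (-ε) ε ×ˢ U) ∩ θ ⁻¹' O' ∈ 𝓝 ((0 : ℝ), x₀) := by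
    refine inter_mem (hopen.mem_nhds h0) ?_
    refine (hθ.contDiffAt (hopen.mem_nhds h0)).continuousAt.preimage_mem_nhds ?_
    rw [hθ0 _ hxU]
    exact hO'.mem_nhds hx₀'
  obtain ⟨δ, hδ, hδs⟩ := Metric.mem_nhds_iff.1 hnear
  have hsub : ∀ t ∈ Ioo (-δ) δ, ∀ x ∈ Metric.ball x₀ δ,
      (t, x) ∈ (Ioo (-ε) ε ×ˢ U) ∩ θ ⁻¹' O' := by
    intro t ht x hx
    refine hδs ?_
    rw [Metric.mem_ball, Prod.dist_eq, max_lt_iff]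
    exact ⟨by rw [Real.dist_eq, sub_zero, abs_lt]; exact ht, hx⟩
  refine ⟨δ, hδ, Metric.ball x₀ δ, Metric.isOpen_ball, Metric.mem_ball_self hδ, θ,
    hθ.mono fun p hp => (hsub p.1 hp.1 p.2 hp.2).1, ?_, ?_, ?_⟩
  · intro x hx
    exact hθ0 x (hsub 0 ⟨by linarith, hδ⟩ x hx).1.2
  · intro p hp
    exact (hO'sub (hsub p.1 hp.1 p.2 hp.2).2).1
  · intro x hx t ht
    have h := hsub t ht x hx
    have h2 : w (θ (t, x)) = v (θ (t, x)) := (hO'sub h.2).2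
    rw [← h2]
    exact hθd x h.1.2 t h.1.1

end LocalFlow

/-! ### The bracket as a local operation and in coordinates -/

section Bracket

variable {E : Type*} [NormedAddCommGroup E] [NormedSpace ℝ E]
  {M : Type*} [TopologicalSpace M] [ChartedSpace E M]

/-- `f` coincides near `x` with a smooth function on the whole manifold. -/
def GermSmooth (E : Type*) [NormedAddCommGroup E] [NormedSpace ℝ E]
    {M : Type*} [TopologicalSpace M] [ChartedSpace E M] (f : M → ℝ) (x : M) : Prop :=
  ∃ p : Smooth E M, (p : M → ℝ) =ᶠ[𝓝 x] f

lemma Smooth.germSmooth (p : Smooth E M) (x : M) : GermSmooth E (p : M → ℝ) x :=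
  ⟨p, EventuallyEq.rfl⟩

lemma GermSmooth.congr {f g : M → ℝ} {x : M} (hf : GermSmooth E f x) (h : f =ᶠ[𝓝 x] g) :
    GermSmooth E g x := by
  obtain ⟨p, hp⟩ := hf
  exact ⟨p, hp.trans h⟩

lemma GermSmooth.eventually {f : M → ℝ} {x : M} (hf : GermSmooth E f x) :
    ∀ᶠ y in 𝓝 x, GermSmooth E f y := by
  obtain ⟨p, hp⟩ := hf
  filter_upwards [hp.eventually_nhds] with y hy
  exact ⟨p, hy⟩

lemma GermSmooth.contMDiffAt {f : M → ℝ} {x : M} (hf : GermSmooth E f x) :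
    ContMDiffAt 𝓘(ℝ, E) 𝓘(ℝ, ℝ) ∞ f x := by
  obtain ⟨p, hp⟩ := hf
  exact p.contMDiff.contMDiffAt.congr_of_eventuallyEq hp.symm

lemma GermSmooth.mdifferentiableAt {f : M → ℝ} {x : M} (hf : GermSmooth E f x) :
    MDifferentiableAt 𝓘(ℝ, E) 𝓘(ℝ, ℝ) f x := hf.contMDiffAt.mdifferentiableAt (by simp)

lemma GermSmooth.add {f g : M → ℝ} {x : M} (hf : GermSmooth E f x) (hg : GermSmooth E g x) :
    GermSmooth E (f + g) x := by
  obtain ⟨p, hp⟩ := hf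
  obtain ⟨q, hq⟩ := hg
  exact ⟨p + q, hp.add hq⟩

lemma GermSmooth.mul {f g : M → ℝ} {x : M} (hf : GermSmooth E f x) (hg : GermSmooth E g x) :
    GermSmooth E (f * g) x := by
  obtain ⟨p, hp⟩ := hf
  obtain ⟨q, hq⟩ := hg
  exact ⟨p * q, hp.mul hq⟩

lemma GermSmooth.smul {f : M → ℝ} {x : M} (c : ℝ) (hf : GermSmooth E f x) :
    GermSmooth E (c • f) x := by
  obtain ⟨p, hp⟩ := hf
  exact ⟨c • p, hp.const_smul c⟩

open Classical in
/-- The bracket of germs depends on the germs only. -/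
lemma localBracket_congr (P : PoissonStructure E M) {f f' g g' : M → ℝ} {x : M}
    (hf : f =ᶠ[𝓝 x] f') (hg : g =ᶠ[𝓝 x] g') :
    localBracket P f g x = localBracket P f' g' x := by
  have : (fun p : Smooth E M × Smooth E M => (p.1 : M → ℝ) =ᶠ[𝓝 x] f ∧ (p.2 : M → ℝ) =ᶠ[𝓝 x] g) =
      (fun p => (p.1 : M → ℝ) =ᶠ[𝓝 x] f' ∧ (p.2 : M → ℝ) =ᶠ[𝓝 x] g') := by
    funext p
    exact propext ⟨fun h => ⟨h.1.trans hf, h.2.trans hg⟩,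
      fun h => ⟨h.1.trans hf.symm, h.2.trans hg.symm⟩⟩
  have key : ∀ Q Q' : Smooth E M × Smooth E M → Prop, Q = Q' →
      (if h : ∃ p, Q p then P.br h.choose.1 h.choose.2 x else 0) =
        (if h : ∃ p, Q' p then P.br h.choose.1 h.choose.2 x else 0) := by
    rintro Q _ rfl
    rfl
  exact key _ _ this

lemma PoissonBracket.antisymm {R : Type*} [CommRing R] [Algebra ℝ R] (P : PoissonBracket R)
    (f g : R) : P.br f g = -P.br g f := by
  have h := P.alternating (f + g)
  simp only [map_add, LinearMap.add_apply, P.alternating, zero_add, add_zero] at h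
  exact eq_neg_of_add_eq_zero_right h

lemma PoissonBracket.one_left {R : Type*} [CommRing R] [Algebra ℝ R] (P : PoissonBracket R)
    (g : R) : P.br 1 g = 0 := by
  simpa using P.leibniz 1 1 g

lemma PoissonBracket.algebraMap_left {R : Type*} [CommRing R] [Algebra ℝ R] (P : PoissonBracket R)
    (c : ℝ) (g : R) : P.br (algebraMap ℝ R c) g = 0 := by
  rw [Algebra.algebraMap_eq_smul_one, map_smul, LinearMap.smul_apply, P.one_left, smul_zero]

variable [FiniteDimensional ℝ E] [T2Space M] [IsManifold 𝓘(ℝ, E) ∞ M]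

lemma germSmooth_of_smoothOn {U : Set M} (hU : IsOpen U) {f : M → ℝ} (hf : SmoothOn E U f) {x : M}
    (hx : x ∈ U) : GermSmooth E f x := by
  obtain ⟨b, -, hb⟩ := (SmoothBumpFunction.nhds_basis_tsupport (I := 𝓘(ℝ, E)) x).mem_iff.1
    (hU.mem_nhds hx)
  refine ⟨⟨fun y => b y • f y, contMDiff_of_tsupport fun y hy => ?_⟩, ?_⟩
  · exact b.contMDiff.contMDiffAt.smul
      (hf.contMDiffAt (hU.mem_nhds (hb (tsupport_smul_subset_left _ _ hy))))
  · filter_upwards [b.eventuallyEq_one] with y hy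
    simp [hy]

lemma germSmooth_of_eventually {f : M → ℝ} {x : M}
    (h : ∀ᶠ y in 𝓝 x, ContMDiffAt 𝓘(ℝ, E) 𝓘(ℝ, ℝ) ∞ f y) : GermSmooth E f x := by
  obtain ⟨U, hUs, hU, hx⟩ := mem_nhds_iff.1 h
  exact germSmooth_of_smoothOn hU (fun y hy => (hUs hy).contMDiffWithinAt) hx

lemma smoothOn_iff_germSmooth {U : Set M} (hU : IsOpen U) {f : M → ℝ} :
    SmoothOn E U f ↔ ∀ x ∈ U, GermSmooth E f x :=
  ⟨fun h _ hx => germSmooth_of_smoothOn hU h hx,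
    fun h x hx => (h x hx).contMDiffAt.contMDiffWithinAt⟩

/-- Locality of the bracket: multiplication by a bump function supported where `p` vanishes. -/
lemma br_eq_zero_of_eventuallyEq (P : PoissonStructure E M) {p : Smooth E M} (q : Smooth E M)
    {x : M} (hp : (p : M → ℝ) =ᶠ[𝓝 x] 0) : P.br p q x = 0 := by
  obtain ⟨b, -, hb⟩ := (SmoothBumpFunction.nhds_basis_tsupport (I := 𝓘(ℝ, E)) x).mem_iff.1 hp
  let β : Smooth E M := ⟨b, b.contMDiff⟩
  have h0 : β * p = 0 := by
    ext y
    change b y * p y = 0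
    by_cases hy : y ∈ tsupport b
    · have hpy : p y = 0 := hb hy
      rw [hpy, mul_zero]
    · rw [image_eq_zero_of_notMem_tsupport hy, zero_mul]
  have h1 := P.leibniz β p q
  rw [h0, map_zero, LinearMap.zero_apply] at h1
  have h2 := congrArg (fun r : Smooth E M => r x) h1
  have h3 : β x = 1 := b.eq_one
  have h4 : p x = 0 := hp.self_of_nhds
  simp only [ContMDiffMap.coe_add, ContMDiffMap.coe_mul, Pi.add_apply, Pi.mul_apply, h3, h4,
    mul_zero, add_zero, one_mul] at h2
  exact h2.symm

lemma br_congr (P : PoissonStructure E M) {p p' q q' : Smooth E M} {x : M}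
    (hp : (p : M → ℝ) =ᶠ[𝓝 x] p') (hq : (q : M → ℝ) =ᶠ[𝓝 x] q') :
    P.br p q x = P.br p' q' x := by
  have h1 : ∀ {p p' : Smooth E M} (q : Smooth E M), (p : M → ℝ) =ᶠ[𝓝 x] p' →
      P.br p q x = P.br p' q x := by
    intro p p' q hp
    have h := br_eq_zero_of_eventuallyEq P (p := p - p') q (x := x) (by
      filter_upwards [hp] with y hy
      simp [hy])
    rw [map_sub, LinearMap.sub_apply] at h
    exact sub_eq_zero.1 h
  have h2 : ∀ p q : Smooth E M, P.br p q x = -P.br q p x := fun p q => by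
    rw [P.antisymm]; rfl
  rw [h1 q hp, h2, h1 p' hq, ← h2]

lemma localBracket_eq (P : PoissonStructure E M) {p q : Smooth E M} {f g : M → ℝ} {x : M}
    (hp : (p : M → ℝ) =ᶠ[𝓝 x] f) (hq : (q : M → ℝ) =ᶠ[𝓝 x] g) :
    localBracket P f g x = P.br p q x := by
  have h : ∃ p : Smooth E M × Smooth E M, (p.1 : M → ℝ) =ᶠ[𝓝 x] f ∧ (p.2 : M → ℝ) =ᶠ[𝓝 x] g :=
    ⟨(p, q), hp, hq⟩
  rw [localBracket, dif_pos h]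
  exact br_congr P (h.choose_spec.1.trans hp.symm) (h.choose_spec.2.trans hq.symm)

lemma localBracket_eventuallyEq (P : PoissonStructure E M) {p q : Smooth E M} {f g : M → ℝ} {x : M}
    (hp : (p : M → ℝ) =ᶠ[𝓝 x] f) (hq : (q : M → ℝ) =ᶠ[𝓝 x] g) :
    (P.br p q : M → ℝ) =ᶠ[𝓝 x] localBracket P f g := by
  filter_upwards [hp.eventually_nhds, hq.eventually_nhds] with y h1 h2
  exact (localBracket_eq P h1 h2).symm

lemma GermSmooth.localBracket (P : PoissonStructure E M) {f g : M → ℝ} {x : M}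
    (hf : GermSmooth E f x) (hg : GermSmooth E g x) : GermSmooth E (localBracket P f g) x := by
  obtain ⟨p, hp⟩ := hf
  obtain ⟨q, hq⟩ := hg
  exact ⟨P.br p q, localBracket_eventuallyEq P hp hq⟩

lemma localBracket_add_left (P : PoissonStructure E M) {f g h : M → ℝ} {x : M}
    (hf : GermSmooth E f x) (hg : GermSmooth E g x) (hh : GermSmooth E h x) :
    localBracket P (f + g) h x = localBracket P f h x + localBracket P g h x := by
  obtain ⟨p, hp⟩ := hf
  obtain ⟨q, hq⟩ := hg
  obtain ⟨r, hr⟩ := hh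
  rw [localBracket_eq P hp hr, localBracket_eq P hq hr,
    localBracket_eq P (p := p + q) (hp.add hq) hr, map_add]
  rfl

lemma localBracket_smul_left (P : PoissonStructure E M) (c : ℝ) {f g : M → ℝ} {x : M}
    (hf : GermSmooth E f x) (hg : GermSmooth E g x) :
    localBracket P (c • f) g x = c * localBracket P f g x := by
  obtain ⟨p, hp⟩ := hf
  obtain ⟨q, hq⟩ := hg
  rw [localBracket_eq P hp hq, localBracket_eq P (p := c • p) (hp.const_smul c) hq, map_smul]
  rfl

lemma localBracket_antisymm (P : PoissonStructure E M) {f g : M → ℝ} {x : M}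
    (hf : GermSmooth E f x) (hg : GermSmooth E g x) :
    localBracket P f g x = -localBracket P g f x := by
  obtain ⟨p, hp⟩ := hf
  obtain ⟨q, hq⟩ := hg
  rw [localBracket_eq P hp hq, localBracket_eq P hq hp, P.antisymm]
  rfl

lemma localBracket_leibniz (P : PoissonStructure E M) {f g h : M → ℝ} {x : M}
    (hf : GermSmooth E f x) (hg : GermSmooth E g x) (hh : GermSmooth E h x) :
    localBracket P (f * g) h x = f x * localBracket P g h x + localBracket P f h x * g x := by
  obtain ⟨p, hp⟩ := hf
  obtain ⟨q, hq⟩ := hg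
  obtain ⟨r, hr⟩ := hh
  rw [localBracket_eq P hp hr, localBracket_eq P hq hr,
    localBracket_eq P (p := p * q) (hp.mul hq) hr, P.leibniz, ← hp.self_of_nhds,
    ← hq.self_of_nhds]
  rfl

lemma localBracket_jacobi (P : PoissonStructure E M) {f g h : M → ℝ} {x : M}
    (hf : GermSmooth E f x) (hg : GermSmooth E g x) (hh : GermSmooth E h x) :
    localBracket P f (localBracket P g h) x + localBracket P g (localBracket P h f) x +
      localBracket P h (localBracket P f g) x = 0 := by
  obtain ⟨p, hp⟩ := hf
  obtain ⟨q, hq⟩ := hg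
  obtain ⟨r, hr⟩ := hh
  rw [localBracket_eq P hp (localBracket_eventuallyEq P hq hr),
    localBracket_eq P hq (localBracket_eventuallyEq P hr hp),
    localBracket_eq P hr (localBracket_eventuallyEq P hp hq)]
  exact congrArg (fun r : Smooth E M => r x) (P.jacobi p q r)

/-- The bracket with `h` is a derivation of the bracket. -/
lemma localBracket_derivation (P : PoissonStructure E M) {f g h : M → ℝ} {x : M}
    (hf : GermSmooth E f x) (hg : GermSmooth E g x) (hh : GermSmooth E h x) :
    localBracket P (localBracket P f g) h x =
      localBracket P (localBracket P f h) g x + localBracket P f (localBracket P g h) x := by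
  have hj := localBracket_jacobi P hf hg hh
  have h1 := localBracket_antisymm P hh (hf.localBracket P hg)
  have h2 : localBracket P g (localBracket P h f) x = localBracket P (localBracket P f h) g x := by
    obtain ⟨p, hp⟩ := hf
    obtain ⟨q, hq⟩ := hg
    obtain ⟨r, hr⟩ := hh
    rw [localBracket_eq P hq (localBracket_eventuallyEq P hr hp),
      localBracket_eq P (localBracket_eventuallyEq P hp hr) hq, P.antisymm q, P.antisymm p r,
      map_neg, LinearMap.neg_apply]
  linarith

end Bracket

section Coordinates

variable {E : Type*} [NormedAddCommGroup E] [NormedSpace ℝ E] [FiniteDimensional ℝ E]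
  {M : Type*} [TopologicalSpace M] [T2Space M] [ChartedSpace E M] [IsManifold 𝓘(ℝ, E) ∞ M]

/-- A basis of the model space. -/
abbrev modelBasis (E : Type*) [NormedAddCommGroup E] [NormedSpace ℝ E] [FiniteDimensional ℝ E] :
    Module.Basis (Fin (Module.finrank ℝ E)) ℝ E := Module.finBasis ℝ E

/-- The coordinates of the model space with respect to `modelBasis`. -/
def modelCoord (E : Type*) [NormedAddCommGroup E] [NormedSpace ℝ E] [FiniteDimensional ℝ E]
    (i : Fin (Module.finrank ℝ E)) : E →L[ℝ] ℝ :=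
  LinearMap.toContinuousLinearMap ((modelBasis E).coord i)

lemma sum_modelCoord_smul (w : E) : ∑ i, modelCoord E i w • modelBasis E i = w :=
  (modelBasis E).sum_repr w

lemma map_eq_sum_modelCoord {F : Type*} [NormedAddCommGroup F] [NormedSpace ℝ F] (L : E →L[ℝ] F)
    (w : E) : L w = ∑ i, modelCoord E i w • L (modelBasis E i) := by
  conv_lhs => rw [← sum_modelCoord_smul w]
  rw [map_sum]
  simp only [map_smul]

omit [FiniteDimensional ℝ E] [T2Space M] in
lemma contMDiffAt_chart {z x : M} (hx : x ∈ (chartAt E z).source) :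
    ContMDiffAt 𝓘(ℝ, E) 𝓘(ℝ, E) ∞ (chartAt E z) x :=
  (contMDiffOn_chart (I := 𝓘(ℝ, E)) (x := z)).contMDiffAt ((chartAt E z).open_source.mem_nhds hx)

lemma contMDiffAt_chart_symm {z : M} {u : E} (hu : u ∈ (chartAt E z).target) :
    ContMDiffAt 𝓘(ℝ, E) 𝓘(ℝ, E) ∞ (chartAt E z).symm u :=
  (contMDiffOn_chart_symm (I := 𝓘(ℝ, E)) (x := z)).contMDiffAt
    ((chartAt E z).open_target.mem_nhds hu)

/-- A smooth function of the chart coordinates is smooth. -/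
lemma germSmooth_comp_chart {z x : M} (hx : x ∈ (chartAt E z).source) {a : E → ℝ}
    (ha : ContDiff ℝ ∞ a) : GermSmooth E (a ∘ chartAt E z) x :=
  germSmooth_of_smoothOn (chartAt E z).open_source
    (ha.contMDiff.comp_contMDiffOn contMDiffOn_chart) hx

lemma GermSmooth.contDiffAt_comp_symm {z x : M} (hx : x ∈ (chartAt E z).source) {f : M → ℝ}
    (hf : GermSmooth E f x) : ContDiffAt ℝ ∞ (f ∘ (chartAt E z).symm) (chartAt E z x) := by
  rw [← contMDiffAt_iff_contDiffAt]
  have h := contMDiffAt_chart_symm ((chartAt E z).map_source hx)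
  refine ContMDiffAt.comp _ ?_ h
  rw [(chartAt E z).left_inv hx]
  exact hf.contMDiffAt

/-- The differential of a function in terms of its coordinate expression. -/
lemma mfderiv_eq_fderiv_comp_symm {z x : M} (hx : x ∈ (chartAt E z).source) {f : M → ℝ}
    (hf : GermSmooth E f x) (w : TangentSpace 𝓘(ℝ, E) x) :
    mfderiv 𝓘(ℝ, E) 𝓘(ℝ, ℝ) f x w = fderiv ℝ (f ∘ (chartAt E z).symm) (chartAt E z x)
      (mfderiv 𝓘(ℝ, E) 𝓘(ℝ, E) (chartAt E z) x w) := by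
  have h1 : f =ᶠ[𝓝 x] (f ∘ (chartAt E z).symm) ∘ chartAt E z := by
    filter_upwards [(chartAt E z).open_source.mem_nhds hx] with y hy
    simp [(chartAt E z).left_inv hy]
  rw [h1.mfderiv_eq, mfderiv_comp (I' := 𝓘(ℝ, E)) x
    ((hf.contDiffAt_comp_symm hx).contMDiffAt.mdifferentiableAt (by simp))
    ((contMDiffAt_chart hx).mdifferentiableAt (by simp)), mfderiv_eq_fderiv]
  rfl

/-- The bracket depends on the differential of its first argument only. -/
lemma localBracket_eq_sum (P : PoissonStructure E M) {z x : M} (hx : x ∈ (chartAt E z).source)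
    {f g : M → ℝ} (hf : GermSmooth E f x) (hg : GermSmooth E g x) :
    localBracket P f g x = ∑ i, fderiv ℝ (f ∘ (chartAt E z).symm) (chartAt E z x) (modelBasis E i) *
      localBracket P (modelCoord E i ∘ chartAt E z) g x := by
  obtain ⟨q, hq⟩ := hg
  set φ := chartAt E z with hφ
  obtain ⟨p, hp⟩ := hf
  -- a globally smooth extension of the coordinate expression of `f`
  have hsm : ContDiffOn ℝ ∞ (p ∘ φ.symm) φ.target := by
    rw [← contMDiffOn_iff_contDiffOn]
    exact p.contMDiff.comp_contMDiffOn contMDiffOn_chart_symm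
  obtain ⟨a, ha, hae⟩ := exists_contDiff_eventuallyEq φ.open_target hsm (φ.map_source hx)
  obtain ⟨A, hA, hA0, hAf⟩ := exists_hadamard ha (φ x)
  have hfa : (f ∘ φ.symm) =ᶠ[𝓝 (φ x)] a := by
    have h1 : Tendsto φ.symm (𝓝 (φ x)) (𝓝 x) := by
      have := φ.continuousAt_symm (φ.map_source hx)
      rwa [ContinuousAt, φ.left_inv hx] at this
    filter_upwards [h1.eventually hp, hae] with u hu hu'
    rw [hu']
    exact hu.symm
  have hc : ∀ i, ∃ c : Smooth E M, (c : M → ℝ) =ᶠ[𝓝 x] modelCoord E i ∘ φ := fun i =>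
    germSmooth_comp_chart hx (modelCoord E i).contDiff
  have hr : ∀ i, ∃ r : Smooth E M, (r : M → ℝ) =ᶠ[𝓝 x] (fun u => A u (modelBasis E i)) ∘ φ :=
    fun i => germSmooth_comp_chart hx (hA.clm_apply contDiff_const)
  choose c hc using hc
  choose r hr using hr
  let k : Fin (Module.finrank ℝ E) → ℝ := fun i => modelCoord E i (φ x)
  let p' : Smooth E M := algebraMap ℝ _ (a (φ x)) + ∑ i, (c i - algebraMap ℝ _ (k i)) * r i
  have hsum : ∀ y, (∑ i, (c i - algebraMap ℝ (Smooth E M) (k i)) * r i : Smooth E M) y =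
      ∑ i, (c i y - k i) * r i y := fun y => by
    have := map_sum (ContMDiffMap.coeFnRingHom : Smooth E M →+* (M → ℝ))
      (fun i => (c i - algebraMap ℝ (Smooth E M) (k i)) * r i) Finset.univ
    have h2 := congrFun this y
    rw [Finset.sum_apply] at h2
    exact h2
  have hp' : (p' : M → ℝ) =ᶠ[𝓝 x] f := by
    filter_upwards [φ.open_source.mem_nhds hx, eventually_all.2 hc, eventually_all.2 hr,
      φ.continuousAt hx |>.eventually hfa] with y hy hcy hry hfy
    have h1 : f y = a (φ y) := by
      rw [← hfy, Function.comp_apply, φ.left_inv hy]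
    rw [h1, hAf (φ y), map_eq_sum_modelCoord]
    change a (φ x) + (∑ i, (c i - algebraMap ℝ (Smooth E M) (k i)) * r i : Smooth E M) y = _
    rw [hsum]
    congr 1
    refine Finset.sum_congr rfl fun i _ => ?_
    rw [hcy, hry, map_sub, smul_eq_mul]
    rfl
  rw [localBracket_eq P hp' hq, hfa.fderiv_eq, ← hA0]
  have hbr : P.br p' q = ∑ i, ((c i - algebraMap ℝ _ (k i)) * P.br (r i) q +
      P.br (c i) q * r i) := by
    simp only [p', map_add, LinearMap.add_apply, P.algebraMap_left, zero_add, map_sum,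
      LinearMap.sum_apply, P.leibniz, map_sub, LinearMap.sub_apply, sub_zero]
  rw [hbr]
  have := congrFun (map_sum (ContMDiffMap.coeFnRingHom : Smooth E M →+* (M → ℝ))
      (fun i => (c i - algebraMap ℝ (Smooth E M) (k i)) * P.br (r i) q +
      P.br (c i) q * r i) Finset.univ) x
  rw [Finset.sum_apply] at this
  refine this.trans (Finset.sum_congr rfl fun i _ => ?_)
  change (c i x - k i) * P.br (r i) q x + P.br (c i) q x * r i x = _
  rw [(hc i).self_of_nhds, (hr i).self_of_nhds, ← localBracket_eq P (hc i) hq]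
  simp only [k, Function.comp_apply, sub_self, zero_mul, zero_add]
  exact mul_comm _ _

/-- The components `{xⁱ, xʲ}` of the bracket in the chart at `z`. -/
def chartTensor (P : PoissonStructure E M) (z : M) (i j : Fin (Module.finrank ℝ E)) (u : E) : ℝ :=
  localBracket P (modelCoord E i ∘ chartAt E z) (modelCoord E j ∘ chartAt E z)
    ((chartAt E z).symm u)

lemma contDiffOn_chartTensor (P : PoissonStructure E M) (z : M)
    (i j : Fin (Module.finrank ℝ E)) :
    ContDiffOn ℝ ∞ (chartTensor P z i j) (chartAt E z).target := by
  intro u hu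
  have hx := (chartAt E z).map_target hu
  have h := ((germSmooth_comp_chart hx (modelCoord E i).contDiff).localBracket P
    (germSmooth_comp_chart hx (modelCoord E j).contDiff)).contDiffAt_comp_symm hx
  rw [(chartAt E z).right_inv hu] at h
  exact h.contDiffWithinAt

/-- The coordinate expression `∑ πⁱʲ ∂ᵢf ∂ⱼg` of the bracket. -/
lemma localBracket_eq_chart (P : PoissonStructure E M) {z x : M} (hx : x ∈ (chartAt E z).source)
    {f g : M → ℝ} (hf : GermSmooth E f x) (hg : GermSmooth E g x) :
    localBracket P f g x = ∑ i, ∑ j, chartTensor P z i j (chartAt E z x) *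
      (fderiv ℝ (f ∘ (chartAt E z).symm) (chartAt E z x) (modelBasis E i) *
        fderiv ℝ (g ∘ (chartAt E z).symm) (chartAt E z x) (modelBasis E j)) := by
  rw [localBracket_eq_sum P hx hf hg]
  refine Finset.sum_congr rfl fun i _ => ?_
  have hi := germSmooth_comp_chart hx (modelCoord E i).contDiff
  rw [localBracket_antisymm P hi hg, localBracket_eq_sum P hx hg hi, ← Finset.sum_neg_distrib,
    Finset.mul_sum]
  refine Finset.sum_congr rfl fun j _ => ?_
  have hj := germSmooth_comp_chart hx (modelCoord E j).contDiff
  rw [chartTensor, (chartAt E z).left_inv hx, localBracket_antisymm P hi hj]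
  ring

/-- Tangent vectors are determined by the derivatives of smooth functions. -/
lemma eq_of_forall_mfderiv_eq {x : M} {v w : TangentSpace 𝓘(ℝ, E) x}
    (h : ∀ g : Smooth E M, mfderiv 𝓘(ℝ, E) 𝓘(ℝ, ℝ) g x v = mfderiv 𝓘(ℝ, E) 𝓘(ℝ, ℝ) g x w) :
    v = w := by
  have hx := mem_chart_source E x
  refine ((mdifferentiable_chart (I := 𝓘(ℝ, E)) x).mfderiv hx).injective ?_
  refine (modelBasis E).ext_elem fun i => ?_
  obtain ⟨c, hc⟩ := germSmooth_comp_chart hx (modelCoord E i).contDiff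
  have h1 : ∀ v : TangentSpace 𝓘(ℝ, E) x, mfderiv 𝓘(ℝ, E) 𝓘(ℝ, ℝ) c x v =
      modelCoord E i (mfderiv 𝓘(ℝ, E) 𝓘(ℝ, E) (chartAt E x) x v) := by
    intro v
    rw [hc.mfderiv_eq, mfderiv_comp (I' := 𝓘(ℝ, E)) x
      ((modelCoord E i).contDiff.contMDiff.mdifferentiableAt (n := 1) (by simp))
      ((contMDiffAt_chart hx).mdifferentiableAt (by simp)), mfderiv_eq_fderiv,
      (modelCoord E i).fderiv]
    rfl
  have := h c
  rw [h1, h1] at this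
  exact this

variable {P : PoissonStructure E M}

lemma IsHamiltonian.mfderiv_eq {f : M → ℝ} {X : LocalVectorField E M} (hX : IsHamiltonian P f X)
    {x : M} (hx : x ∈ X.dom) {g : M → ℝ} (hg : GermSmooth E g x) :
    mfderiv 𝓘(ℝ, E) 𝓘(ℝ, ℝ) g x (X.vec x) = localBracket P g f x := by
  obtain ⟨p, hp⟩ := hg
  rw [← hp.mfderiv_eq]
  exact (hX.2 x hx p).trans (localBracket_congr P hp EventuallyEq.rfl)

omit [FiniteDimensional ℝ E] [T2Space M] in
/-- In the trivialization of the tangent bundle over a chart, vectors are read off with the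
differential of the chart. -/
lemma trivializationAt_snd_eq_mfderiv {z x : M} (hx : x ∈ (chartAt E z).source)
    (v : TangentSpace 𝓘(ℝ, E) x) : (trivializationAt E (TangentSpace 𝓘(ℝ, E)) z
      (⟨x, v⟩ : TangentBundle 𝓘(ℝ, E) M)).2 = mfderiv 𝓘(ℝ, E) 𝓘(ℝ, E) (chartAt E z) x v := by
  have h1 := TangentBundle.continuousLinearMapAt_trivializationAt (I := 𝓘(ℝ, E)) hx
  have hb : x ∈ (trivializationAt E (TangentSpace 𝓘(ℝ, E)) z).baseSet := by
    simpa using hx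
  rw [extChartAt, OpenPartialHomeomorph.extend_coe] at h1
  have h3 := congrArg (fun L : TangentSpace 𝓘(ℝ, E) x →L[ℝ] E => L v) h1
  have h4 := (trivializationAt E (TangentSpace 𝓘(ℝ, E)) z).linearMapAt_apply
    (R := ℝ) (b := x) v
  rw [if_pos hb] at h4
  exact h4.symm.trans h3

/-- Every smooth function on an open set has a Hamiltonian vector field there. -/
lemma exists_isHamiltonian (P : PoissonStructure E M) {U : Set M} (hU : IsOpen U) {f : M → ℝ}
    (hf : SmoothOn E U f) : ∃ X : LocalVectorField E M, X.dom = U ∧ IsHamiltonian P f X := by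
  let vec : (x : M) → TangentSpace 𝓘(ℝ, E) x := fun x =>
    -- the value at `x` is defined in the chart at `x`; its expression in a fixed chart is `hform`
    ((mdifferentiable_chart (I := 𝓘(ℝ, E)) x).mfderiv (mem_chart_source E x)).symm
      (∑ i, localBracket P (modelCoord E i ∘ chartAt E x) f x • modelBasis E i : E)
  have hvec : ∀ x ∈ U, ∀ g, GermSmooth E g x →
      mfderiv 𝓘(ℝ, E) 𝓘(ℝ, ℝ) g x (vec x) = localBracket P g f x := by
    intro x hx g hg
    have hxs := mem_chart_source E x
    rw [mfderiv_eq_fderiv_comp_symm hxs hg,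
      localBracket_eq_sum P hxs hg (germSmooth_of_smoothOn hU hf hx)]
    have h1 : mfderiv 𝓘(ℝ, E) 𝓘(ℝ, E) (chartAt E x) x (vec x) =
        (∑ i, localBracket P (modelCoord E i ∘ chartAt E x) f x • modelBasis E i : E) :=
      ((mdifferentiable_chart (I := 𝓘(ℝ, E)) x).mfderiv hxs).apply_symm_apply _
    rw [h1, map_sum]
    refine Finset.sum_congr rfl fun i _ => ?_
    rw [map_smul, smul_eq_mul, mul_comm]
  refine ⟨⟨U, hU, vec, ?_⟩, rfl, hf, fun x hx g => hvec x hx g (g.germSmooth x)⟩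
  intro x₀ hx₀
  refine ContMDiffAt.contMDiffWithinAt ?_
  rw [Bundle.contMDiffAt_section]
  set φ := chartAt E x₀
  have hx₀s : x₀ ∈ φ.source := mem_chart_source E x₀
  have hform : (fun x => (trivializationAt E (TangentSpace 𝓘(ℝ, E)) x₀
      (⟨x, vec x⟩ : TangentBundle 𝓘(ℝ, E) M)).2) =ᶠ[𝓝 x₀]
      fun x => ∑ i, localBracket P (modelCoord E i ∘ φ) f x • modelBasis E i := by
    filter_upwards [φ.open_source.mem_nhds hx₀s, hU.mem_nhds hx₀] with x hx hxU
    rw [trivializationAt_snd_eq_mfderiv hx (vec x),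
      ← sum_modelCoord_smul (E := E) (mfderiv 𝓘(ℝ, E) 𝓘(ℝ, E) φ x (vec x))]
    refine Finset.sum_congr rfl fun i _ => ?_
    congr 1
    rw [← hvec x hxU _ (germSmooth_comp_chart hx (modelCoord E i).contDiff),
      mfderiv_comp (I' := 𝓘(ℝ, E)) x
      ((modelCoord E i).contDiff.contMDiff.mdifferentiableAt (n := 1) (by simp))
      ((contMDiffAt_chart hx).mdifferentiableAt (by simp)), mfderiv_eq_fderiv,
      (modelCoord E i).fderiv]
    rfl
  refine ContMDiffAt.congr_of_eventuallyEq ?_ hform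
  refine ContMDiffAt.sum fun i _ => ?_
  have h1 := ((germSmooth_comp_chart hx₀s (modelCoord E i).contDiff).localBracket P
    (germSmooth_of_smoothOn hU hf hx₀)).contMDiffAt
  have h2 : ContMDiffAt 𝓘(ℝ, E) 𝓘(ℝ, E) ∞ (fun _ : M => modelBasis E i) x₀ := contMDiffAt_const
  exact h1.smul h2

end Coordinates

/-! ### Integral curves and flows of local vector fields -/

section FlowRelation

variable {E : Type*} [NormedAddCommGroup E] [NormedSpace ℝ E] [FiniteDimensional ℝ E]
  {M : Type*} [TopologicalSpace M] [T2Space M] [ChartedSpace E M] [IsManifold 𝓘(ℝ, E) ∞ M]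
  {X : LocalVectorField E M}

lemma LocalVectorField.contMDiffAt_one (X : LocalVectorField E M) {x : M} (hx : x ∈ X.dom) :
    ContMDiffAt 𝓘(ℝ, E) 𝓘(ℝ, E).tangent 1
      (fun x => (⟨x, X.vec x⟩ : TangentBundle 𝓘(ℝ, E) M)) x :=
  (X.smooth.contMDiffAt (X.isOpen_dom.mem_nhds hx)).of_le (by exact_mod_cast le_top)

/-- Integral curves inside the domain of a local vector field are unique. -/
lemma integralCurve_unique {γ γ' : ℝ → M} {a b s : ℝ} (hs : s ∈ Ioo a b)
    (hd : MapsTo γ (Ioo a b) X.dom) (hγ : IsMIntegralCurveOn (I := 𝓘(ℝ, E)) γ X.vec (Ioo a b))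
    (hγ' : IsMIntegralCurveOn (I := 𝓘(ℝ, E)) γ' X.vec (Ioo a b)) (h : γ s = γ' s) :
    EqOn γ γ' (Ioo a b) := by
  have hat : ∀ {γ : ℝ → M}, IsMIntegralCurveOn (I := 𝓘(ℝ, E)) γ X.vec (Ioo a b) → ∀ t ∈ Ioo a b,
      IsMIntegralCurveAt (I := 𝓘(ℝ, E)) γ X.vec t :=
    fun hγ t ht => hγ.isMIntegralCurveAt (isOpen_Ioo.mem_nhds ht)
  have hloc : ∀ t ∈ Ioo a b, γ t = γ' t → γ =ᶠ[𝓝 t] γ' := fun t ht e =>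
    isMIntegralCurveAt_eventuallyEq_of_contMDiffAt_boundaryless
      (X.contMDiffAt_one (hd ht)) (hat hγ t ht) (hat hγ' t ht) e
  have hsub : Ioo a b ⊆ {t | γ =ᶠ[𝓝 t] γ'} := by
    refine isPreconnected_Ioo.subset_of_closure_inter_subset ?_ ⟨s, hs, hloc s hs h⟩ ?_
    · exact isOpen_setOfPred_eventually_nhds
    · rintro t ⟨htc, ht⟩
      refine hloc t ht ?_
      have hf : ∃ᶠ r in 𝓝 t, γ r = γ' r :=
        (mem_closure_iff_frequently.1 htc).mono fun r hr => hr.self_of_nhds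
      exact tendsto_nhds_unique_of_frequently_eq (hat hγ t ht).continuousAt
        (hat hγ' t ht).continuousAt hf
  exact fun t ht => (hsub ht).self_of_nhds

/-- Overlapping integral curves can be glued. -/
lemma integralCurve_glue {γ₁ γ₂ : ℝ → M} {a b c d s : ℝ} (hs : s ∈ Ioo a b) (hs' : s ∈ Ioo c d)
    (hd₁ : MapsTo γ₁ (Ioo a b) X.dom) (h₁ : IsMIntegralCurveOn (I := 𝓘(ℝ, E)) γ₁ X.vec (Ioo a b))
    (hd₂ : MapsTo γ₂ (Ioo c d) X.dom) (h₂ : IsMIntegralCurveOn (I := 𝓘(ℝ, E)) γ₂ X.vec (Ioo c d))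
    (h : γ₁ s = γ₂ s) :
    ∃ γ : ℝ → M, EqOn γ γ₁ (Ioo a b) ∧ EqOn γ γ₂ (Ioo c d) ∧
      MapsTo γ (Ioo (min a c) (max b d)) X.dom ∧
      IsMIntegralCurveOn (I := 𝓘(ℝ, E)) γ X.vec (Ioo (min a c) (max b d)) := by
  classical
  let γ : ℝ → M := fun t => if t ∈ Ioo a b then γ₁ t else γ₂ t
  have e₁ : EqOn γ γ₁ (Ioo a b) := fun t ht => if_pos ht
  have e₂ : EqOn γ γ₂ (Ioo c d) := by
    intro t ht
    by_cases ht' : t ∈ Ioo a b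
    · rw [e₁ ht']
      have hsub₁ : Ioo (max a c) (min b d) ⊆ Ioo a b :=
        Ioo_subset_Ioo (le_max_left _ _) (min_le_left _ _)
      have hsub₂ : Ioo (max a c) (min b d) ⊆ Ioo c d :=
        Ioo_subset_Ioo (le_max_right _ _) (min_le_right _ _)
      exact integralCurve_unique (s := s) ⟨max_lt hs.1 hs'.1, lt_min hs.2 hs'.2⟩
        (hd₁.mono_left hsub₁) (h₁.mono hsub₁) (h₂.mono hsub₂) h
        ⟨max_lt ht'.1 ht.1, lt_min ht'.2 ht.2⟩
    · exact if_neg ht'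
  have hcov : Ioo (min a c) (max b d) ⊆ Ioo a b ∪ Ioo c d := by
    rintro t ⟨h1, h2⟩
    rcases min_lt_iff.1 h1 with h1 | h1 <;> rcases lt_max_iff.1 h2 with h2 | h2
    · exact Or.inl ⟨h1, h2⟩
    · rcases lt_or_ge t b with h3 | h3
      · exact Or.inl ⟨h1, h3⟩
      · exact Or.inr ⟨hs'.1.trans (hs.2.trans_le h3), h2⟩
    · rcases lt_or_ge t d with h3 | h3
      · exact Or.inr ⟨h1, h3⟩
      · exact Or.inl ⟨hs.1.trans (hs'.2.trans_le h3), h2⟩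
    · exact Or.inr ⟨h1, h2⟩
  have hcongr : ∀ {γ' : ℝ → M} {p q t : ℝ}, EqOn γ γ' (Ioo p q) →
      IsMIntegralCurveOn (I := 𝓘(ℝ, E)) γ' X.vec (Ioo p q) → t ∈ Ioo p q →
      HasMFDerivAt 𝓘(ℝ, ℝ) 𝓘(ℝ, E) γ t ((1 : ℝ →L[ℝ] ℝ).smulRight (X.vec (γ t))) := by
    intro γ' p q t he hγ' ht
    have h3 := (hγ' t ht).hasMFDerivAt (isOpen_Ioo.mem_nhds ht)
    rw [← he ht] at h3
    exact h3.congr_of_eventuallyEq (by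
      filter_upwards [isOpen_Ioo.mem_nhds ht] with r hr using he hr)
  refine ⟨γ, e₁, e₂, ?_, ?_⟩
  · intro t ht
    rcases hcov ht with h | h
    · rw [e₁ h]; exact hd₁ h
    · rw [e₂ h]; exact hd₂ h
  · intro t ht
    rcases hcov ht with h | h
    · exact (hcongr e₁ h₁ h).hasMFDerivWithinAt
    · exact (hcongr e₂ h₂ h).hasMFDerivWithinAt

lemma integralCurve_shift {γ : ℝ → M} {a b : ℝ} (hd : MapsTo γ (Ioo a b) X.dom)
    (hγ : IsMIntegralCurveOn (I := 𝓘(ℝ, E)) γ X.vec (Ioo a b)) (s : ℝ) :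
    MapsTo (fun t => γ (t + s)) (Ioo (a - s) (b - s)) X.dom ∧
      IsMIntegralCurveOn (I := 𝓘(ℝ, E)) (fun t => γ (t + s)) X.vec (Ioo (a - s) (b - s)) := by
  have hset : {t | t + s ∈ Ioo a b} = Ioo (a - s) (b - s) := by
    ext t
    simp only [mem_ofPred_eq, mem_Ioo, sub_lt_iff_lt_add, lt_sub_iff_add_lt]
  refine ⟨fun t ht => hd (hset.symm ▸ ht : t ∈ {t | t + s ∈ Ioo a b}), ?_⟩
  rw [← hset]
  exact hγ.comp_add s

/-- The flow moves along every integral curve. -/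
lemma FlowsTo.of_curve {γ : ℝ → M} {a b : ℝ} (hd : MapsTo γ (Ioo a b) X.dom)
    (hγ : IsMIntegralCurveOn (I := 𝓘(ℝ, E)) γ X.vec (Ioo a b)) {s t : ℝ} (hs : s ∈ Ioo a b)
    (ht : t ∈ Ioo a b) : FlowsTo X (t - s) (γ s) (γ t) := by
  obtain ⟨h1, h2⟩ := integralCurve_shift hd hγ s
  exact ⟨_, a - s, b - s, ⟨by linarith [hs.1], by linarith [hs.2]⟩,
    ⟨by linarith [ht.1], by linarith [ht.2]⟩, h1, h2, by simp, by simp⟩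

lemma FlowsTo.symm {t : ℝ} {x y : M} (h : FlowsTo X t x y) : FlowsTo X (-t) y x := by
  obtain ⟨γ, a, b, h0, ht, hd, hγ, rfl, rfl⟩ := h
  simpa using FlowsTo.of_curve hd hγ ht h0

lemma FlowsTo.trans {s t : ℝ} {x y z : M} (h : FlowsTo X s x y) (h' : FlowsTo X t y z) :
    FlowsTo X (s + t) x z := by
  obtain ⟨γ, a, b, h0, hs, hd, hγ, rfl, rfl⟩ := h
  obtain ⟨γ', c, d, h0', ht, hd', hγ', he, rfl⟩ := h'
  obtain ⟨h1, h2⟩ := integralCurve_shift hd' hγ' (-s)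
  obtain ⟨η, e₁, e₂, hd'', hη⟩ := integralCurve_glue (s := s) hs
    (c := c - -s) (d := d - -s) ⟨by linarith [h0'.1], by linarith [h0'.2]⟩ hd hγ h1 h2
    (by simp [he])
  have hst : s + t ∈ Ioo (c - -s) (d - -s) := ⟨by linarith [ht.1], by linarith [ht.2]⟩
  refine ⟨η, _, _, ⟨(min_le_left _ _).trans_lt h0.1, h0.2.trans_le (le_max_left _ _)⟩,
    ⟨(min_le_right _ _).trans_lt hst.1, hst.2.trans_le (le_max_right _ _)⟩, hd'', hη, e₁ h0, ?_⟩
  rw [e₂ hst]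
  simp

lemma FlowsTo.unique {t : ℝ} {x y y' : M} (h : FlowsTo X t x y) (h' : FlowsTo X t x y') :
    y = y' := by
  obtain ⟨γ, a, b, h0, ht, hd, hγ, rfl, rfl⟩ := h
  obtain ⟨γ', c, d, h0', ht', hd', hγ', he, rfl⟩ := h'
  have hsub₁ : Ioo (max a c) (min b d) ⊆ Ioo a b :=
    Ioo_subset_Ioo (le_max_left _ _) (min_le_left _ _)
  have hsub₂ : Ioo (max a c) (min b d) ⊆ Ioo c d :=
    Ioo_subset_Ioo (le_max_right _ _) (min_le_right _ _)
  exact integralCurve_unique (s := 0) ⟨max_lt h0.1 h0'.1, lt_min h0.2 h0'.2⟩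
    (hd.mono_left hsub₁) (hγ.mono hsub₁) (hγ'.mono hsub₂) he.symm
    ⟨max_lt ht.1 ht'.1, lt_min ht.2 ht'.2⟩

lemma FlowsTo.mem_dom {t : ℝ} {x y : M} (h : FlowsTo X t x y) : x ∈ X.dom ∧ y ∈ X.dom := by
  obtain ⟨γ, a, b, h0, ht, hd, hγ, rfl, rfl⟩ := h
  exact ⟨hd h0, hd ht⟩

/-- The value of `flow` is chosen, but unique since `M` is Hausdorff. -/
lemma mem_flow_iff {t : ℝ} {x y : M} : y ∈ flow X t x ↔ FlowsTo X t x y := by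
  constructor
  · rintro ⟨h, rfl⟩
    exact h.choose_spec
  · intro h
    exact ⟨⟨y, h⟩, (Exists.choose_spec (⟨y, h⟩ : ∃ y, FlowsTo X t x y)).unique h⟩

omit [FiniteDimensional ℝ E] [T2Space M] in
lemma mfderiv_chart_symm_mfderiv_chart {z : M} {u : E} (hu : u ∈ (chartAt E z).target)
    (w : TangentSpace 𝓘(ℝ, E) ((chartAt E z).symm u)) :
    mfderiv 𝓘(ℝ, E) 𝓘(ℝ, E) (chartAt E z).symm u
      (mfderiv 𝓘(ℝ, E) 𝓘(ℝ, E) (chartAt E z) ((chartAt E z).symm u) w) = w := by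
  have h := (mdifferentiable_chart (I := 𝓘(ℝ, E)) z).symm_comp_deriv
    ((chartAt E z).map_target hu)
  rw [(chartAt E z).right_inv hu] at h
  exact congrArg (fun L : E →L[ℝ] E => L w) h

/-- The local flow in the chart at `z`, jointly smooth in time and space. -/
lemma exists_chart_flow (X : LocalVectorField E M) {z : M} (hz : z ∈ X.dom) :
    ∃ ε > 0, ∃ U : Set E, IsOpen U ∧ chartAt E z z ∈ U ∧ U ⊆ (chartAt E z).target ∧
      ∃ θ : ℝ × E → E, ContDiffOn ℝ ∞ θ (Ioo (-ε) ε ×ˢ U) ∧ (∀ u ∈ U, θ (0, u) = u) ∧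
      MapsTo θ (Ioo (-ε) ε ×ˢ U) (chartAt E z).target ∧
      ∀ u ∈ U, ∀ t ∈ Ioo (-ε) ε,
        FlowsTo X t ((chartAt E z).symm u) ((chartAt E z).symm (θ (t, u))) ∧
        HasDerivAt (fun s => θ (s, u)) (mfderiv 𝓘(ℝ, E) 𝓘(ℝ, E) (chartAt E z)
          ((chartAt E z).symm (θ (t, u))) (X.vec ((chartAt E z).symm (θ (t, u))))) t := by
  set φ := chartAt E z
  let v : E → E := fun u => mfderiv 𝓘(ℝ, E) 𝓘(ℝ, E) φ (φ.symm u) (X.vec (φ.symm u))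
  have hO : IsOpen (φ.target ∩ φ.symm ⁻¹' X.dom) :=
    φ.symm.isOpen_inter_preimage X.isOpen_dom
  have hv : ContDiffOn ℝ ∞ v (φ.target ∩ φ.symm ⁻¹' X.dom) := by
    rintro u ⟨hu, hud⟩
    have hx : φ.symm u ∈ φ.source := φ.map_target hu
    have h1 := X.smooth.contMDiffAt (X.isOpen_dom.mem_nhds hud)
    rw [(trivializationAt E (TangentSpace 𝓘(ℝ, E)) z).contMDiffAt_section_iff
      (by simpa using hx)] at h1
    have h2 := h1.comp u (contMDiffAt_chart_symm (z := z) hu)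
    rw [contMDiffAt_iff_contDiffAt] at h2
    refine (h2.congr_of_eventuallyEq ?_).contDiffWithinAt
    filter_upwards [φ.open_target.mem_nhds hu] with w hw
    exact (trivializationAt_snd_eq_mfderiv (φ.map_target hw) _).symm
  have hz0 : φ z ∈ φ.target ∩ φ.symm ⁻¹' X.dom := by
    refine ⟨mem_chart_target E z, ?_⟩
    rw [mem_preimage, φ.left_inv (mem_chart_source E z)]
    exact hz
  obtain ⟨ε, hε, U, hU, hzU, θ, hθ, hθ0, hθm, hθd⟩ := exists_local_flow hO hv hz0
  refine ⟨ε, hε, U ∩ φ.target, hU.inter φ.open_target, ⟨hzU, hz0.1⟩, inter_subset_right, θ,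
    hθ.mono (prod_mono subset_rfl inter_subset_left), fun u hu => hθ0 u hu.1,
    fun p hp => (hθm ⟨hp.1, hp.2.1⟩).1, fun u hu t ht => ⟨?_, hθd u hu.1 t ht⟩⟩
  have h0 : (0 : ℝ) ∈ Ioo (-ε) ε := ⟨by linarith, hε⟩
  refine ⟨fun s => φ.symm (θ (s, u)), -ε, ε, h0, ht, fun s hs => (hθm ⟨hs, hu.1⟩).2, ?_,
    congrArg φ.symm (hθ0 u hu.1), rfl⟩
  intro s hs
  refine HasMFDerivAt.hasMFDerivWithinAt ?_
  have hst := (hθm (show (s, u) ∈ Ioo (-ε) ε ×ˢ U from ⟨hs, hu.1⟩)).1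
  have h1 : HasMFDerivAt 𝓘(ℝ, ℝ) 𝓘(ℝ, E) (fun s => θ (s, u)) s
      ((1 : ℝ →L[ℝ] ℝ).smulRight (v (θ (s, u)))) :=
    (hθd u hu.1 s hs).hasFDerivAt.hasMFDerivAt
  have h2 := ((contMDiffAt_chart_symm (z := z) hst).mdifferentiableAt (by simp)).hasMFDerivAt
  have h3 := HasMFDerivAt.comp s h2 h1
  refine HasMFDerivAt.congr_mfderiv h3 ?_
  refine ContinuousLinearMap.ext fun (r : ℝ) => ?_
  let L : E →L[ℝ] E := mfderiv 𝓘(ℝ, E) 𝓘(ℝ, E) φ.symm (θ (s, u))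
  have h4 : L (v (θ (s, u))) = X.vec (φ.symm (θ (s, u))) := mfderiv_chart_symm_mfderiv_chart hst _
  change L (r • v (θ (s, u))) = r • (X.vec (φ.symm (θ (s, u))) : E)
  rw [map_smul, h4]
  rfl

end FlowRelation

/-! ### Hamiltonian flows preserve the bracket -/

section PartialDerivatives

variable {E G : Type*} [NormedAddCommGroup E] [NormedSpace ℝ E] [NormedAddCommGroup G]
  [NormedSpace ℝ G]

lemma fderiv_slice_right {F : ℝ × E → G} {t : ℝ} {u : E} (hF : DifferentiableAt ℝ F (t, u)) (w : E) :
    fderiv ℝ (fun u' => F (t, u')) u w = fderiv ℝ F (t, u) (0, w) := by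
  have h := (hF.hasFDerivAt.comp u (hasFDerivAt_prodMk_right t u)).fderiv
  exact congrArg (fun L : E →L[ℝ] G => L w) h

lemma hasDerivAt_slice_left {F : ℝ × E → G} {t : ℝ} {u : E} (hF : DifferentiableAt ℝ F (t, u)) :
    HasDerivAt (fun s => F (s, u)) (fderiv ℝ F (t, u) (1, 0)) t := by
  have h := (hF.hasFDerivAt.comp t (hasFDerivAt_prodMk_left t u)).hasDerivAt
  exact h.congr_deriv (by simp)

/-- Time derivatives of space derivatives are space derivatives of time derivatives. -/
lemma hasDerivAt_fderiv_slice {F : ℝ × E → ℝ} {t : ℝ} {u : E} (hF : ContDiffAt ℝ ∞ F (t, u))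
    (w : E) : HasDerivAt (fun s => fderiv ℝ F (s, u) (0, w))
      (fderiv ℝ (fun u' => fderiv ℝ F (t, u') (1, 0)) u w) t := by
  have hd : DifferentiableAt ℝ (fderiv ℝ F) (t, u) :=
    (hF.fderiv_right (m := ∞) (by simp)).differentiableAt (by simp)
  have hda : ∀ v : ℝ × E, HasFDerivAt (fun p => fderiv ℝ F p v)
      ((fderiv ℝ (fderiv ℝ F) (t, u)).flip v) (t, u) := fun v => by
    have := hd.hasFDerivAt.clm_apply (hasFDerivAt_const v (t, u))
    refine this.congr_fderiv ?_
    ext <;> simp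
  have h1 := hasDerivAt_slice_left (F := fun p => fderiv ℝ F p (0, w)) (hda (0, w)).differentiableAt
  refine h1.congr_deriv ?_
  rw [fderiv_slice_right (F := fun p => fderiv ℝ F p (1, 0)) (hda (1, 0)).differentiableAt,
    (hda _).fderiv, (hda _).fderiv]
  exact (hF.isSymmSndFDerivAt (by simpa using ENat.LEInfty.out)) _ _

end PartialDerivatives

section PoissonFlow

variable {E : Type*} [NormedAddCommGroup E] [NormedSpace ℝ E] [FiniteDimensional ℝ E]
  {M : Type*} [TopologicalSpace M] [T2Space M] [ChartedSpace E M] [IsManifold 𝓘(ℝ, E) ∞ M]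
  {P : PoissonStructure E M}

lemma GermSmooth.comp {Θ : M → M} {f : M → ℝ} {x : M} (hf : GermSmooth E f (Θ x))
    (hΘ : ∀ᶠ x' in 𝓝 x, ContMDiffAt 𝓘(ℝ, E) 𝓘(ℝ, E) ∞ Θ x') : GermSmooth E (f ∘ Θ) x := by
  refine germSmooth_of_eventually ?_
  filter_upwards [hΘ, hΘ.self_of_nhds.continuousAt.eventually hf.eventually] with y h1 h2
  exact h2.contMDiffAt.comp y h1

/-- The map `Θ` is smooth near `x` and preserves the bracket at `x`. -/
def IsPoissonAt (P : PoissonStructure E M) (Θ : M → M) (x : M) : Prop :=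
  (∀ᶠ x' in 𝓝 x, ContMDiffAt 𝓘(ℝ, E) 𝓘(ℝ, E) ∞ Θ x') ∧
    ∀ f g : M → ℝ, GermSmooth E f (Θ x) → GermSmooth E g (Θ x) →
      localBracket P (f ∘ Θ) (g ∘ Θ) x = localBracket P f g (Θ x)

lemma isPoissonAt_id (P : PoissonStructure E M) (x : M) : IsPoissonAt P id x :=
  ⟨Eventually.of_forall fun _ => contMDiffAt_id, fun _ _ _ _ => rfl⟩

lemma IsPoissonAt.comp {Θ Θ' : M → M} {x : M} (h' : IsPoissonAt P Θ' (Θ x))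
    (h : IsPoissonAt P Θ x) : IsPoissonAt P (Θ' ∘ Θ) x := by
  refine ⟨?_, fun f g hf hg => ?_⟩
  · filter_upwards [h.1, h.1.self_of_nhds.continuousAt.eventually h'.1] with y h1 h2
    exact h2.comp y h1
  · rw [← Function.comp_assoc, ← Function.comp_assoc, h.2 _ _ (GermSmooth.comp (x := Θ x) hf h'.1)
      (GermSmooth.comp (x := Θ x) hg h'.1),
      h'.2 f g hf hg]
    rfl

lemma IsPoissonAt.congr {Θ Θ' : M → M} {x : M} (h : IsPoissonAt P Θ x) (e : Θ =ᶠ[𝓝 x] Θ') :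
    IsPoissonAt P Θ' x := by
  refine ⟨?_, fun f g hf hg => ?_⟩
  · filter_upwards [h.1, e.eventually_nhds] with y h1 h2
    exact h1.congr_of_eventuallyEq (EventuallyEq.symm h2)
  · rw [← e.self_of_nhds] at hf hg ⊢
    rw [← h.2 f g hf hg]
    exact localBracket_congr P (e.symm.fun_comp f) (e.symm.fun_comp g)

/-- The coordinate expression of the bracket of functions given in coordinates. -/
lemma localBracket_comp_chart {z : M} {U : Set E} (hU : IsOpen U) (hUt : U ⊆ (chartAt E z).target)
    {a b : E → ℝ} (ha : ContDiffOn ℝ ∞ a U) (hb : ContDiffOn ℝ ∞ b U) {u : E} (hu : u ∈ U) :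
    GermSmooth E (a ∘ chartAt E z) ((chartAt E z).symm u) ∧
    localBracket P (a ∘ chartAt E z) (b ∘ chartAt E z) ((chartAt E z).symm u) =
      ∑ i, ∑ j, chartTensor P z i j u *
        (fderiv ℝ a u (modelBasis E i) * fderiv ℝ b u (modelBasis E j)) := by
  set φ := chartAt E z
  have hx : φ.symm u ∈ φ.source := φ.map_target (hUt hu)
  have hg : ∀ {a : E → ℝ}, ContDiffOn ℝ ∞ a U → GermSmooth E (a ∘ φ) (φ.symm u) := by
    intro a ha
    refine germSmooth_of_smoothOn (φ.isOpen_inter_preimage hU) ?_ ⟨hx, by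
      rw [mem_preimage, φ.right_inv (hUt hu)]; exact hu⟩
    exact (contMDiffOn_iff_contDiffOn.2 ha).comp (contMDiffOn_chart.mono inter_subset_left)
      fun y hy => hy.2
  refine ⟨hg ha, ?_⟩
  have he : ∀ a : E → ℝ, (a ∘ φ) ∘ φ.symm =ᶠ[𝓝 u] a := fun a => by
    filter_upwards [φ.open_target.mem_nhds (hUt hu)] with w hw
    simp [φ.right_inv hw]
  rw [localBracket_eq_chart P hx (hg ha) (hg hb), φ.right_inv (hUt hu), (he a).fderiv_eq,
    (he b).fderiv_eq]

/-- The bracket of two time-dependent functions in coordinates. -/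
def chartBracket (P : PoissonStructure E M) (z : M) (F G : ℝ × E → ℝ) (p : ℝ × E) : ℝ :=
  ∑ i, ∑ j, chartTensor P z i j p.2 *
    (fderiv ℝ F p (0, modelBasis E i) * fderiv ℝ G p (0, modelBasis E j))

/-- If two time-dependent functions are transported by a Hamiltonian vector field, then so is their
bracket: this is the Jacobi identity. -/
lemma chartBracket_transport {h : M → ℝ} {X : LocalVectorField E M} (hX : IsHamiltonian P h X)
    {z : M} {J : Set ℝ} (hJ : IsOpen J) {U : Set E} (hU : IsOpen U)
    (hUt : U ⊆ (chartAt E z).target) (hUd : MapsTo (chartAt E z).symm U X.dom)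
    {F G : ℝ × E → ℝ} (hF : ContDiffOn ℝ ∞ F (J ×ˢ U)) (hG : ContDiffOn ℝ ∞ G (J ×ˢ U))
    {v : E → E} (hv : ∀ u ∈ U, v u = mfderiv 𝓘(ℝ, E) 𝓘(ℝ, E) (chartAt E z)
      ((chartAt E z).symm u) (X.vec ((chartAt E z).symm u)))
    (hFt : ∀ t ∈ J, ∀ u ∈ U, fderiv ℝ F (t, u) (1, 0) = fderiv ℝ F (t, u) (0, v u))
    (hGt : ∀ t ∈ J, ∀ u ∈ U, fderiv ℝ G (t, u) (1, 0) = fderiv ℝ G (t, u) (0, v u)) :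
    ContDiffOn ℝ ∞ (chartBracket P z F G) (J ×ˢ U) ∧ ∀ t ∈ J, ∀ u ∈ U,
      fderiv ℝ (chartBracket P z F G) (t, u) (1, 0) =
        fderiv ℝ (chartBracket P z F G) (t, u) (0, v u) := by
  have hopen : IsOpen (J ×ˢ U) := hJ.prod hU
  set φ := chartAt E z
  have hpart : ∀ {F : ℝ × E → ℝ}, ContDiffOn ℝ ∞ F (J ×ˢ U) → ∀ w,
      ContDiffOn ℝ ∞ (fun p => fderiv ℝ F p w) (J ×ˢ U) := fun hF w =>
    (hF.fderiv_of_isOpen hopen (by simp)).clm_apply contDiffOn_const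
  have hc : ContDiffOn ℝ ∞ (chartBracket P z F G) (J ×ˢ U) := by
    refine ContDiffOn.sum fun i _ => ContDiffOn.sum fun j _ => ContDiffOn.mul ?_ ?_
    · exact (contDiffOn_chartTensor P z i j).comp contDiffOn_snd fun p hp => hUt hp.2
    · exact (hpart hF _).mul (hpart hG _)
  refine ⟨hc, fun t ht u hu => ?_⟩
  have hdiff : ∀ {F : ℝ × E → ℝ}, ContDiffOn ℝ ∞ F (J ×ˢ U) → ∀ u ∈ U,
      ContDiffAt ℝ ∞ F (t, u) := fun hF u hu => hF.contDiffAt (hopen.mem_nhds ⟨ht, hu⟩)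
  have hslice : ∀ {F : ℝ × E → ℝ}, ContDiffOn ℝ ∞ F (J ×ˢ U) →
      ContDiffOn ℝ ∞ (fun u => F (t, u)) U := fun hF =>
    hF.comp (contDiff_const.prodMk contDiff_id).contDiffOn fun u hu => ⟨ht, hu⟩
  have hslice' : ∀ {F : ℝ × E → ℝ}, ContDiffOn ℝ ∞ F (J ×ˢ U) → ∀ u ∈ U, ∀ w,
      fderiv ℝ (fun u' => F (t, u')) u w = fderiv ℝ F (t, u) (0, w) := fun hF u hu w =>
    fderiv_slice_right ((hdiff hF u hu).differentiableAt (by simp)) w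
  have hxs : ∀ u ∈ U, φ.symm u ∈ φ.source := fun u hu => φ.map_target (hUt hu)
  have hnear : ∀ᶠ y in 𝓝 (φ.symm u), y ∈ φ.source ∧ φ y ∈ U := by
    have := φ.isOpen_inter_preimage hU
    exact this.mem_nhds ⟨hxs u hu, by rw [mem_preimage, φ.right_inv (hUt hu)]; exact hu⟩
  -- derivatives along the vector field of functions given in coordinates
  have hder : ∀ {a : E → ℝ}, ContDiffOn ℝ ∞ a U → ∀ u ∈ U,
      fderiv ℝ a u (v u) = localBracket P (a ∘ φ) h (φ.symm u) := by
    intro a ha u hu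
    have hga := (localBracket_comp_chart (P := P) hU hUt ha ha hu).1
    have he : (a ∘ φ) ∘ φ.symm =ᶠ[𝓝 u] a := by
      filter_upwards [φ.open_target.mem_nhds (hUt hu)] with w hw
      simp [φ.right_inv hw]
    rw [← hX.mfderiv_eq (hUd hu) hga, mfderiv_eq_fderiv_comp_symm (hxs u hu) hga,
      φ.right_inv (hUt hu), he.fderiv_eq, hv u hu]
    rfl
  set x := φ.symm u
  have hφx : φ x = u := φ.right_inv (hUt hu)
  have hh : GermSmooth E h x := germSmooth_of_smoothOn X.isOpen_dom hX.1 (hUd hu)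
  have hFg := (localBracket_comp_chart (P := P) hU hUt (hslice hF) (hslice hF) hu).1
  have hGg := (localBracket_comp_chart (P := P) hU hUt (hslice hG) (hslice hG) hu).1
  -- the time derivative of the transported functions
  have hdot : ∀ {F : ℝ × E → ℝ}, ContDiffOn ℝ ∞ F (J ×ˢ U) →
      (∀ t ∈ J, ∀ u ∈ U, fderiv ℝ F (t, u) (1, 0) = fderiv ℝ F (t, u) (0, v u)) →
      (fun u' => fderiv ℝ F (t, u') (1, 0)) ∘ φ =ᶠ[𝓝 x]
        localBracket P ((fun u' => F (t, u')) ∘ φ) h := by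
    intro F hF hFt
    filter_upwards [hnear] with y hy
    rw [Function.comp_apply, hFt t ht _ hy.2, ← hslice' hF _ hy.2, hder (hslice hF) _ hy.2,
      φ.left_inv hy.1]
  have hleft : fderiv ℝ (chartBracket P z F G) (t, u) (1, 0) =
      localBracket P ((fun u' => fderiv ℝ F (t, u') (1, 0)) ∘ φ) ((fun u' => G (t, u')) ∘ φ) x +
      localBracket P ((fun u' => F (t, u')) ∘ φ) ((fun u' => fderiv ℝ G (t, u') (1, 0)) ∘ φ) x := by
    rw [(localBracket_comp_chart hU hUt (hslice (hpart hF (1, 0))) (hslice hG) hu).2,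
      (localBracket_comp_chart hU hUt (hslice hF) (hslice (hpart hG (1, 0))) hu).2]
    have h1 := hasDerivAt_slice_left ((hdiff hc u hu).differentiableAt (by simp))
    have h2 : HasDerivAt (fun s => chartBracket P z F G (s, u))
        (∑ i, ∑ j, chartTensor P z i j u *
          (fderiv ℝ (fun u' => fderiv ℝ F (t, u') (1, 0)) u (modelBasis E i) *
            fderiv ℝ G (t, u) (0, modelBasis E j) + fderiv ℝ F (t, u) (0, modelBasis E i) *
            fderiv ℝ (fun u' => fderiv ℝ G (t, u') (1, 0)) u (modelBasis E j))) t := by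
      refine HasDerivAt.fun_sum fun i _ => HasDerivAt.fun_sum fun j _ => ?_
      exact ((hasDerivAt_fderiv_slice (hdiff hF u hu) _).mul
        (hasDerivAt_fderiv_slice (hdiff hG u hu) _)).const_mul (chartTensor P z i j u)
    rw [h1.unique h2]
    simp only [mul_add, Finset.sum_add_distrib, hslice' hF u hu, hslice' hG u hu]
  have hright : fderiv ℝ (chartBracket P z F G) (t, u) (0, v u) =
      localBracket P (localBracket P ((fun u' => F (t, u')) ∘ φ) ((fun u' => G (t, u')) ∘ φ))
        h x := by
    rw [← hslice' hc u hu, hder (hslice hc) u hu]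
    refine localBracket_congr P ?_ EventuallyEq.rfl
    filter_upwards [hnear] with y hy
    have h3 := (localBracket_comp_chart (P := P) hU hUt (hslice hF) (hslice hG) hy.2).2
    rw [φ.left_inv hy.1] at h3
    rw [h3]
    simp only [Function.comp_apply, chartBracket, hslice' hF _ hy.2, hslice' hG _ hy.2]
  rw [hleft, hright, localBracket_derivation P hFg hGg hh,
    localBracket_congr P (hdot hF hFt) EventuallyEq.rfl,
    localBracket_congr P EventuallyEq.rfl (hdot hG hGt)]

/-- Hamiltonian flows for short times are smooth and preserve the bracket. -/
lemma IsHamiltonian.exists_local_poisson_flow {h : M → ℝ} {X : LocalVectorField E M}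
    (hX : IsHamiltonian P h X) {z : M} (hz : z ∈ X.dom) :
    ∃ ε > 0, ∃ W ∈ 𝓝 z, ∀ x ∈ W, ∀ t ∈ Ioo (-ε) ε, ∃ Θ : M → M, IsPoissonAt P Θ x ∧
      ∀ᶠ x' in 𝓝 x, FlowsTo X t x' (Θ x') := by
  obtain ⟨ε, hε, U, hU, hzU, hUt, θ, hθ, hθ0, hθm, hθf⟩ := exists_chart_flow X hz
  set φ := chartAt E z
  have hopen : IsOpen (Ioo (-ε) ε ×ˢ U) := isOpen_Ioo.prod hU
  have h0ε : (0 : ℝ) ∈ Ioo (-ε) ε := ⟨by linarith, hε⟩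
  -- smaller times and points, for which the flow stays in `U`
  obtain ⟨δ, hδ, V, hV, hzV, hδε, hVU, hδV⟩ : ∃ δ > 0, ∃ V : Set E, IsOpen V ∧ φ z ∈ V ∧
      Ioo (-δ) δ ⊆ Ioo (-ε) ε ∧ V ⊆ U ∧ ∀ t ∈ Ioo (-δ) δ, ∀ u ∈ V, θ (t, u) ∈ U := by
    have hnear : (Ioo (-ε) ε ×ˢ U) ∩ θ ⁻¹' U ∈ 𝓝 ((0 : ℝ), φ z) := by
      refine inter_mem (hopen.mem_nhds ⟨h0ε, hzU⟩) ?_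
      refine (hθ.contDiffAt (hopen.mem_nhds ⟨h0ε, hzU⟩)).continuousAt.preimage_mem_nhds ?_
      rw [hθ0 _ hzU]
      exact hU.mem_nhds hzU
    obtain ⟨δ, hδ, hδs⟩ := Metric.mem_nhds_iff.1 hnear
    have hsub : ∀ t ∈ Ioo (-δ) δ, ∀ u ∈ Metric.ball (φ z) δ,
        (t, u) ∈ (Ioo (-ε) ε ×ˢ U) ∩ θ ⁻¹' U := by
      intro t ht u hu
      refine hδs ?_
      rw [Metric.mem_ball, Prod.dist_eq, max_lt_iff]
      exact ⟨by rw [Real.dist_eq, sub_zero, abs_lt]; exact ht, hu⟩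
    exact ⟨δ, hδ, Metric.ball (φ z) δ, Metric.isOpen_ball, Metric.mem_ball_self hδ,
      fun t ht => (hsub t ht _ (Metric.mem_ball_self hδ)).1.1,
      fun u hu => (hsub 0 ⟨by linarith, hδ⟩ u hu).1.2, fun t ht u hu => (hsub t ht u hu).2⟩
  have hWn : φ.source ∩ φ ⁻¹' V ∈ 𝓝 z :=
    (φ.isOpen_inter_preimage hV).mem_nhds ⟨mem_chart_source E z, hzV⟩
  refine ⟨δ, hδ, _, hWn, fun x hx t ht => ⟨fun y => φ.symm (θ (t, φ y)), ⟨?_, ?_⟩, ?_⟩⟩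
  · filter_upwards [(φ.isOpen_inter_preimage hV).mem_nhds hx] with y hy
    have hp : (t, φ y) ∈ Ioo (-ε) ε ×ˢ U := ⟨hδε ht, hVU hy.2⟩
    have h1 : ContDiffAt ℝ ∞ (fun u => θ (t, u)) (φ y) :=
      (hθ.contDiffAt (hopen.mem_nhds hp)).comp (φ y) (contDiffAt_const.prodMk contDiffAt_id)
    exact (contMDiffAt_chart_symm (z := z) (hθm hp)).comp y
      (h1.contMDiffAt.comp y (contMDiffAt_chart hy.1))
  · rintro f g ⟨p, hp⟩ ⟨q, hq⟩
    set u := φ x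
    have huV : u ∈ V := hx.2
    have hxu : φ.symm u = x := φ.left_inv hx.1
    have htx : (t, u) ∈ Ioo (-ε) ε ×ˢ U := ⟨hδε ht, hVU huV⟩
    have hcont : ContinuousAt (fun y => φ.symm (θ (t, φ y))) x := by
      have h1 : ContDiffAt ℝ ∞ (fun u => θ (t, u)) (φ x) :=
        (hθ.contDiffAt (hopen.mem_nhds htx)).comp (φ x) (contDiffAt_const.prodMk contDiffAt_id)
      exact ContinuousAt.comp (f := fun y => θ (t, φ y))
        (contMDiffAt_chart_symm (z := z) (hθm htx)).continuousAt
        (h1.continuousAt.comp (φ.continuousAt hx.1))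
    let v : E → E := fun u => mfderiv 𝓘(ℝ, E) 𝓘(ℝ, E) φ (φ.symm u) (X.vec (φ.symm u))
    have hUd : MapsTo φ.symm U X.dom := fun u hu => (hθf u hu 0 h0ε).1.mem_dom.1
    have hsm : ∀ p : Smooth E M, ContDiffOn ℝ ∞ (fun a => p (φ.symm (θ a))) (Ioo (-ε) ε ×ˢ U) := by
      intro p
      have h1 : ContDiffOn ℝ ∞ (p ∘ φ.symm) φ.target := by
        rw [← contMDiffOn_iff_contDiffOn]
        exact p.contMDiff.comp_contMDiffOn contMDiffOn_chart_symm
      exact h1.comp hθ hθm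
    -- the functions `p ∘ F_t` are transported by the vector field, by the group law of the flow
    have htr : ∀ p : Smooth E M, ∀ t ∈ Ioo (-ε) ε, ∀ u ∈ U,
        fderiv ℝ (fun a => p (φ.symm (θ a))) (t, u) (1, 0) =
          fderiv ℝ (fun a => p (φ.symm (θ a))) (t, u) (0, v u) := by
      intro p t ht u hu
      have hd := ((hsm p).contDiffAt (x := (t, u)) (hopen.mem_nhds ⟨ht, hu⟩)).differentiableAt
        (by simp)
      have h1 : HasDerivAt (fun s : ℝ => t + s) 1 0 := (hasDerivAt_id 0).const_add t
      have hst := hasDerivAt_slice_left hd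
      rw [← add_zero t] at hst
      have h2 := hst.comp 0 h1
      have h3 : HasDerivAt (fun s => θ (s, u)) (v u) 0 := by
        have := (hθf u hu 0 h0ε).2
        rwa [hθ0 u hu] at this
      have h4 : HasFDerivAt (fun a => p (φ.symm (θ a)))
          (fderiv ℝ (fun a => p (φ.symm (θ a))) (t, u)) (t, θ (0, u)) := by
        rw [hθ0 u hu]; exact hd.hasFDerivAt
      have h5 := h4.comp_hasDerivAt (0 : ℝ) ((hasDerivAt_const (0 : ℝ) t).prodMk h3)
      have he : ((fun s => p (φ.symm (θ (s, u)))) ∘ fun s => t + s) =ᶠ[𝓝 0]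
          (fun a => p (φ.symm (θ a))) ∘ fun s => (t, θ (s, u)) := by
        have c1 : ∀ᶠ s : ℝ in 𝓝 0, t + s ∈ Ioo (-ε) ε := by
          refine h1.continuousAt.preimage_mem_nhds ?_
          change Ioo (-ε) ε ∈ 𝓝 (t + 0)
          rw [add_zero]
          exact isOpen_Ioo.mem_nhds ht
        have c2 : ∀ᶠ s : ℝ in 𝓝 0, θ (s, u) ∈ U := by
          refine h3.continuousAt.preimage_mem_nhds ?_
          rw [hθ0 u hu]
          exact hU.mem_nhds hu
        filter_upwards [c1, c2, isOpen_Ioo.mem_nhds h0ε] with s h1 h2 h3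
        have f1 := (hθf u hu _ h1).1
        have f2 := (hθf u hu s h3).1.trans (hθf _ h2 t ht).1
        rw [add_comm s t] at f2
        exact congrArg p (f1.unique f2)
      have h6 := h2.unique (h5.congr_of_eventuallyEq he)
      simpa using h6
    obtain ⟨hc, hct⟩ := chartBracket_transport hX isOpen_Ioo hU hUt hUd (hsm p) (hsm q)
      (fun u _ => rfl) (htr p) (htr q)
    set c := chartBracket P z (fun a => p (φ.symm (θ a))) (fun a => q (φ.symm (θ a)))
    -- hence the bracket is constant along the backward flow
    have hconst : c (0, θ (t - 0, u)) = c (t, θ (t - t, u)) := by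
      have hsub : ∀ r ∈ Ioo (max (-δ) (t - δ)) (min δ (t + δ)),
          r ∈ Ioo (-δ) δ ∧ t - r ∈ Ioo (-δ) δ := by
        rintro r ⟨h1, h2⟩
        rw [max_lt_iff] at h1
        rw [lt_min_iff] at h2
        exact ⟨⟨h1.1, h2.1⟩, by linarith [h2.2], by linarith [h1.2]⟩
      have hd : ∀ r ∈ Ioo (max (-δ) (t - δ)) (min δ (t + δ)),
          HasDerivAt (fun r => c (r, θ (t - r, u))) 0 r := by
        intro r hr
        obtain ⟨hr1, hr2⟩ := hsub r hr
        have hin := hδV _ hr2 u huV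
        have h1 : HasDerivAt (fun r => t - r) (-1) r := by
          simpa using (hasDerivAt_id r).const_sub t
        have h2 := ((hθf u (hVU huV) _ (hδε hr2)).2).scomp r h1
        have h3 := ((hc.contDiffAt (hopen.mem_nhds ⟨hδε hr1, hin⟩)).differentiableAt
          (by simp)).hasFDerivAt.comp_hasDerivAt r ((hasDerivAt_id r).prodMk h2)
        refine h3.congr_deriv ?_
        have h4 := hct r (hδε hr1) _ hin
        have h5 : ((1 : ℝ), (-1 : ℝ) • v (θ (t - r, u))) =
            (1, 0) - (0, v (θ (t - r, u))) := by simp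
        change fderiv ℝ c (r, θ (t - r, u)) ((1 : ℝ), (-1 : ℝ) • v (θ (t - r, u))) = 0
        rw [h5, map_sub, h4, sub_self]
      refine isOpen_Ioo.is_const_of_deriv_eq_zero isPreconnected_Ioo
        (fun r hr => (hd r hr).differentiableAt.differentiableWithinAt)
        (fun r hr => (hd r hr).deriv) (x := 0) (y := t) ?_ ?_
      · rw [mem_Ioo, max_lt_iff, lt_min_iff]
        exact ⟨⟨by linarith, by linarith [ht.2]⟩, hδ, by linarith [ht.1]⟩
      · rw [mem_Ioo, max_lt_iff, lt_min_iff]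
        exact ⟨⟨ht.1, by linarith⟩, ht.2, by linarith⟩
    have hcval : ∀ s ∈ Ioo (-ε) ε, ∀ w ∈ U, c (s, w) = localBracket P
        ((fun w' => p (φ.symm (θ (s, w')))) ∘ φ) ((fun w' => q (φ.symm (θ (s, w')))) ∘ φ)
          (φ.symm w) := by
      intro s hs w hw
      have hsl : ∀ p : Smooth E M, ContDiffOn ℝ ∞ (fun w' => p (φ.symm (θ (s, w')))) U := fun p =>
        (hsm p).comp (f := fun w' => (s, w')) (contDiff_const.prodMk contDiff_id).contDiffOn
          fun u hu => ⟨hs, hu⟩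
      have hsl' : ∀ p : Smooth E M, ∀ w', fderiv ℝ (fun w' => p (φ.symm (θ (s, w')))) w w' =
          fderiv ℝ (fun a => p (φ.symm (θ a))) (s, w) (0, w') := fun p w' =>
        fderiv_slice_right (F := fun a => p (φ.symm (θ a)))
          (((hsm p).contDiffAt (hopen.mem_nhds ⟨hs, hw⟩)).differentiableAt (by simp)) w'
      rw [(localBracket_comp_chart hU hUt (hsl p) (hsl q) hw).2]
      simp only [c, chartBracket, hsl']
    rw [sub_zero, sub_self, hθ0 u (hVU huV), hcval 0 h0ε _ (hδV t ht u huV),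
      hcval t (hδε ht) u (hVU huV), hxu] at hconst
    have e1 : localBracket P (f ∘ fun y => φ.symm (θ (t, φ y))) (g ∘ fun y => φ.symm (θ (t, φ y))) x =
        localBracket P ((fun w' => p (φ.symm (θ (t, w')))) ∘ φ)
          ((fun w' => q (φ.symm (θ (t, w')))) ∘ φ) x := by
      refine localBracket_congr P ?_ ?_
      · exact hcont.eventually (hp.symm)
      · exact hcont.eventually (hq.symm)
    rw [e1, ← hconst]
    have e2 : ∀ p : Smooth E M, (fun w' => p (φ.symm (θ (0, w')))) ∘ φ
        =ᶠ[𝓝 (φ.symm (θ (t, u)))] p := by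
      intro p
      have hmem := hδV t ht u huV
      filter_upwards [(φ.isOpen_inter_preimage hU).mem_nhds ⟨φ.map_target (hUt hmem), by
        rw [mem_preimage, φ.right_inv (hUt hmem)]; exact hmem⟩] with y hy
      simp only [Function.comp_apply]
      rw [hθ0 _ hy.2, φ.left_inv hy.1]
    exact localBracket_congr P ((e2 p).trans hp) ((e2 q).trans hq)
  · filter_upwards [(φ.isOpen_inter_preimage hV).mem_nhds hx] with y hy
    have := (hθf _ (hVU hy.2) t (hδε ht)).1
    rwa [φ.left_inv hy.1] at this

lemma flowsTo_zero (X : LocalVectorField E M) {x : M} (hx : x ∈ X.dom) : FlowsTo X 0 x x := by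
  obtain ⟨ε, hε, U, hU, hzU, hUt, θ, hθ, hθ0, hθm, hθf⟩ := exists_chart_flow X hx
  have := (hθf _ hzU 0 ⟨by linarith, hε⟩).1
  rwa [hθ0 _ hzU, (chartAt E x).left_inv (mem_chart_source E x)] at this

/-- Hamiltonian flows have open domains, are smooth and preserve the bracket. -/
lemma IsHamiltonian.exists_germ_of_flowsTo {h : M → ℝ} {X : LocalVectorField E M}
    (hX : IsHamiltonian P h X) {t : ℝ} {x y : M} (hxy : FlowsTo X t x y) :
    ∃ Θ : M → M, IsPoissonAt P Θ x ∧ ∀ᶠ x' in 𝓝 x, FlowsTo X t x' (Θ x') := by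
  obtain ⟨γ, a, b, h0, ht, hd, hγ, rfl, rfl⟩ := hxy
  -- the claim along the curve, which propagates in both directions for short times
  let Q : ℝ → Prop := fun t => ∃ Θ : M → M, IsPoissonAt P Θ (γ 0) ∧
    ∀ᶠ x' in 𝓝 (γ 0), FlowsTo X t x' (Θ x')
  have hstep : ∀ s ∈ Ioo a b, ∀ s' ∈ Ioo a b, (∃ Θ : M → M, IsPoissonAt P Θ (γ s) ∧
      ∀ᶠ x' in 𝓝 (γ s), FlowsTo X (s' - s) x' (Θ x')) → Q s → Q s' := by
    rintro s hs s' hs' ⟨Θ', hP', hΘ'⟩ ⟨Θ, hP, hΘ⟩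
    have hval : Θ (γ 0) = γ s := by
      have := FlowsTo.of_curve hd hγ h0 hs
      rw [sub_zero] at this
      exact hΘ.self_of_nhds.unique this
    rw [← hval] at hP' hΘ'
    refine ⟨Θ' ∘ Θ, hP'.comp hP, ?_⟩
    filter_upwards [hΘ, hP.1.self_of_nhds.continuousAt.eventually hΘ'] with w h1 h2
    have := h1.trans h2
    rwa [add_sub_cancel] at this
  have hQ0 : Q 0 := by
    refine ⟨id, isPoissonAt_id P _, ?_⟩
    filter_upwards [X.isOpen_dom.mem_nhds (hd h0)] with w hw using flowsTo_zero X hw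
  refine isPreconnected_Ioo.induction₂' (fun s s' => Q s → Q s') ?_
    (fun _ _ _ _ _ _ h1 h2 => h2 ∘ h1) h0 ht hQ0
  intro s hs
  obtain ⟨ε, hε, W, hW, hflow⟩ := hX.exists_local_poisson_flow (hd hs)
  have hcont : ContinuousAt γ s :=
    (hγ.isMIntegralCurveAt (isOpen_Ioo.mem_nhds hs)).continuousAt
  refine eventually_nhdsWithin_of_eventually_nhds ?_
  filter_upwards [isOpen_Ioo.mem_nhds hs, hcont.eventually hW,
    Metric.ball_mem_nhds s hε] with s' hs' hs'W hss'
  rw [Metric.mem_ball, Real.dist_eq, abs_lt] at hss'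
  exact ⟨hstep s hs s' hs' (hflow _ (mem_of_mem_nhds hW) _ ⟨by linarith, by linarith⟩),
    hstep s' hs' s hs (hflow _ hs'W _ ⟨by linarith, by linarith⟩)⟩

end PoissonFlow

/-! ### The polar pseudogroup -/

section PartialFunctions

variable {X : Type*}

lemma mem_pfun_comp {Y Z : Type*} {G : Y →. Z} {F : X →. Y} {x : X} {z : Z} :
    z ∈ (G.comp F) x ↔ ∃ y, y ∈ F x ∧ z ∈ G y := by
  rw [PFun.comp_apply]
  exact Part.mem_bind_iff

lemma mem_pfun_coe {Y : Type*} {f : X → Y} {x : X} {y : Y} : y ∈ (f : X →. Y) x ↔ y = f x := by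
  simp

lemma mem_pfun_dom {Y : Type*} {F : X →. Y} {x : X} : x ∈ F.Dom ↔ ∃ y, y ∈ F x := Part.dom_iff_mem

open Classical in
/-- The extension of a partial map by the identity. -/
def totalize (F : X →. X) (x : X) : X := if h : (F x).Dom then (F x).get h else x

lemma totalize_eq {F : X →. X} {x y : X} (h : y ∈ F x) : totalize F x = y := by
  obtain ⟨hd, rfl⟩ := h
  exact dif_pos hd

lemma totalize_mem {F : X →. X} {x : X} (h : x ∈ F.Dom) : totalize F x ∈ F x := by
  obtain ⟨y, hy⟩ := mem_pfun_dom.1 h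
  rwa [totalize_eq hy]

end PartialFunctions

section Pseudogroup

variable {E : Type*} [NormedAddCommGroup E] [NormedSpace ℝ E]
  {M : Type*} [TopologicalSpace M] [ChartedSpace E M] [IsManifold 𝓘(ℝ, E) ∞ M]

lemma pseudogroup_comp {𝒟 : Set (LocalVectorField E M)} {F G : M →. M} (hF : F ∈ pseudogroup 𝒟)
    (hG : G ∈ pseudogroup 𝒟) : F.comp G ∈ pseudogroup 𝒟 := by
  induction hF with
  | flow hX t => exact pseudogroup.comp hX t hG
  | comp hX t hF ih => rw [PFun.comp_assoc]; exact pseudogroup.comp hX t ih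

end Pseudogroup

section PolarMaps

variable {E : Type*} [NormedAddCommGroup E] [NormedSpace ℝ E] [FiniteDimensional ℝ E]
  {M : Type*} [TopologicalSpace M] [T2Space M] [ChartedSpace E M] [IsManifold 𝓘(ℝ, E) ∞ M]
  {P : PoissonStructure E M} {A : Subgroup (Equiv.Perm M)}

lemma IsPoissonAut.isPoissonAt {φ : Equiv.Perm M} (hφ : IsPoissonAut P φ) (x : M) :
    IsPoissonAt P φ x := by
  obtain ⟨Φ, hΦ, hbr⟩ := hφ
  have he : (φ : M → M) = Φ := funext fun x => (hΦ x).symm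
  rw [he]
  refine ⟨Eventually.of_forall fun y => Φ.contMDiff.contMDiffAt, ?_⟩
  rintro f g ⟨p, hp⟩ ⟨q, hq⟩
  have hc : ContinuousAt Φ x := Φ.continuous.continuousAt
  rw [localBracket_eq P hp hq, localBracket_eq P (f := f ∘ Φ) (g := g ∘ Φ)
    (p := p.comp (Φ : C^∞⟮𝓘(ℝ, E), M; 𝓘(ℝ, E), M⟯)) (q := q.comp Φ)
    (hc.eventually hp) (hc.eventually hq), hbr]
  rfl

/-- Maps that preserve the bracket carry Hamiltonian vector fields to Hamiltonian vector fields. -/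
lemma IsPoissonAt.mfderiv_vec {Θ : M → M} {x : M} (hΘ : IsPoissonAt P Θ x) {f g : M → ℝ}
    {X Y : LocalVectorField E M} (hX : IsHamiltonian P f X) (hY : IsHamiltonian P g Y)
    (hx : x ∈ X.dom) (hy : Θ x ∈ Y.dom) (hfg : g ∘ Θ =ᶠ[𝓝 x] f) :
    mfderiv 𝓘(ℝ, E) 𝓘(ℝ, E) Θ x (X.vec x) = Y.vec (Θ x) := by
  refine eq_of_forall_mfderiv_eq fun k => ?_
  have hk := Smooth.germSmooth k (Θ x)
  have h1 := hX.mfderiv_eq hx (hk.comp hΘ.1)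
  rw [mfderiv_comp (I' := 𝓘(ℝ, E)) x hk.mdifferentiableAt
    (hΘ.1.self_of_nhds.mdifferentiableAt (by simp))] at h1
  refine h1.trans ?_
  rw [localBracket_congr P EventuallyEq.rfl hfg.symm,
    hΘ.2 k g hk (germSmooth_of_smoothOn Y.isOpen_dom hY.1 hy)]
  exact (hY.mfderiv_eq hy hk).symm

/-- Elements of `A` map integral curves of the polar family to integral curves. -/
lemma FlowsTo.map_polar (hA : ∀ φ ∈ A, IsPoissonAut P φ) {X : LocalVectorField E M}
    (hX : X ∈ polarFamily P A) {φ : Equiv.Perm M} (hφ : φ ∈ A) {t : ℝ} {x y : M}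
    (h : FlowsTo X t x y) : FlowsTo X t (φ x) (φ y) := by
  obtain ⟨hinv, f, hf, hham⟩ := hX
  obtain ⟨γ, a, b, h0, ht, hd, hγ, rfl, rfl⟩ := h
  refine ⟨φ ∘ γ, a, b, h0, ht, fun s hs => hinv φ hφ _ (hd hs), fun s hs => ?_, rfl, rfl⟩
  have hP := (hA φ hφ).isPoissonAt (γ s)
  have h1 := (hP.1.self_of_nhds.mdifferentiableAt (by simp)).hasMFDerivAt.comp_hasMFDerivWithinAt
    s (hγ s hs)
  refine h1.congr_mfderiv ?_
  have h2 : mfderiv 𝓘(ℝ, E) 𝓘(ℝ, E) φ (γ s) (X.vec (γ s)) = X.vec (φ (γ s)) := by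
    refine hP.mfderiv_vec hham hham (hd hs) (hinv φ hφ _ (hd hs)) ?_
    filter_upwards [X.isOpen_dom.mem_nhds (hd hs)] with z hz using hf φ hφ z hz
  let L : E →L[ℝ] E := mfderiv 𝓘(ℝ, E) 𝓘(ℝ, E) φ (γ s)
  refine ContinuousLinearMap.ext fun (r : ℝ) => ?_
  change L (r • (X.vec (γ s) : E)) = r • (X.vec (φ (γ s)) : E)
  exact (L.map_smul r _).trans (congrArg (fun w : E => r • w) h2)

/-- An element of the pseudogroup has an open domain and is smooth and Poisson near each point. -/
lemma polar_germ {F : M →. M} (hF : F ∈ polarPseudogroup P A) {x y : M} (h : y ∈ F x) :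
    ∃ Θ : M → M, IsPoissonAt P Θ x ∧ ∀ᶠ x' in 𝓝 x, Θ x' ∈ F x' := by
  have hflow : ∀ {X : LocalVectorField E M}, X ∈ polarFamily P A → ∀ {t : ℝ} {x y : M},
      y ∈ flow X t x → ∃ Θ : M → M, IsPoissonAt P Θ x ∧ ∀ᶠ x' in 𝓝 x, Θ x' ∈ flow X t x' := by
    rintro X ⟨-, f, -, hX⟩ t x y hxy
    obtain ⟨Θ, h1, h2⟩ := hX.exists_germ_of_flowsTo (mem_flow_iff.1 hxy)
    exact ⟨Θ, h1, h2.mono fun x' hx' => mem_flow_iff.2 hx'⟩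
  induction hF generalizing x y with
  | flow hX t => exact hflow hX h
  | comp hX t hF ih =>
    obtain ⟨w, hw, hy⟩ := mem_pfun_comp.1 h
    obtain ⟨Θ, h1, h2⟩ := ih hw
    obtain rfl : Θ x = w := Part.mem_unique h2.self_of_nhds hw
    obtain ⟨Θ', h1', h2'⟩ := hflow hX hy
    refine ⟨Θ' ∘ Θ, h1'.comp h1, ?_⟩
    filter_upwards [h2, h1.1.self_of_nhds.continuousAt.eventually h2'] with x' e1 e2
    exact mem_pfun_comp.2 ⟨_, e1, e2⟩

lemma isOpen_polar_dom {F : M →. M} (hF : F ∈ polarPseudogroup P A) : IsOpen F.Dom := by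
  rw [isOpen_iff_mem_nhds]
  intro x hx
  obtain ⟨y, hy⟩ := mem_pfun_dom.1 hx
  obtain ⟨Θ, -, h⟩ := polar_germ hF hy
  filter_upwards [h] with x' hx' using mem_pfun_dom.2 ⟨_, hx'⟩

/-- The group `A` commutes with the pseudogroup. Used for `φ` and `φ⁻¹`, this contains the invariance
of the domains. -/
lemma polar_equivariant (hA : ∀ φ ∈ A, IsPoissonAut P φ) {F : M →. M}
    (hF : F ∈ polarPseudogroup P A) {φ : Equiv.Perm M} (hφ : φ ∈ A) {x y : M} (h : y ∈ F x) :
    φ y ∈ F (φ x) := by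
  induction hF generalizing x y with
  | flow hX t => exact mem_flow_iff.2 ((mem_flow_iff.1 h).map_polar hA hX hφ)
  | comp hX t hF ih =>
    obtain ⟨w, hw, hy⟩ := mem_pfun_comp.1 h
    exact mem_pfun_comp.2 ⟨φ w, ih hw, mem_flow_iff.2 ((mem_flow_iff.1 hy).map_polar hA hX hφ)⟩

/-- The pseudogroup is closed under inverses. -/
lemma exists_polar_inverse {F : M →. M} (hF : F ∈ polarPseudogroup P A) :
    ∃ G ∈ polarPseudogroup P A, ∀ x y, y ∈ F x ↔ x ∈ G y := by
  have hflow : ∀ (X : LocalVectorField E M) (t : ℝ) (x y : M),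
      y ∈ flow X t x ↔ x ∈ flow X (-t) y := by
    intro X t x y
    rw [mem_flow_iff, mem_flow_iff]
    exact ⟨FlowsTo.symm, fun h => by simpa using h.symm⟩
  induction hF with
  | flow hX t => exact ⟨_, pseudogroup.flow hX (-t), hflow _ t⟩
  | @comp X hX t F hF ih =>
    obtain ⟨G, hG, hFG⟩ := ih
    refine ⟨G.comp (flow X (-t)), pseudogroup_comp hG (pseudogroup.flow hX (-t)), fun x y => ?_⟩
    rw [mem_pfun_comp, mem_pfun_comp]
    exact exists_congr fun w => by rw [hFG x w, hflow X t w y, and_comm]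

/-- An element of the pseudogroup as a homeomorphism between open sets that is Poisson in both
directions. -/
lemma exists_polar_homeomorph {F : M →. M} (hF : F ∈ polarPseudogroup P A) :
    ∃ Φ : OpenPartialHomeomorph M M, Represents Φ F ∧ (∀ x ∈ Φ.source, IsPoissonAt P Φ x) ∧
      ∀ y ∈ Φ.target, IsPoissonAt P Φ.symm y := by
  have hP : ∀ {F : M →. M}, F ∈ polarPseudogroup P A → ∀ x ∈ F.Dom,
      IsPoissonAt P (totalize F) x := by
    intro F hF x hx
    obtain ⟨Θ, h1, h2⟩ := polar_germ hF (totalize_mem hx)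
    exact h1.congr (h2.mono fun x' hx' => (totalize_eq hx').symm)
  obtain ⟨G, hG, hFG⟩ := exists_polar_inverse hF
  refine ⟨{ toFun := totalize F
            invFun := totalize G
            source := F.Dom
            target := G.Dom
            map_source' := fun x hx => mem_pfun_dom.2 ⟨x, (hFG _ _).1 (totalize_mem hx)⟩
            map_target' := fun y hy => mem_pfun_dom.2 ⟨y, (hFG _ _).2 (totalize_mem hy)⟩
            left_inv' := fun x hx => totalize_eq ((hFG _ _).1 (totalize_mem hx))
            right_inv' := fun y hy => totalize_eq ((hFG _ _).2 (totalize_mem hy))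
            open_source := isOpen_polar_dom hF
            open_target := isOpen_polar_dom hG
            continuousOn_toFun := fun x hx =>
              (hP hF x hx).1.self_of_nhds.continuousAt.continuousWithinAt
            continuousOn_invFun := fun x hx =>
              (hP hG x hx).1.self_of_nhds.continuousAt.continuousWithinAt }, ?_, hP hF, hP hG⟩
  intro x y
  constructor
  · intro h
    exact ⟨mem_pfun_dom.2 ⟨y, h⟩, totalize_eq h⟩
  · rintro ⟨hx, rfl⟩
    exact totalize_mem hx

/-- The germ of an element of the pseudogroup is left-inverted by the germ of the inverse element. -/
lemma polar_germ_inverse {F G : M →. M} (hG : G ∈ polarPseudogroup P A)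
    (hFG : ∀ x y, y ∈ F x ↔ x ∈ G y) {Θ : M → M} {x : M} (hΘ : IsPoissonAt P Θ x)
    (h : ∀ᶠ x' in 𝓝 x, Θ x' ∈ F x') :
    ∃ Ψ : M → M, IsPoissonAt P Ψ (Θ x) ∧ (∀ᶠ y in 𝓝 (Θ x), Ψ y ∈ G y) ∧
      Ψ ∘ Θ =ᶠ[𝓝 x] id := by
  obtain ⟨Ψ, h1, h2⟩ := polar_germ hG ((hFG _ _).1 h.self_of_nhds)
  refine ⟨Ψ, h1, h2, ?_⟩
  filter_upwards [h, hΘ.1.self_of_nhds.continuousAt.eventually h2] with x' e1 e2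
  exact Part.mem_unique e2 ((hFG _ _).1 e1)

/-- The polar family is a Poisson family. -/
lemma isPoissonFamily_polarFamily : IsPoissonFamily P (polarFamily P A) := by
  intro F hF
  obtain ⟨Φ, hΦ, hP, hP'⟩ := exists_polar_homeomorph hF
  refine ⟨Φ, hΦ, fun x hx => (hP x hx).1.self_of_nhds.contMDiffWithinAt,
    fun y hy => (hP' y hy).1.self_of_nhds.contMDiffWithinAt, ?_⟩
  intro f g hf hg x hx
  have hy := Φ.map_source hx
  exact (hP x hx).2 f g (germSmooth_of_smoothOn Φ.open_target hf hy)
    (germSmooth_of_smoothOn Φ.open_target hg hy)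

/-- The pseudogroup preserves the polar distribution. -/
lemma mfderiv_mem_polarDistribution (hA : ∀ φ ∈ A, IsPoissonAut P φ) {F : M →. M}
    (hF : F ∈ polarPseudogroup P A) {Θ : M → M} {x : M} (hΘ : IsPoissonAt P Θ x)
    (h : ∀ᶠ x' in 𝓝 x, Θ x' ∈ F x') {v : TangentSpace 𝓘(ℝ, E) x}
    (hv : v ∈ polarDistribution P A x) :
    mfderiv 𝓘(ℝ, E) 𝓘(ℝ, E) Θ x v ∈ polarDistribution P A (Θ x) := by
  have hle : polarDistribution P A x ≤ (polarDistribution P A (Θ x)).comap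
      (mfderiv 𝓘(ℝ, E) 𝓘(ℝ, E) Θ x).toLinearMap := by
    refine Submodule.span_le.2 ?_
    rintro _ ⟨Y, ⟨hYinv, f, hf, hY⟩, hxY, rfl⟩
    obtain ⟨G, hG, hFG⟩ := exists_polar_inverse hF
    obtain ⟨Φ, hΦ, hΦP, -⟩ := exists_polar_homeomorph hG
    have hmemG : ∀ {y}, y ∈ Φ.source → Φ y ∈ G y := fun hy => (hΦ _ _).2 ⟨hy, rfl⟩
    have hequi : ∀ φ ∈ A, ∀ y ∈ Φ.source, φ y ∈ Φ.source ∧ Φ (φ y) = φ (Φ y) := fun φ hφ y hy =>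
      (hΦ _ _).1 (polar_equivariant hA hG hφ (hmemG hy))
    -- `f ∘ Φ`, where `Φ` inverts `F`, is invariant on an invariant set, and its vector field `Z`
    -- corresponds to `Y` under `F`
    have hU := Φ.isOpen_inter_preimage Y.isOpen_dom
    have hsm : SmoothOn E (Φ.source ∩ Φ ⁻¹' Y.dom) (f ∘ Φ) :=
      (smoothOn_iff_germSmooth hU).2 fun y hy =>
        (germSmooth_of_smoothOn Y.isOpen_dom hY.1 hy.2).comp (hΦP y hy.1).1
    obtain ⟨Z, hZd, hZ⟩ := exists_isHamiltonian P hU hsm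
    have hback : ∀ {x'}, Θ x' ∈ F x' → Θ x' ∈ Φ.source ∧ Φ (Θ x') = x' := fun h' =>
      (hΦ _ _).1 ((hFG _ _).1 h')
    have hyZ : Θ x ∈ Z.dom := by
      rw [hZd]
      obtain ⟨h1, h2⟩ := hback h.self_of_nhds
      exact ⟨h1, by rw [mem_preimage, h2]; exact hxY⟩
    have hZmem : Z ∈ polarFamily P A := by
      refine ⟨fun φ hφ y hy => ?_, f ∘ Φ, fun φ hφ y hy => ?_, hZ⟩
      · rw [hZd] at hy ⊢
        obtain ⟨h1, h2⟩ := hequi φ hφ y hy.1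
        exact ⟨h1, by rw [mem_preimage, h2]; exact hYinv φ hφ _ hy.2⟩
      · rw [hZd] at hy
        rw [Function.comp_apply, (hequi φ hφ y hy.1).2]
        exact hf φ hφ _ hy.2
    refine Submodule.subset_span ⟨Z, hZmem, hyZ, ?_⟩
    refine (hΘ.mfderiv_vec hY hZ hxY hyZ ?_).symm
    filter_upwards [h] with x' hx'
    simp only [Function.comp_apply, (hback hx').2]
  exact hle hv

/-- Two points are related if an element of the pseudogroup moves the one to the other. -/
def PolarRel (P : PoissonStructure E M) (A : Subgroup (Equiv.Perm M)) (x y : M) : Prop :=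
  ∃ F ∈ polarPseudogroup P A, y ∈ F x

lemma polarRel_refl (x : M) : PolarRel P A x x := by
  obtain ⟨X, hXd, hX⟩ := exists_isHamiltonian P isOpen_univ (f := fun _ => 0) contMDiffOn_const
  have hmem : X ∈ polarFamily P A :=
    ⟨fun _ _ _ _ => by rw [hXd]; trivial, fun _ => 0, fun _ _ _ _ => rfl, hX⟩
  exact ⟨_, pseudogroup.flow hmem 0, mem_flow_iff.2 (flowsTo_zero X (by rw [hXd]; trivial))⟩

lemma PolarRel.symm {x y : M} (h : PolarRel P A x y) : PolarRel P A y x := by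
  obtain ⟨F, hF, h⟩ := h
  obtain ⟨G, hG, hFG⟩ := exists_polar_inverse hF
  exact ⟨G, hG, (hFG _ _).1 h⟩

lemma PolarRel.trans {x y z : M} (h : PolarRel P A x y) (h' : PolarRel P A y z) :
    PolarRel P A x z := by
  obtain ⟨F, hF, h⟩ := h
  obtain ⟨G, hG, h'⟩ := h'
  exact ⟨_, pseudogroup_comp hG hF, mem_pfun_comp.2 ⟨y, h, h'⟩⟩

lemma FlowsTo.polarRel {X : LocalVectorField E M} (hX : X ∈ polarFamily P A) {t : ℝ} {x y : M}
    (h : FlowsTo X t x y) : PolarRel P A x y :=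
  ⟨_, pseudogroup.flow hX t, mem_flow_iff.2 h⟩

/-- The derivative of an element of the pseudogroup is injective and preserves the distribution. -/
lemma finrank_polarDistribution_le (hA : ∀ φ ∈ A, IsPoissonAut P φ) {x y : M}
    (h : PolarRel P A x y) : Module.finrank ℝ (polarDistribution P A x) ≤
      Module.finrank ℝ (polarDistribution P A y) := by
  obtain ⟨F, hF, h⟩ := h
  obtain ⟨Θ, h1, h2⟩ := polar_germ hF h
  obtain rfl := Part.mem_unique h2.self_of_nhds h
  obtain ⟨G, hG, hFG⟩ := exists_polar_inverse hF
  obtain ⟨Ψ, h3, h4, h5⟩ := polar_germ_inverse hG hFG h1 h2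
  have hinj : Function.Injective (mfderiv 𝓘(ℝ, E) 𝓘(ℝ, E) Θ x) := by
    have h6 := mfderiv_comp (I' := 𝓘(ℝ, E)) x (h3.1.self_of_nhds.mdifferentiableAt (by simp))
      (h1.1.self_of_nhds.mdifferentiableAt (by simp))
    rw [h5.mfderiv_eq, mfderiv_id] at h6
    refine Function.LeftInverse.injective (g := mfderiv 𝓘(ℝ, E) 𝓘(ℝ, E) Ψ (Θ x)) fun w => ?_
    exact (congrArg (fun L : E →L[ℝ] E => L w) h6).symm
  let L : E →ₗ[ℝ] E := (mfderiv 𝓘(ℝ, E) 𝓘(ℝ, E) Θ x).toLinearMap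
  let D : Submodule ℝ E := polarDistribution P A x
  let D' : Submodule ℝ E := polarDistribution P A (Θ x)
  have hmap : D.map L ≤ D' := by
    rintro _ ⟨w, hw, rfl⟩
    exact mfderiv_mem_polarDistribution hA hF h1 h2 hw
  have h7 : Module.finrank ℝ D = Module.finrank ℝ (D.map L) :=
    (LinearEquiv.finrank_eq (Submodule.equivMapOfInjective L hinj D))
  calc Module.finrank ℝ D = _ := h7
    _ ≤ Module.finrank ℝ D' := Submodule.finrank_mono hmap

lemma PolarRel.finrank_eq (hA : ∀ φ ∈ A, IsPoissonAut P φ) {x y : M} (h : PolarRel P A x y) :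
    Module.finrank ℝ (polarDistribution P A x) = Module.finrank ℝ (polarDistribution P A y) :=
  le_antisymm (finrank_polarDistribution_le hA h) (finrank_polarDistribution_le hA h.symm)

end PolarMaps

/-! ### Compositions of flows in a chart -/

section FoliatedCharts

variable {E : Type*} [NormedAddCommGroup E] [NormedSpace ℝ E] [FiniteDimensional ℝ E]
  {M : Type*} [TopologicalSpace M] [T2Space M] [ChartedSpace E M] [IsManifold 𝓘(ℝ, E) ∞ M]
  {P : PoissonStructure E M} {A : Subgroup (Equiv.Perm M)}

/-- The distribution `D` read in the chart at `z`. -/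
def chartDistribution (D : (z : M) → Submodule ℝ (TangentSpace 𝓘(ℝ, E) z)) (z : M) (u : E) :
    Submodule ℝ E :=
  (D ((chartAt E z).symm u)).comap (mfderiv 𝓘(ℝ, E) 𝓘(ℝ, E) (chartAt E z).symm u).toLinearMap

lemma mem_chartDistribution {D : (z : M) → Submodule ℝ (TangentSpace 𝓘(ℝ, E) z)} {z : M} {u w : E} :
    w ∈ chartDistribution D z u ↔
      mfderiv 𝓘(ℝ, E) 𝓘(ℝ, E) (chartAt E z).symm u w ∈ D ((chartAt E z).symm u) := Iff.rfl

/-- In a chart, flows of Hamiltonian vector fields of the polar family preserve the polar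
distribution. -/
lemma fderiv_flow_mem_chartDistribution (hA : ∀ φ ∈ A, IsPoissonAut P φ)
    {X : LocalVectorField E M} (hX : X ∈ polarFamily P A) {z : M} {t : ℝ} {f : E → E} {u : E}
    (hu : u ∈ (chartAt E z).target) (hfu : f u ∈ (chartAt E z).target)
    (hf : DifferentiableAt ℝ f u)
    (h : ∀ᶠ u' in 𝓝 u, FlowsTo X t ((chartAt E z).symm u') ((chartAt E z).symm (f u')))
    {w : E} (hw : w ∈ chartDistribution (polarDistribution P A) z u) :
    fderiv ℝ f u w ∈ chartDistribution (polarDistribution P A) z (f u) := by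
  have hF : flow X t ∈ polarPseudogroup P A := pseudogroup.flow hX t
  obtain ⟨Θ, h1, h2⟩ := polar_germ hF (mem_flow_iff.2 h.self_of_nhds)
  have hs := contMDiffAt_chart_symm (z := z) hu
  have e : Θ ∘ (chartAt E z).symm =ᶠ[𝓝 u] (chartAt E z).symm ∘ f := by
    filter_upwards [h, hs.continuousAt.eventually h2] with u' e1 e2
    exact Part.mem_unique e2 (mem_flow_iff.2 e1)
  have hd := e.mfderiv_eq (I := 𝓘(ℝ, E)) (I' := 𝓘(ℝ, E))
  rw [mfderiv_comp (I' := 𝓘(ℝ, E)) u (h1.1.self_of_nhds.mdifferentiableAt (by simp))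
    (hs.mdifferentiableAt (by simp)), mfderiv_comp (I' := 𝓘(ℝ, E)) u
    ((contMDiffAt_chart_symm hfu).mdifferentiableAt (by simp)) hf.mdifferentiableAt,
    mfderiv_eq_fderiv] at hd
  have hmem := mfderiv_mem_polarDistribution hA hF h1 h2 hw
  have he : Θ ((chartAt E z).symm u) = (chartAt E z).symm (f u) := e.self_of_nhds
  have hcast : ∀ {x : M} (hx : Θ ((chartAt E z).symm u) = x) {v : E},
      v ∈ (polarDistribution P A (Θ ((chartAt E z).symm u)) : Submodule ℝ E) →
        v ∈ (polarDistribution P A x : Submodule ℝ E) := by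
    rintro x rfl v hv
    exact hv
  refine hcast he ?_
  exact (congrArg (· ∈ (polarDistribution P A (Θ ((chartAt E z).symm u)) : Submodule ℝ E))
    (congrArg (fun L : E →L[ℝ] E => L w) hd)).mp hmem

/-- Composing flows of the polar family in the chart at `z`: a map `Ψ`, smooth near `(0, z)`, whose
slices `Ψ (·, u)` are tangent to the distribution and stay in one orbit, and whose derivative at the
centre covers prescribed values of members of the family. -/
lemma exists_multiflow (hA : ∀ φ ∈ A, IsPoissonAut P φ) (z : M) (s : Finset E)
    (hs : (s : Set E) ⊆ {v | ∃ X ∈ polarFamily P A, z ∈ X.dom ∧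
      mfderiv 𝓘(ℝ, E) 𝓘(ℝ, E) (chartAt E z) z (X.vec z) = v}) :
    ∃ (T : Type) (_ : NormedAddCommGroup T) (_ : NormedSpace ℝ T) (Ψ : T × E → E),
      (∀ᶠ u in 𝓝 (chartAt E z z), Ψ (0, u) = u) ∧
      (∀ᶠ p in 𝓝 ((0 : T), chartAt E z z), ContDiffAt ℝ ∞ Ψ p ∧ Ψ p ∈ (chartAt E z).target ∧
        PolarRel P A ((chartAt E z).symm p.2) ((chartAt E z).symm (Ψ p)) ∧
        ∀ τ : T, fderiv ℝ Ψ p (τ, 0) ∈ chartDistribution (polarDistribution P A) z (Ψ p)) ∧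
      ∀ v ∈ s, ∃ τ : T, fderiv ℝ Ψ (0, chartAt E z z) (τ, 0) = v := by
  classical
  induction s using Finset.induction_on with
  | empty =>
    refine ⟨ℝ, inferInstance, inferInstance, Prod.snd, Eventually.of_forall fun _ => rfl, ?_,
      by simp⟩
    have h : ∀ᶠ p in 𝓝 ((0 : ℝ), chartAt E z z), p.2 ∈ (chartAt E z).target :=
      continuousAt_snd.eventually ((chartAt E z).open_target.mem_nhds (mem_chart_target E z))
    filter_upwards [h] with p hp
    refine ⟨contDiffAt_snd, hp, polarRel_refl _, fun τ => ?_⟩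
    rw [fderiv_snd]
    exact Submodule.zero_mem _
  | insert v s hv ih =>
    obtain ⟨T, _, _, Ψ, h0, hΨ, hr⟩ := ih fun w hw => hs (by simp [hw])
    obtain ⟨X, hX, hzX, hXv⟩ := hs (show v ∈ _ by simp)
    obtain ⟨ε, hε, U, hU, hzU, hUt, θ, hθ, hθ0, hθm, hθf⟩ := exists_chart_flow X hzX
    set u₀ := chartAt E z z with hu₀
    have hO : IsOpen (Ioo (-ε) ε ×ˢ U) := isOpen_Ioo.prod hU
    have h0ε : (0 : ℝ) ∈ Ioo (-ε) ε := ⟨by linarith, hε⟩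
    have hΨ0 : Ψ (0, u₀) = u₀ := h0.self_of_nhds
    -- the flow of one more field `X` is applied after `Ψ`: the new map is `θ (t, Ψ (x, u))`
    let g : (ℝ × T) × E → ℝ × E := fun p => (p.1.1, Ψ (p.1.2, p.2))
    let k : (ℝ × T) × E →L[ℝ] T × E :=
      ((ContinuousLinearMap.snd ℝ ℝ T).comp (ContinuousLinearMap.fst ℝ (ℝ × T) E)).prod
        (ContinuousLinearMap.snd ℝ (ℝ × T) E)
    have hk : Tendsto k (𝓝 (0, u₀)) (𝓝 (0, u₀)) := k.continuous.tendsto' _ _ rfl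
    have hgd : ∀ {p : (ℝ × T) × E}, DifferentiableAt ℝ Ψ (k p) →
        HasFDerivAt g (((ContinuousLinearMap.fst ℝ ℝ T).comp
          (ContinuousLinearMap.fst ℝ (ℝ × T) E)).prod ((fderiv ℝ Ψ (k p)).comp k)) p :=
      fun {p} hp => (((ContinuousLinearMap.fst ℝ ℝ T).comp
          (ContinuousLinearMap.fst ℝ (ℝ × T) E)).hasFDerivAt).prodMk
            (hp.hasFDerivAt.comp p k.hasFDerivAt)
    have hgs : ∀ {p : (ℝ × T) × E}, ContDiffAt ℝ ∞ Ψ (k p) → ContDiffAt ℝ ∞ g p :=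
      fun {p} hp => (contDiffAt_fst.fst).prodMk (hp.comp p k.contDiff.contDiffAt)
    have hg0 : g (0, u₀) = (0, u₀) := Prod.ext rfl hΨ0
    have hgc : ∀ᶠ p in 𝓝 ((0 : ℝ × T), u₀), g p ∈ Ioo (-ε) ε ×ˢ U := by
      refine (hgs (p := (0, u₀)) hΨ.self_of_nhds.1).continuousAt.eventually ?_
      rw [hg0]
      exact hO.mem_nhds ⟨h0ε, hzU⟩
    have hθd : ∀ {q}, q ∈ Ioo (-ε) ε ×ˢ U → ContDiffAt ℝ ∞ θ q := fun hq =>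
      hθ.contDiffAt (hO.mem_nhds hq)
    have hcomp : ∀ {p : (ℝ × T) × E}, DifferentiableAt ℝ Ψ (k p) → g p ∈ Ioo (-ε) ε ×ˢ U →
        ∀ (a : ℝ) (b : T), fderiv ℝ (θ ∘ g) p ((a, b), 0) =
          a • fderiv ℝ θ (g p) (1, 0) + fderiv ℝ θ (g p) (0, fderiv ℝ Ψ (k p) (b, 0)) := by
      intro p hp hgp a b
      rw [(((hθd hgp).differentiableAt (by simp)).hasFDerivAt.comp p (hgd hp)).fderiv,
        ← map_smul, ← map_add]
      change fderiv ℝ θ (g p) (a, fderiv ℝ Ψ (k p) (b, 0)) = _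
      simp
    have hθt : ∀ {t u}, t ∈ Ioo (-ε) ε → u ∈ U → fderiv ℝ θ (t, u) (1, 0) =
        mfderiv 𝓘(ℝ, E) 𝓘(ℝ, E) (chartAt E z) ((chartAt E z).symm (θ (t, u)))
          (X.vec ((chartAt E z).symm (θ (t, u)))) := fun {t u} ht hu =>
      (hasDerivAt_slice_left ((hθd (q := (t, u)) ⟨ht, hu⟩).differentiableAt (by simp))).unique
        (hθf u hu t ht).2
    have hθx : ∀ {t u}, t ∈ Ioo (-ε) ε → u ∈ U → ∀ w, fderiv ℝ θ (t, u) (0, w) =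
        fderiv ℝ (fun u' => θ (t, u')) u w := fun {t u} ht hu w =>
      (fderiv_slice_right ((hθd (q := (t, u)) ⟨ht, hu⟩).differentiableAt (by simp)) w).symm
    refine ⟨ℝ × T, inferInstance, inferInstance, θ ∘ g, ?_, ?_, ?_⟩
    · filter_upwards [h0, hU.mem_nhds hzU] with u e1 e2
      change θ (0, Ψ (0, u)) = u
      rw [e1, hθ0 u e2]
    · filter_upwards [hgc, hk.eventually hΨ] with p e1 ⟨e2, e3, e4, e5⟩
      have hf := hθf (g p).2 e1.2 (g p).1 e1.1
      refine ⟨(hθd e1).comp p (hgs e2), hθm e1, e4.trans (hf.1.polarRel hX), ?_⟩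
      rintro ⟨a, b⟩
      rw [hcomp (e2.differentiableAt (by simp)) e1]
      refine Submodule.add_mem _ (Submodule.smul_mem _ _ ?_) ?_
      · have e6 := hθt e1.1 e1.2
        have e7 : X.vec ((chartAt E z).symm (θ (g p))) ∈
            polarDistribution P A ((chartAt E z).symm (θ (g p))) := by
          refine Submodule.subset_span ⟨X, hX, ?_, rfl⟩
          exact hf.1.mem_dom.2
        rw [show ((g p).1, (g p).2) = g p from rfl] at e6
        refine mem_chartDistribution.2 ?_
        change (mfderiv 𝓘(ℝ, E) 𝓘(ℝ, E) (chartAt E z).symm (θ (g p)) (fderiv ℝ θ (g p) (1, 0)) : E) ∈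
          (polarDistribution P A ((chartAt E z).symm (θ (g p))) : Submodule ℝ E)
        rw [e6]
        have e8 := mfderiv_chart_symm_mfderiv_chart (hθm e1)
          (X.vec ((chartAt E z).symm (θ (g p))))
        exact (congrArg (· ∈ (polarDistribution P A ((chartAt E z).symm (θ (g p))) :
          Submodule ℝ E)) e8).mpr e7
      · rw [show g p = ((g p).1, (g p).2) from rfl, hθx e1.1 e1.2]
        refine fderiv_flow_mem_chartDistribution hA hX (t := (g p).1)
          (f := fun u' => θ ((g p).1, u')) e3 (hθm e1) ?_ ?_ (e5 b)
        · exact ((hθd e1).differentiableAt (by simp)).comp (g p).2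
            (differentiableAt_const _ |>.prodMk differentiableAt_id)
        · filter_upwards [hU.mem_nhds e1.2] with u' hu' using (hθf u' hu' _ e1.1).1
    · intro w hw
      have hd := (hΨ.self_of_nhds.1).differentiableAt (by simp)
      have hc := hcomp (p := (0, u₀)) hd (by rw [hg0]; exact ⟨h0ε, hzU⟩)
      have hk0 : k (0, u₀) = (0, u₀) := rfl
      simp only [hg0, hk0] at hc
      rcases Finset.mem_insert.1 hw with rfl | hw
      · refine ⟨(1, 0), ?_⟩
        have hcast : ∀ {x : M} (hx : z = x),
            (mfderiv 𝓘(ℝ, E) 𝓘(ℝ, E) (chartAt E z) x (X.vec x) : E) =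
              mfderiv 𝓘(ℝ, E) 𝓘(ℝ, E) (chartAt E z) z (X.vec z) := by
          rintro x rfl
          rfl
        refine (hc 1 0).trans ?_
        have hx : z = (chartAt E z).symm (θ (0, u₀)) := by
          rw [hθ0 _ hzU, hu₀, (chartAt E z).left_inv (mem_chart_source E z)]
        rw [(hθt h0ε hzU).trans ((hcast hx).trans hXv), one_smul, Prod.mk_zero_zero, map_zero,
          Prod.mk_zero_zero, map_zero, add_zero]
      · obtain ⟨τ, hτ⟩ := hr w hw
        refine ⟨(0, τ), (hc 0 τ).trans ?_⟩
        rw [hτ, zero_smul, zero_add, hθx h0ε hzU]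
        have e : (fun u' => θ (0, u')) =ᶠ[𝓝 u₀] id := by
          filter_upwards [hU.mem_nhds hzU] with u hu using hθ0 u hu
        rw [e.fderiv_eq, fderiv_id]
        rfl

end FoliatedCharts

/-! ### Foliated parametrizations -/

section FoliatedParametrizations

variable {E : Type*} [NormedAddCommGroup E] [NormedSpace ℝ E] [FiniteDimensional ℝ E]
  {M : Type*} [TopologicalSpace M] [T2Space M] [ChartedSpace E M] [IsManifold 𝓘(ℝ, E) ∞ M]
  {P : PoissonStructure E M} {A : Subgroup (Equiv.Perm M)}
  {T S : Type*} [NormedAddCommGroup T] [NormedSpace ℝ T] [NormedAddCommGroup S] [NormedSpace ℝ S]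

/-- A linear lift through a linear map. -/
lemma exists_linear_lift {T' : Type*} [AddCommGroup T'] [Module ℝ T'] {V : Type*} [AddCommGroup V]
    [Module ℝ V] {W : Type*} [AddCommGroup W] [Module ℝ W] (g : T' →ₗ[ℝ] V) (h : W →ₗ[ℝ] V)
    (hgh : LinearMap.range h ≤ LinearMap.range g) : ∃ i : W →ₗ[ℝ] T', ∀ w, g (i w) = h w := by
  obtain ⟨i, hi⟩ := Module.projective_lifting_property g.rangeRestrict
    (h.codRestrict (LinearMap.range g) fun w => hgh ⟨w, rfl⟩) g.surjective_rangeRestrict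
  exact ⟨i, fun w => congrArg Subtype.val (LinearMap.congr_fun hi w)⟩

/-- A smooth parametrization of an open subset of `M` by a ball in `T × S`, whose slices
`s = const`, the plaques, are tangent to the polar distribution and contained in orbits of the
pseudogroup. (In the product norm, a ball is a product of balls.) -/
structure IsFoliatedParam (P : PoissonStructure E M) (A : Subgroup (Equiv.Perm M))
    (Λ : OpenPartialHomeomorph (T × S) M) : Prop where
  source_eq : ∃ r > 0, Λ.source = Metric.ball 0 r
  smooth : ∀ p ∈ Λ.source, ContMDiffAt 𝓘(ℝ, T × S) 𝓘(ℝ, E) ∞ Λ p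
  smooth_symm : ∀ x ∈ Λ.target, ContMDiffAt 𝓘(ℝ, E) 𝓘(ℝ, T × S) ∞ Λ.symm x
  rel : ∀ p ∈ Λ.source, PolarRel P A (Λ (0, p.2)) (Λ p)
  tangent : ∀ p ∈ Λ.source, ∀ τ : T,
    mfderiv 𝓘(ℝ, T × S) 𝓘(ℝ, E) Λ p ((τ, 0) : T × S) ∈ polarDistribution P A (Λ p)

lemma map_polarDistribution_chart (z : M) :
    ((polarDistribution P A z).map (mfderiv 𝓘(ℝ, E) 𝓘(ℝ, E) (chartAt E z) z).toLinearMap :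
      Submodule ℝ E) = Submodule.span ℝ {v : E | ∃ X ∈ polarFamily P A, z ∈ X.dom ∧
        mfderiv 𝓘(ℝ, E) 𝓘(ℝ, E) (chartAt E z) z (X.vec z) = v} := by
  refine (Submodule.map_span _ _).trans ?_
  congr 1
  ext v
  constructor
  · rintro ⟨_, ⟨X, h1, h2, rfl⟩, rfl⟩
    exact ⟨X, h1, h2, rfl⟩
  · rintro ⟨X, h1, h2, rfl⟩
    exact ⟨_, ⟨X, h1, h2, rfl⟩, rfl⟩

lemma finrank_map_chart (z : M) (D : Submodule ℝ (TangentSpace 𝓘(ℝ, E) z)) :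
    Module.finrank ℝ (D.map (mfderiv 𝓘(ℝ, E) 𝓘(ℝ, E) (chartAt E z) z).toLinearMap :
      Submodule ℝ E) = Module.finrank ℝ D := by
  have hinj : Function.Injective (mfderiv 𝓘(ℝ, E) 𝓘(ℝ, E) (chartAt E z) z) := by
    refine Function.LeftInverse.injective
      (g := mfderiv 𝓘(ℝ, E) 𝓘(ℝ, E) (chartAt E z).symm (chartAt E z z)) fun w => ?_
    have h := (mdifferentiable_chart (I := 𝓘(ℝ, E)) z).symm_comp_deriv (mem_chart_source E z)
    exact congrArg (fun L : E →L[ℝ] E => L w) h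
  exact (LinearEquiv.finrank_eq (Submodule.equivMapOfInjective _ hinj D)).symm

/-- Every point is the centre of a foliated parametrization. -/
lemma exists_foliatedParam (hA : ∀ φ ∈ A, IsPoissonAut P φ) (z : M) {d : ℕ}
    (hd : Module.finrank ℝ (polarDistribution P A z) = d) :
    ∃ Λ : OpenPartialHomeomorph
        (EuclideanSpace ℝ (Fin d) × EuclideanSpace ℝ (Fin (Module.finrank ℝ E - d))) M,
      IsFoliatedParam P A Λ ∧ Λ 0 = z := by
  classical
  set T := EuclideanSpace ℝ (Fin d)
  set S := EuclideanSpace ℝ (Fin (Module.finrank ℝ E - d))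
  set u₀ := chartAt E z z with hu₀
  let W : Submodule ℝ E :=
    (polarDistribution P A z).map (mfderiv 𝓘(ℝ, E) 𝓘(ℝ, E) (chartAt E z) z).toLinearMap
  have hW : Module.finrank ℝ W = d := (finrank_map_chart z _).trans hd
  -- a linear isomorphism that takes `T × 0` to the distribution
  obtain ⟨C, hC⟩ := Submodule.exists_isCompl W
  have hCd : Module.finrank ℝ C = Module.finrank ℝ E - d := by
    have := Submodule.finrank_add_eq_of_isCompl hC
    omega
  let L : (T × S) ≃L[ℝ] E :=
    (((LinearEquiv.ofFinrankEq T W (by simp [T, hW])).prodCongr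
      (LinearEquiv.ofFinrankEq S C (by simp [S, hCd]))).trans
        (Submodule.prodEquivOfIsCompl W C hC)).toContinuousLinearEquiv
  have hL : ∀ t : T, L (t, 0) ∈ W := fun t => by simp [L]
  -- finitely many members of the family span the distribution at `z`
  obtain ⟨s, hs, hspan⟩ := (Submodule.fg_span_iff_fg_span_finset_subset _).1
    (IsNoetherian.noetherian (Submodule.span ℝ {v : E | ∃ X ∈ polarFamily P A, z ∈ X.dom ∧
        mfderiv 𝓘(ℝ, E) 𝓘(ℝ, E) (chartAt E z) z (X.vec z) = v}))
  have hWs : W = Submodule.span ℝ (s : Set E) := (map_polarDistribution_chart z).trans hspan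
  obtain ⟨T', _, _, Ψ, h0, hΨ, hr⟩ := exists_multiflow hA z s hs
  rw [← hu₀] at h0 hΨ hr
  obtain ⟨i, hi⟩ := exists_linear_lift
    ((fderiv ℝ Ψ (0, u₀)).comp (ContinuousLinearMap.inl ℝ T' E)).toLinearMap
    (L.toContinuousLinearMap.comp (ContinuousLinearMap.inl ℝ T S)).toLinearMap (by
      refine le_trans (b := W) ?_ ?_
      · rintro _ ⟨t, rfl⟩
        exact hL t
      · rw [hWs, Submodule.span_le]
        intro v hv
        obtain ⟨τ, hτ⟩ := hr v hv
        exact ⟨τ, hτ⟩)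
  let ι : T →L[ℝ] T' := LinearMap.toContinuousLinearMap i
  have hι : ∀ t : T, fderiv ℝ Ψ (0, u₀) (ι t, 0) = L (t, 0) := hi
  -- `(t, s) ↦ Ψ (ι t, u₀ + L (0, s))` has the derivative `L` at the origin
  let J : T × S →L[ℝ] T' × E := (ι.comp (ContinuousLinearMap.fst ℝ T S)).prod
    ((L.toContinuousLinearMap.comp (ContinuousLinearMap.inr ℝ T S)).comp
      (ContinuousLinearMap.snd ℝ T S))
  let j : T × S → T' × E := fun p => (0, u₀) + J p
  have hj : ContDiff ℝ ∞ j := contDiff_const.add J.contDiff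
  have hj1 : ∀ p, j p = (ι p.1, u₀ + L (0, p.2)) := fun p => by simp [j, J]
  have hj0 : j 0 = (0, u₀) := by simp [j]
  have hjd : ∀ p, HasFDerivAt j J p := fun p => J.hasFDerivAt.const_add _
  have hjt : Tendsto j (𝓝 0) (𝓝 (0, u₀)) := by
    rw [← hj0]; exact hj.continuous.continuousAt
  have hKd : ∀ {p}, ContDiffAt ℝ ∞ Ψ (j p) →
      HasFDerivAt (Ψ ∘ j) ((fderiv ℝ Ψ (j p)).comp J) p := fun {p} hp =>
    (hp.differentiableAt (by simp)).hasFDerivAt.comp p (hjd p)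
  have hKs : ∀ {p}, ContDiffAt ℝ ∞ Ψ (j p) → ContDiffAt ℝ ∞ (Ψ ∘ j) p := fun {p} hp =>
    hp.comp p hj.contDiffAt
  have hΨ0 := hΨ.self_of_nhds.1
  have hK0 : HasFDerivAt (Ψ ∘ j) (L : T × S →L[ℝ] E) 0 := by
    refine (hKd (p := 0) (by rw [hj0]; exact hΨ0)).congr_fderiv ?_
    rw [hj0]
    have hsl : fderiv ℝ Ψ (0, u₀) ∘L ContinuousLinearMap.inr ℝ T' E = ContinuousLinearMap.id ℝ E := by
      have h1 := (hΨ0.differentiableAt (by simp)).hasFDerivAt.comp u₀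
        (hasFDerivAt_prodMk_right (𝕜 := ℝ) (0 : T') u₀)
      have h2 : (Ψ ∘ fun u => ((0 : T'), u)) =ᶠ[𝓝 u₀] id := h0
      exact h1.unique ((hasFDerivAt_id u₀).congr_of_eventuallyEq h2)
    refine ContinuousLinearMap.ext fun p => ?_
    change fderiv ℝ Ψ (0, u₀) (ι p.1, L (0, p.2)) = L p
    have e1 : ((ι p.1, L (0, p.2)) : T' × E) = (ι p.1, 0) + (0, L (0, p.2)) := by simp
    rw [e1, map_add, hι]
    have e2 : fderiv ℝ Ψ (0, u₀) (0, L (0, p.2)) = L (0, p.2) :=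
      congrArg (fun l : E →L[ℝ] E => l (L (0, p.2))) hsl
    rw [e2, ← map_add]
    simp
  have hKs0 : ContDiffAt ℝ ∞ (Ψ ∘ j) 0 := hKs (by rw [hj0]; exact hΨ0)
  let Φ := hKs0.toOpenPartialHomeomorph (Ψ ∘ j) hK0 (by simp)
  have hΦ : ∀ p, Φ p = Ψ (j p) := fun _ => rfl
  have h0Φ : (0 : T × S) ∈ Φ.source := hKs0.mem_toOpenPartialHomeomorph_source hK0 (by simp)
  -- the properties of `Ψ` hold on a ball
  have hinv : ∀ᶠ p in 𝓝 (0 : T × S), fderiv ℝ (Ψ ∘ j) p ∈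
      range (ContinuousLinearEquiv.toContinuousLinearMap : ((T × S) ≃L[ℝ] E) → _) := by
    refine (hKs0.fderiv_right (m := 0) (by simp)).continuousAt.eventually ?_
    rw [hK0.fderiv]
    exact ContinuousLinearEquiv.nhds L
  have hgood : ∀ᶠ p in 𝓝 (0 : T × S), p ∈ Φ.source ∧ fderiv ℝ (Ψ ∘ j) p ∈
      range (ContinuousLinearEquiv.toContinuousLinearMap : ((T × S) ≃L[ℝ] E) → _) ∧
      (ContDiffAt ℝ ∞ Ψ (j p) ∧ Ψ (j p) ∈ (chartAt E z).target ∧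
        PolarRel P A ((chartAt E z).symm (j p).2) ((chartAt E z).symm (Ψ (j p))) ∧
        ∀ τ : T', fderiv ℝ Ψ (j p) (τ, 0) ∈
          chartDistribution (polarDistribution P A) z (Ψ (j p))) ∧
      Ψ (0, (j p).2) = (j p).2 := by
    have h2 : Tendsto (fun p => (j p).2) (𝓝 0) (𝓝 u₀) := (continuous_snd.tendsto _).comp hjt
    have h3 : ∀ᶠ p in 𝓝 (0 : T × S), p ∈ Φ.source := Φ.open_source.mem_nhds h0Φ
    exact h3.and
      (hinv.and ((hjt.eventually hΨ).and (h2.eventually h0)))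
  obtain ⟨r, hr0, hball⟩ := Metric.eventually_nhds_iff_ball.1 hgood
  let Λ := (Φ.restrOpen (Metric.ball 0 r) Metric.isOpen_ball).trans (chartAt E z).symm
  have hΛ : ∀ p, Λ p = (chartAt E z).symm (Ψ (j p)) := fun _ => rfl
  have hsrc : Λ.source = Metric.ball 0 r := by
    ext p
    constructor
    · intro hp
      exact hp.1.2
    · intro hp
      exact ⟨⟨(hball p hp).1, hp⟩, (hball p hp).2.2.1.2.1⟩
  have hmf : ∀ p ∈ Metric.ball (0 : T × S) r, mfderiv 𝓘(ℝ, T × S) 𝓘(ℝ, E) Λ p =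
      (mfderiv 𝓘(ℝ, E) 𝓘(ℝ, E) (chartAt E z).symm (Ψ (j p)) : E →L[ℝ] E).comp
        ((fderiv ℝ Ψ (j p)).comp J) := by
    intro p hp
    obtain ⟨-, -, ⟨h3, h4, -, -⟩, -⟩ := hball p hp
    have h5 := ((contMDiffAt_chart_symm h4).mdifferentiableAt (by simp)).hasMFDerivAt.comp p
      (hKd h3).hasMFDerivAt
    exact h5.mfderiv
  refine ⟨Λ, ⟨⟨r, hr0, hsrc⟩, fun p hp => ?_, fun x hx => ?_, fun p hp => ?_, fun p hp τ => ?_⟩, ?_⟩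
  · rw [hsrc] at hp
    obtain ⟨-, -, ⟨h3, h4, -, -⟩, -⟩ := hball p hp
    exact ContMDiffAt.comp (g := (chartAt E z).symm) (f := Ψ ∘ j) (I' := 𝓘(ℝ, E)) p
      (contMDiffAt_chart_symm h4) (hKs h3).contMDiffAt
  · have hp := Λ.map_target hx
    rw [hsrc] at hp
    obtain ⟨h1, ⟨L', hL'⟩, ⟨h3, h4, -, -⟩, -⟩ := hball _ hp
    obtain ⟨hx1, hx2⟩ := hx
    have hx3 : x ∈ (chartAt E z).source := hx1
    have h5 : Φ.symm (chartAt E z x) ∈ Metric.ball 0 r := hp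
    have h6 : ContDiffAt ℝ ∞ Φ.symm (chartAt E z x) := by
      refine Φ.contDiffAt_symm (f₀' := L') hx2.1 ?_ (hKs h3)
      rw [hL']
      exact (hKd h3).differentiableAt.hasFDerivAt
    exact h6.contMDiffAt.comp x (contMDiffAt_chart hx3)
  · rw [hsrc] at hp
    have hp0 : ((0 : T), p.2) ∈ Metric.ball (0 : T × S) r := by
      rw [mem_ball_zero_iff, Prod.norm_def] at hp ⊢
      simp only [norm_zero, sup_lt_iff] at hp ⊢
      exact ⟨hr0, hp.2⟩
    have h1 := (hball _ hp).2.2.1.2.2.1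
    have h2 := (hball _ hp0).2.2.2
    have h3 : j (0, p.2) = (0, (j p).2) := by simp [hj1]
    rw [h3] at h2
    rw [hΛ, hΛ, h3, h2]
    exact h1
  · rw [hsrc] at hp
    have h1 := (hball p hp).2.2.1.2.2.2 (ι τ)
    rw [hmf p hp]
    have h2 : J (τ, 0) = (ι τ, 0) := by simp [J]
    change (mfderiv 𝓘(ℝ, E) 𝓘(ℝ, E) (chartAt E z).symm (Ψ (j p)) (fderiv ℝ Ψ (j p) (J (τ, 0))) : E) ∈
      (polarDistribution P A (Λ p) : Submodule ℝ E)
    rw [h2]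
    exact h1
  · rw [hΛ, hj0, h0.self_of_nhds, hu₀, (chartAt E z).left_inv (mem_chart_source E z)]

end FoliatedParametrizations

/-! ### Maps tangent to the polar distribution -/

section Transversal

variable {E : Type*} [NormedAddCommGroup E] [NormedSpace ℝ E] [FiniteDimensional ℝ E]
  {M : Type*} [TopologicalSpace M] [T2Space M] [ChartedSpace E M] [IsManifold 𝓘(ℝ, E) ∞ M]
  {P : PoissonStructure E M} {A : Subgroup (Equiv.Perm M)}
  {T S : Type*} [NormedAddCommGroup T] [NormedSpace ℝ T] [NormedAddCommGroup S] [NormedSpace ℝ S]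
  {F : Type*} [NormedAddCommGroup F] [NormedSpace ℝ F] {N : Type*} [TopologicalSpace N]
  [ChartedSpace F N] [IsManifold 𝓘(ℝ, F) ∞ N]

/-- A function on a manifold whose derivative vanishes near a point is constant near this point. -/
lemma eventually_eq_of_mfderiv_eq_zero {h : N → S} {p₀ : N} (hh : ∀ᶠ p in 𝓝 p₀,
    MDifferentiableAt 𝓘(ℝ, F) 𝓘(ℝ, S) h p ∧ mfderiv 𝓘(ℝ, F) 𝓘(ℝ, S) h p = 0) :
    ∀ᶠ p in 𝓝 p₀, h p = h p₀ := by
  set φ := chartAt F p₀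
  have hp₀ : p₀ ∈ φ.source := mem_chart_source F p₀
  have h1 : ∀ᶠ u in 𝓝 (φ p₀), u ∈ φ.target ∧
      MDifferentiableAt 𝓘(ℝ, F) 𝓘(ℝ, S) h (φ.symm u) ∧
        mfderiv 𝓘(ℝ, F) 𝓘(ℝ, S) h (φ.symm u) = 0 := by
    have h2 : Tendsto φ.symm (𝓝 (φ p₀)) (𝓝 p₀) := by
      have := φ.continuousAt_symm (φ.map_source hp₀)
      rwa [ContinuousAt, φ.left_inv hp₀] at this
    have h3 : ∀ᶠ u in 𝓝 (φ p₀), u ∈ φ.target := φ.open_target.mem_nhds (φ.map_source hp₀)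
    exact h3.and (h2.eventually hh)
  obtain ⟨r, hr, hball⟩ := Metric.eventually_nhds_iff_ball.1 h1
  have hd : ∀ u ∈ Metric.ball (φ p₀) r, HasFDerivAt (h ∘ φ.symm) (0 : F →L[ℝ] S) u := by
    intro u hu
    obtain ⟨h2, h3, h4⟩ := hball u hu
    have h5 := h3.hasMFDerivAt.comp u (((contMDiffOn_chart_symm (I := 𝓘(ℝ, F)) (n := ∞)).contMDiffAt
      (φ.open_target.mem_nhds h2)).mdifferentiableAt (by simp)).hasMFDerivAt
    rw [h4] at h5
    have h6 := h5.hasFDerivAt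
    refine h6.congr_fderiv ?_
    ext
    rfl
  have hc : ∀ u ∈ Metric.ball (φ p₀) r, h (φ.symm u) = h p₀ := by
    intro u hu
    have := Metric.isOpen_ball.is_const_of_fderiv_eq_zero (𝕜 := ℝ)
      (convex_ball (φ p₀) r).isPreconnected
      (fun u hu => (hd u hu).differentiableAt.differentiableWithinAt)
      (fun u hu => (hd u hu).fderiv) hu (Metric.mem_ball_self hr)
    simpa [φ.left_inv hp₀] using this
  have hφ : ∀ᶠ p in 𝓝 p₀, φ p ∈ Metric.ball (φ p₀) r :=
    (φ.continuousAt hp₀).eventually (Metric.ball_mem_nhds _ hr)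
  have hsrc : ∀ᶠ p in 𝓝 p₀, p ∈ φ.source := φ.open_source.mem_nhds hp₀
  filter_upwards [hφ, hsrc] with p h2 h3
  rw [← hc _ h2, φ.left_inv h3]

namespace IsFoliatedParam

variable {Λ : OpenPartialHomeomorph (T × S) M}

lemma mfderiv_symm_mfderiv (hΛ : IsFoliatedParam P A Λ) {p : T × S} (hp : p ∈ Λ.source)
    (w : T × S) : mfderiv 𝓘(ℝ, E) 𝓘(ℝ, T × S) Λ.symm (Λ p)
      (mfderiv 𝓘(ℝ, T × S) 𝓘(ℝ, E) Λ p w) = w := by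
  have h1 := mfderiv_comp (I' := 𝓘(ℝ, E)) p
    ((hΛ.smooth_symm _ (Λ.map_source hp)).mdifferentiableAt (by simp))
    ((hΛ.smooth p hp).mdifferentiableAt (by simp))
  have h2 : Λ.symm ∘ Λ =ᶠ[𝓝 p] id := by
    filter_upwards [Λ.open_source.mem_nhds hp] with q hq using Λ.left_inv hq
  rw [h2.mfderiv_eq, mfderiv_id] at h1
  exact (congrArg (fun L : (T × S) →L[ℝ] (T × S) => L w) h1).symm

/-- Where the distribution has the dimension of the plaques, it is tangent to the plaques. -/
lemma exists_mfderiv_eq [FiniteDimensional ℝ T] (hΛ : IsFoliatedParam P A Λ) {p : T × S}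
    (hp : p ∈ Λ.source)
    (hd : Module.finrank ℝ (polarDistribution P A (Λ p)) = Module.finrank ℝ T)
    {v : TangentSpace 𝓘(ℝ, E) (Λ p)} (hv : v ∈ polarDistribution P A (Λ p)) :
    ∃ τ : T, mfderiv 𝓘(ℝ, T × S) 𝓘(ℝ, E) Λ p ((τ, 0) : T × S) = v := by
  let L : (T × S) →L[ℝ] E := mfderiv 𝓘(ℝ, T × S) 𝓘(ℝ, E) Λ p
  let a : T →ₗ[ℝ] E := (L.comp (ContinuousLinearMap.inl ℝ T S)).toLinearMap
  let D : Submodule ℝ E := polarDistribution P A (Λ p)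
  have ha : Function.Injective a := by
    intro τ τ' h
    have h1 := hΛ.mfderiv_symm_mfderiv hp (τ, 0)
    have h2 := hΛ.mfderiv_symm_mfderiv hp (τ', 0)
    have h3 : L (τ, 0) = L (τ', 0) := h
    have h4 := h1.symm.trans ((congrArg (fun w : E =>
      (mfderiv 𝓘(ℝ, E) 𝓘(ℝ, T × S) Λ.symm (Λ p) : E →L[ℝ] (T × S)) w) h3).trans h2)
    exact (Prod.ext_iff.1 h4).1
  have hle : LinearMap.range a ≤ D := by
    rintro _ ⟨τ, rfl⟩
    exact hΛ.tangent p hp τ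
  have heq : LinearMap.range a = D := by
    refine Submodule.eq_of_le_of_finrank_eq hle ?_
    rw [LinearMap.finrank_range_of_inj ha]
    exact hd.symm
  have hvD : v ∈ D := hv
  rw [← heq] at hvD
  exact hvD

/-- A map that is tangent to the distribution, in a region where the distribution has the dimension
of the plaques, stays locally in one plaque. -/
lemma eventually_snd_eq [FiniteDimensional ℝ T] (hΛ : IsFoliatedParam P A Λ) {c : N → M} {p₀ : N}
    (hp₀ : c p₀ ∈ Λ.target) (hc : ∀ᶠ p in 𝓝 p₀, MDifferentiableAt 𝓘(ℝ, F) 𝓘(ℝ, E) c p ∧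
      (∀ v, mfderiv 𝓘(ℝ, F) 𝓘(ℝ, E) c p v ∈ polarDistribution P A (c p)) ∧
      Module.finrank ℝ (polarDistribution P A (c p)) = Module.finrank ℝ T) :
    ∀ᶠ p in 𝓝 p₀, c p ∈ Λ.target ∧ (Λ.symm (c p)).2 = (Λ.symm (c p₀)).2 := by
  have hcont : ∀ᶠ p in 𝓝 p₀, c p ∈ Λ.target :=
    hc.self_of_nhds.1.continuousAt.eventually (Λ.open_target.mem_nhds hp₀)
  refine hcont.and (eventually_eq_of_mfderiv_eq_zero (F := F)
    (h := fun p => (Λ.symm (c p)).2) ?_)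
  filter_upwards [hc, hcont] with p ⟨h1, h2, h3⟩ h4
  have h5 := ((hΛ.smooth_symm _ h4).mdifferentiableAt (by simp)).hasMFDerivAt.comp p h1.hasMFDerivAt
  have h6 : HasMFDerivAt 𝓘(ℝ, T × S) 𝓘(ℝ, S) (Prod.snd : T × S → S) (Λ.symm (c p))
      (ContinuousLinearMap.snd ℝ T S) := hasFDerivAt_snd.hasMFDerivAt
  have h7 := h6.comp p h5
  refine ⟨h7.mdifferentiableAt, h7.mfderiv.trans ?_⟩
  refine ContinuousLinearMap.ext fun v => ?_
  -- vectors of the distribution have no transversal component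
  have hgen : ∀ (x : M) (hx : x ∈ Λ.target)
      (hd : Module.finrank ℝ (polarDistribution P A x) = Module.finrank ℝ T)
      (w : TangentSpace 𝓘(ℝ, E) x) (hw : w ∈ polarDistribution P A x),
      ((mfderiv 𝓘(ℝ, E) 𝓘(ℝ, T × S) Λ.symm x w : T × S)).2 = 0 := by
    intro x hx hd w hw
    obtain ⟨q, hq, rfl⟩ : ∃ q ∈ Λ.source, Λ q = x := ⟨_, Λ.map_target hx, Λ.right_inv hx⟩
    obtain ⟨τ, rfl⟩ := hΛ.exists_mfderiv_eq hq hd hw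
    exact congrArg Prod.snd (hΛ.mfderiv_symm_mfderiv hq (τ, 0))
  exact hgen (c p) h4 h3 _ (h2 v)

lemma zero_mem (hΛ : IsFoliatedParam P A Λ) : (0 : T × S) ∈ Λ.source := by
  obtain ⟨r, hr, h⟩ := hΛ.source_eq
  rw [h]
  exact Metric.mem_ball_self hr

lemma hasMFDerivAt_plaque (hΛ : IsFoliatedParam P A Λ) {t : T} (ht : (t, (0 : S)) ∈ Λ.source) :
    HasMFDerivAt 𝓘(ℝ, T) 𝓘(ℝ, E) (fun t => Λ (t, (0 : S))) t
      ((mfderiv 𝓘(ℝ, T × S) 𝓘(ℝ, E) Λ (t, 0) : (T × S) →L[ℝ] E).comp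
        (ContinuousLinearMap.inl ℝ T S)) := by
  have h1 : HasMFDerivAt 𝓘(ℝ, T) 𝓘(ℝ, T × S) (fun t : T => (t, (0 : S))) t
      (ContinuousLinearMap.inl ℝ T S) := (hasFDerivAt_prodMk_left t (0 : S)).hasMFDerivAt
  exact ((hΛ.smooth _ ht).mdifferentiableAt (by simp)).hasMFDerivAt.comp t h1

lemma contMDiffAt_plaque (hΛ : IsFoliatedParam P A Λ) {t : T} (ht : (t, (0 : S)) ∈ Λ.source) :
    ContMDiffAt 𝓘(ℝ, T) 𝓘(ℝ, E) ∞ (fun t => Λ (t, (0 : S))) t := by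
  have h1 : ContMDiffAt 𝓘(ℝ, T) 𝓘(ℝ, T × S) ∞ (fun t : T => (t, (0 : S))) t :=
    (contDiffAt_id.prodMk contDiffAt_const).contMDiffAt
  exact ContMDiffAt.comp (g := Λ) t (hΛ.smooth _ ht) h1

lemma rel_plaque (hΛ : IsFoliatedParam P A Λ) {t : T} (ht : (t, (0 : S)) ∈ Λ.source) :
    PolarRel P A (Λ 0) (Λ (t, 0)) := hΛ.rel _ ht

/-- Plaques satisfy the hypotheses of `eventually_snd_eq`. -/
lemma plaque_tangent (hA : ∀ φ ∈ A, IsPoissonAut P φ) (hΛ : IsFoliatedParam P A Λ) {t : T}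
    (ht : (t, (0 : S)) ∈ Λ.source) :
    ∀ᶠ t' in 𝓝 t, MDifferentiableAt 𝓘(ℝ, T) 𝓘(ℝ, E) (fun t => Λ (t, (0 : S))) t' ∧
      (∀ v, mfderiv 𝓘(ℝ, T) 𝓘(ℝ, E) (fun t => Λ (t, (0 : S))) t' v ∈
        polarDistribution P A (Λ (t', (0 : S)))) ∧
      Module.finrank ℝ (polarDistribution P A (Λ (t', (0 : S)))) =
        Module.finrank ℝ (polarDistribution P A (Λ 0)) := by
  have h1 : ∀ᶠ t' in 𝓝 t, (t', (0 : S)) ∈ Λ.source :=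
    (Continuous.prodMk_left (0 : S)).continuousAt.eventually (Λ.open_source.mem_nhds ht)
  filter_upwards [h1] with t' h2
  have h3 := hΛ.hasMFDerivAt_plaque h2
  refine ⟨h3.mdifferentiableAt, fun v => ?_, ((hΛ.rel_plaque h2).finrank_eq hA).symm⟩
  rw [h3.mfderiv]
  exact hΛ.tangent _ h2 v

end IsFoliatedParam

/-- A map that is tangent to the distribution, in a region where the distribution has constant
dimension, stays locally in one orbit of the pseudogroup. -/
lemma eventually_polarRel (hA : ∀ φ ∈ A, IsPoissonAut P φ) {c : N → M} {p₀ : N}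
    (hc : ∀ᶠ p in 𝓝 p₀, MDifferentiableAt 𝓘(ℝ, F) 𝓘(ℝ, E) c p ∧
      (∀ v, mfderiv 𝓘(ℝ, F) 𝓘(ℝ, E) c p v ∈ polarDistribution P A (c p)) ∧
      Module.finrank ℝ (polarDistribution P A (c p)) =
        Module.finrank ℝ (polarDistribution P A (c p₀))) :
    ∀ᶠ p in 𝓝 p₀, PolarRel P A (c p₀) (c p) := by
  obtain ⟨d, hd⟩ : ∃ d, Module.finrank ℝ (polarDistribution P A (c p₀)) = d := ⟨_, rfl⟩
  obtain ⟨Λ, hΛ, h0⟩ := exists_foliatedParam hA (c p₀) hd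
  have h1 : c p₀ ∈ Λ.target := by rw [← h0]; exact Λ.map_source hΛ.zero_mem
  have h2 : Λ.symm (c p₀) = 0 := by rw [← h0]; exact Λ.left_inv hΛ.zero_mem
  have h3 := hΛ.eventually_snd_eq h1 (hc.mono fun p hp => ⟨hp.1, hp.2.1, by simpa [hd] using hp.2.2⟩)
  filter_upwards [h3] with p ⟨h4, h5⟩
  have h6 := hΛ.rel _ (Λ.map_target h4)
  rw [h5, h2, Λ.right_inv h4] at h6
  rw [← h0]
  exact h6

end Transversal

/-! ### The orbits of the pseudogroup are the leaves -/

section Orbits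

universe u

variable {E : Type*} [NormedAddCommGroup E] [NormedSpace ℝ E] [FiniteDimensional ℝ E]
  {M : Type u} [TopologicalSpace M] [T2Space M] [ChartedSpace E M] [IsManifold 𝓘(ℝ, E) ∞ M]
  {P : PoissonStructure E M} {A : Subgroup (Equiv.Perm M)}

/-- The orbit of `z` under the polar pseudogroup. It is a type of its own, and not a subtype of
`M`, since its manifold topology is finer than the subspace topology; the assumption on `A` is a
parameter because the manifold structure depends on it. -/
structure PolarOrbit (hA : ∀ φ ∈ A, IsPoissonAut P φ) (z : M) : Type u where
  pt : M
  rel : PolarRel P A z pt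

variable {hA : ∀ φ ∈ A, IsPoissonAut P φ} {z : M}

lemma PolarOrbit.ext {x y : PolarOrbit hA z} (h : x.pt = y.pt) : x = y := by
  cases x
  cases y
  congr

/-- The dimension of the orbit. -/
abbrev orbitDim (P : PoissonStructure E M) (A : Subgroup (Equiv.Perm M)) (z : M) : ℕ :=
  Module.finrank ℝ (polarDistribution P A z)

/-- The model space of the orbit. -/
abbrev OrbitModel (P : PoissonStructure E M) (A : Subgroup (Equiv.Perm M)) (z : M) : Type :=
  EuclideanSpace ℝ (Fin (orbitDim P A z))

/-- The space of transversal coordinates. -/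
abbrev OrbitNormal (P : PoissonStructure E M) (A : Subgroup (Equiv.Perm M)) (z : M) : Type :=
  EuclideanSpace ℝ (Fin (Module.finrank ℝ E - orbitDim P A z))

namespace PolarOrbit

/-- A foliated parametrization centred at a point of the orbit. -/
def param (w : PolarOrbit hA z) :
    OpenPartialHomeomorph (OrbitModel P A z × OrbitNormal P A z) M :=
  (exists_foliatedParam hA w.pt (w.rel.finrank_eq hA).symm).choose

lemma isFoliatedParam (w : PolarOrbit hA z) : IsFoliatedParam P A w.param :=
  (exists_foliatedParam hA w.pt (w.rel.finrank_eq hA).symm).choose_spec.1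

lemma param_zero (w : PolarOrbit hA z) : w.param 0 = w.pt :=
  (exists_foliatedParam hA w.pt (w.rel.finrank_eq hA).symm).choose_spec.2

lemma param_rel (w : PolarOrbit hA z) {t : OrbitModel P A z}
    (ht : (t, (0 : OrbitNormal P A z)) ∈ w.param.source) : PolarRel P A z (w.param (t, 0)) := by
  have h := w.isFoliatedParam.rel_plaque ht
  rw [w.param_zero] at h
  exact w.rel.trans h

open Classical in
/-- The coordinates along the plaque through a point of the orbit. -/
def plaque (w : PolarOrbit hA z) : PartialEquiv (PolarOrbit hA z) (OrbitModel P A z) where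
  toFun y := (w.param.symm y.pt).1
  invFun t := if h : (t, (0 : OrbitNormal P A z)) ∈ w.param.source then ⟨_, w.param_rel h⟩ else w
  source := {y | y.pt ∈ w.param.target ∧ (w.param.symm y.pt).2 = 0}
  target := {t | (t, 0) ∈ w.param.source}
  map_source' y hy := by
    have h : ((w.param.symm y.pt).1, (0 : OrbitNormal P A z)) = w.param.symm y.pt :=
      Prod.ext rfl hy.2.symm
    change _ ∈ w.param.source
    rw [h]
    exact w.param.map_target hy.1
  map_target' t ht := by
    rw [dif_pos (show (t, (0 : OrbitNormal P A z)) ∈ w.param.source from ht)]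
    refine ⟨w.param.map_source ht, ?_⟩
    change (w.param.symm (w.param (t, 0))).2 = 0
    rw [w.param.left_inv ht]
  left_inv' y hy := by
    have h : ((w.param.symm y.pt).1, (0 : OrbitNormal P A z)) = w.param.symm y.pt :=
      Prod.ext rfl hy.2.symm
    have h' : ((w.param.symm y.pt).1, (0 : OrbitNormal P A z)) ∈ w.param.source := by
      rw [h]
      exact w.param.map_target hy.1
    rw [dif_pos h']
    refine PolarOrbit.ext ?_
    change w.param _ = y.pt
    rw [h, w.param.right_inv hy.1]
  right_inv' t ht := by
    rw [dif_pos (show (t, (0 : OrbitNormal P A z)) ∈ w.param.source from ht)]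
    change (w.param.symm (w.param (t, 0))).1 = t
    rw [w.param.left_inv ht]

lemma mem_plaque_source {w y : PolarOrbit hA z} :
    y ∈ w.plaque.source ↔ y.pt ∈ w.param.target ∧ (w.param.symm y.pt).2 = 0 := Iff.rfl

lemma plaque_symm_pt {w : PolarOrbit hA z} {t : OrbitModel P A z} (ht : t ∈ w.plaque.target) :
    (w.plaque.symm t).pt = w.param (t, 0) := by
  have h : w.plaque.symm t = ⟨_, w.param_rel ht⟩ := dif_pos ht
  rw [h]

lemma param_plaque {w y : PolarOrbit hA z} (hy : y ∈ w.plaque.source) :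
    w.param (w.plaque y, 0) = y.pt := by
  rw [← plaque_symm_pt (w.plaque.map_source hy), w.plaque.left_inv hy]

/-- Along a plaque, the transversal coordinate with respect to another parametrization is locally
constant. -/
lemma eventually_plaque {w w' : PolarOrbit hA z} {t : OrbitModel P A z}
    (ht : t ∈ w.plaque.target) (ht' : w.plaque.symm t ∈ w'.plaque.source) :
    ∀ᶠ t' in 𝓝 t, t' ∈ w.plaque.target ∧ w.plaque.symm t' ∈ w'.plaque.source := by
  have h1 : ∀ᶠ t' in 𝓝 t, t' ∈ w.plaque.target :=
    (Continuous.prodMk_left (0 : OrbitNormal P A z)).continuousAt.eventually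
      (w.param.open_source.mem_nhds ht)
  rw [mem_plaque_source, plaque_symm_pt ht] at ht'
  have h2 := w'.isFoliatedParam.eventually_snd_eq (p₀ := t) (N := OrbitModel P A z)
    (c := fun t => w.param (t, 0)) ht'.1
    ((w.isFoliatedParam.plaque_tangent hA ht).mono fun p hp => ⟨hp.1, hp.2.1, by
      rw [hp.2.2, w.param_zero, ← w.rel.finrank_eq hA]
      simp⟩)
  filter_upwards [h1, h2] with t' h3 h4
  refine ⟨h3, ?_⟩
  rw [mem_plaque_source, plaque_symm_pt h3]
  exact ⟨h4.1, h4.2.trans ht'.2⟩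

lemma contDiffAt_plaque_change {w w' : PolarOrbit hA z} {t : OrbitModel P A z}
    (ht : t ∈ w.plaque.target) (ht' : w.plaque.symm t ∈ w'.plaque.source) :
    ContDiffAt ℝ ∞ (w'.plaque ∘ w.plaque.symm) t := by
  rw [mem_plaque_source, plaque_symm_pt ht] at ht'
  have h1 := (w'.isFoliatedParam.smooth_symm _ ht'.1).comp t
    (w.isFoliatedParam.contMDiffAt_plaque ht)
  rw [contMDiffAt_iff_contDiffAt] at h1
  refine h1.fst.congr_of_eventuallyEq ?_
  have h2 : ∀ᶠ t' in 𝓝 t, t' ∈ w.plaque.target :=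
    (Continuous.prodMk_left (0 : OrbitNormal P A z)).continuousAt.eventually
      (w.param.open_source.mem_nhds ht)
  filter_upwards [h2] with t' h3
  change (w'.param.symm (w.plaque.symm t').pt).1 = _
  rw [plaque_symm_pt h3]
  rfl

/-- The atlas of plaques. -/
def core (hA : ∀ φ ∈ A, IsPoissonAut P φ) (z : M) :
    ChartedSpaceCore (OrbitModel P A z) (PolarOrbit hA z) where
  atlas := range plaque
  chartAt := plaque
  mem_chart_source w := by
    rw [mem_plaque_source, ← w.param_zero, w.param.left_inv w.isFoliatedParam.zero_mem]
    exact ⟨w.param.map_source w.isFoliatedParam.zero_mem, rfl⟩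
  chart_mem_atlas w := ⟨w, rfl⟩
  open_source := by
    rintro _ _ ⟨w, rfl⟩ ⟨w', rfl⟩
    rw [isOpen_iff_mem_nhds]
    exact fun t ht => eventually_plaque ht.1 ht.2
  continuousOn_toFun := by
    rintro _ _ ⟨w, rfl⟩ ⟨w', rfl⟩
    exact fun t ht => (contDiffAt_plaque_change ht.1 ht.2).continuousAt.continuousWithinAt

instance : TopologicalSpace (PolarOrbit hA z) := (core hA z).toTopologicalSpace

instance : ChartedSpace (OrbitModel P A z) (PolarOrbit hA z) := (core hA z).toChartedSpace

instance : IsManifold (𝓡 (orbitDim P A z)) ∞ (PolarOrbit hA z) := by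
  refine isManifold_of_contDiffOn _ _ _ fun e e' he he' => ?_
  obtain ⟨_, ⟨_, rfl⟩, ⟨_, ⟨⟨w, rfl⟩, rfl⟩, h⟩⟩ := he
  obtain ⟨_, ⟨_, rfl⟩, ⟨_, ⟨⟨w', rfl⟩, rfl⟩, h'⟩⟩ := he'
  obtain rfl := h
  obtain rfl := h'
  intro t ht
  exact (contDiffAt_plaque_change ht.1.1 ht.1.2).contDiffWithinAt

lemma mem_plaque_self (w : PolarOrbit hA z) : w ∈ w.plaque.source := (core hA z).mem_chart_source w

lemma eventually_pt_eq (w : PolarOrbit hA z) :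
    ∀ᶠ y in 𝓝 w, y.pt = w.param (chartAt (OrbitModel P A z) w y, 0) := by
  filter_upwards [(chartAt (OrbitModel P A z) w).open_source.mem_nhds (mem_chart_source _ w)]
    with y hy using (param_plaque hy).symm

lemma contMDiff_pt : ContMDiff (𝓡 (orbitDim P A z)) 𝓘(ℝ, E) ∞ (PolarOrbit.pt (hA := hA) (z := z)) := by
  intro w
  have h0 : (w.plaque w, (0 : OrbitNormal P A z)) ∈ w.param.source :=
    w.plaque.map_source w.mem_plaque_self
  have h1 := (w.isFoliatedParam.contMDiffAt_plaque h0).comp w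
    ((contMDiffOn_chart (I := 𝓡 (orbitDim P A z)) (x := w)).contMDiffAt
      ((chartAt (OrbitModel P A z) w).open_source.mem_nhds (mem_chart_source _ w)))
  exact h1.congr_of_eventuallyEq w.eventually_pt_eq

/-- The inclusion of the orbit is differentiated along the plaque through the point. -/
lemma mfderiv_pt (w : PolarOrbit hA z) (v : OrbitModel P A z) :
    mfderiv (𝓡 (orbitDim P A z)) 𝓘(ℝ, E) PolarOrbit.pt w v =
      (mfderiv 𝓘(ℝ, OrbitModel P A z × OrbitNormal P A z) 𝓘(ℝ, E) w.param (w.plaque w, 0)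
        ((mfderiv (𝓡 (orbitDim P A z)) (𝓡 (orbitDim P A z)) (chartAt (OrbitModel P A z) w) w v, 0) :
          OrbitModel P A z × OrbitNormal P A z) : E) := by
  have h0 : (w.plaque w, (0 : OrbitNormal P A z)) ∈ w.param.source :=
    w.plaque.map_source w.mem_plaque_self
  have h1 : MDifferentiableAt (𝓡 (orbitDim P A z)) (𝓡 (orbitDim P A z))
      (chartAt (OrbitModel P A z) w) w :=
    ((contMDiffOn_chart (I := 𝓡 (orbitDim P A z)) (n := ∞) (x := w)).contMDiffAt
      ((chartAt (OrbitModel P A z) w).open_source.mem_nhds (mem_chart_source _ w))).mdifferentiableAt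
      (by simp)
  have h2 := HasMFDerivAt.comp w (w.isFoliatedParam.hasMFDerivAt_plaque h0) h1.hasMFDerivAt
  have h3 := h2.congr_of_eventuallyEq w.eventually_pt_eq
  exact congrArg (fun L : OrbitModel P A z →L[ℝ] E => L v) h3.mfderiv

lemma mfderiv_pt_mem (w : PolarOrbit hA z) (v : OrbitModel P A z) :
    mfderiv (𝓡 (orbitDim P A z)) 𝓘(ℝ, E) PolarOrbit.pt w v ∈ polarDistribution P A w.pt := by
  have h0 : (w.plaque w, (0 : OrbitNormal P A z)) ∈ w.param.source :=
    w.plaque.map_source w.mem_plaque_self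
  have h := w.isFoliatedParam.tangent _ h0
    (mfderiv (𝓡 (orbitDim P A z)) (𝓡 (orbitDim P A z)) (chartAt (OrbitModel P A z) w) w v)
  have hcast : ∀ {x y : M} (hx : x = y) {v v' : E} (hv : v' = v),
      v ∈ (polarDistribution P A x : Submodule ℝ E) →
        v' ∈ (polarDistribution P A y : Submodule ℝ E) := by
    rintro x _ rfl v _ rfl hv
    exact hv
  exact hcast (param_plaque w.mem_plaque_self) (w.mfderiv_pt v) h

lemma mfderiv_pt_injective (w : PolarOrbit hA z) :
    Function.Injective (mfderiv (𝓡 (orbitDim P A z)) 𝓘(ℝ, E) (PolarOrbit.pt (hA := hA)) w) := by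
  intro v v' h
  have h0 : (w.plaque w, (0 : OrbitNormal P A z)) ∈ w.param.source :=
    w.plaque.map_source w.mem_plaque_self
  have h1 := (w.mfderiv_pt v).symm.trans ((show _ = _ from h).trans (w.mfderiv_pt v'))
  have h2 := (w.isFoliatedParam.mfderiv_symm_mfderiv h0 _).symm.trans
    ((congrArg (fun x : E => (mfderiv 𝓘(ℝ, E) 𝓘(ℝ, OrbitModel P A z × OrbitNormal P A z)
      w.param.symm (w.param (w.plaque w, 0)) :
        E →L[ℝ] OrbitModel P A z × OrbitNormal P A z) x) h1).trans
      (w.isFoliatedParam.mfderiv_symm_mfderiv h0 _))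
  have h3 := (Prod.ext_iff.1 h2).1
  have h4 := (mdifferentiable_chart (I := 𝓡 (orbitDim P A z)) w).symm_comp_deriv
    (mem_chart_source _ w)
  have h5 : ∀ v : OrbitModel P A z, mfderiv (𝓡 (orbitDim P A z)) (𝓡 (orbitDim P A z))
      (chartAt (OrbitModel P A z) w).symm (chartAt (OrbitModel P A z) w w)
      (mfderiv (𝓡 (orbitDim P A z)) (𝓡 (orbitDim P A z)) (chartAt (OrbitModel P A z) w) w v) = v :=
    fun v => congrArg (fun L : OrbitModel P A z →L[ℝ] OrbitModel P A z => L v) h4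
  rw [← h5 v, ← h5 v']
  exact congrArg _ h3

/-- A map into the orbit is continuous if it is continuous into `M` and stays locally in one
plaque. -/
lemma continuousAt_of_plaque {Y : Type*} [TopologicalSpace Y] {c : Y → PolarOrbit hA z} {y₀ : Y}
    (hc : ContinuousAt (fun y => (c y).pt) y₀)
    (h : ∀ᶠ y in 𝓝 y₀, c y ∈ (c y₀).plaque.source) : ContinuousAt c y₀ := by
  refine ((chartAt (OrbitModel P A z) (c y₀)).continuousAt_iff_continuousAt_comp_left h).2 ?_
  have h1 : (c y₀).pt ∈ (c y₀).param.target := ((c y₀).mem_plaque_self).1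
  have h2 : ContinuousAt (fun y => (c y₀).param.symm (c y).pt) y₀ :=
    ContinuousAt.comp (f := fun y => (c y).pt) ((c y₀).param.continuousAt_symm h1) hc
  exact h2.fst

/-- Integral curves of the polar family are continuous for the topology of the orbit. -/
lemma mem_connectedComponent_of_flowsTo {X : LocalVectorField E M} (hX : X ∈ polarFamily P A)
    {t : ℝ} {w w' : PolarOrbit hA z} (h : FlowsTo X t w.pt w'.pt) :
    w' ∈ connectedComponent w := by
  classical
  obtain ⟨γ, a, b, h0, ht, hd, hγ, hγ0, hγt⟩ := h
  have hrel : ∀ s ∈ Ioo a b, PolarRel P A z (γ s) := by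
    intro s hs
    have h1 : FlowsTo X s w.pt (γ s) := ⟨γ, a, b, h0, hs, hd, hγ, hγ0, rfl⟩
    exact w.rel.trans (h1.polarRel hX)
  -- the integral curve as a curve in the orbit, with an irrelevant value outside of `(a, b)`
  let c : ℝ → PolarOrbit hA z := fun s => if h : s ∈ Ioo a b then ⟨γ s, hrel s h⟩ else w
  have hcpt : ∀ s ∈ Ioo a b, (c s).pt = γ s := fun s hs => by simp only [c, dif_pos hs]
  have hev : ∀ {s}, s ∈ Ioo a b → ∀ᶠ s' in 𝓝 s, s' ∈ Ioo a b := fun hs => isOpen_Ioo.mem_nhds hs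
  have hcc : ∀ s ∈ Ioo a b, ContinuousAt c s := by
    intro s hs
    have hder : ∀ s' ∈ Ioo a b, HasMFDerivAt 𝓘(ℝ, ℝ) 𝓘(ℝ, E) γ s'
        ((1 : ℝ →L[ℝ] ℝ).smulRight (X.vec (γ s'))) := fun s' hs' =>
      (hγ s' hs').hasMFDerivAt (isOpen_Ioo.mem_nhds hs')
    refine continuousAt_of_plaque ?_ ?_
    · refine (hder s hs).continuousAt.congr ?_
      filter_upwards [hev hs] with s' hs' using (hcpt s' hs').symm
    · have hsrc := (c s).mem_plaque_self
      have hpl := (c s).isFoliatedParam.eventually_snd_eq (N := ℝ) (c := γ) (p₀ := s)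
        (by rw [← hcpt s hs]; exact hsrc.1) (by
          filter_upwards [hev hs] with s' hs'
          refine ⟨(hder s' hs').mdifferentiableAt, fun v => ?_, ?_⟩
          · rw [(hder s' hs').mfderiv]
            exact Submodule.smul_mem _ _ (Submodule.subset_span ⟨X, hX, hd hs', rfl⟩)
          · rw [← (hrel s' hs').finrank_eq hA]
            simp)
      filter_upwards [hpl, hev hs] with s' hs' hs''
      rw [mem_plaque_source, hcpt s' hs'']
      refine ⟨hs'.1, hs'.2.trans ?_⟩
      rw [← hcpt s hs]
      exact hsrc.2
  have hsub : uIcc 0 t ⊆ Ioo a b := (convex_Ioo a b).ordConnected.uIcc_subset h0 ht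
  have hpre : IsPreconnected (c '' uIcc 0 t) :=
    isPreconnected_uIcc.image c fun s hs => (hcc s (hsub hs)).continuousWithinAt
  have hw : c 0 = w := PolarOrbit.ext ((hcpt 0 h0).trans hγ0)
  have hw' : c t = w' := PolarOrbit.ext ((hcpt t ht).trans hγt)
  exact hpre.subset_connectedComponent ⟨0, left_mem_uIcc, hw⟩ ⟨t, right_mem_uIcc, hw'⟩

instance : ConnectedSpace (PolarOrbit hA z) := by
  have key : ∀ F ∈ polarPseudogroup P A, ∀ w w' : PolarOrbit hA z, w'.pt ∈ F w.pt →
      w' ∈ connectedComponent w := by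
    intro F hF
    induction hF with
    | flow hX t =>
      intro w w' h
      exact mem_connectedComponent_of_flowsTo hX (mem_flow_iff.1 h)
    | @comp X hX t F hF ih =>
      intro w w' h
      obtain ⟨y, hy, hyw⟩ := mem_pfun_comp.1 h
      have h1 := ih w ⟨y, w.rel.trans ⟨F, hF, hy⟩⟩ hy
      rw [connectedComponent_eq h1]
      exact mem_connectedComponent_of_flowsTo hX (mem_flow_iff.1 hyw)
  refine connectedSpace_iff_connectedComponent.2 ⟨⟨z, polarRel_refl z⟩, eq_univ_of_forall fun w => ?_⟩
  obtain ⟨F, hF, h⟩ := w.rel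
  exact key F hF _ w h

/-- The orbit as an immersed submanifold. -/
def submanifold (hA : ∀ φ ∈ A, IsPoissonAut P φ) (z : M) : ImmersedSubmanifold E M where
  N := PolarOrbit hA z
  dim := orbitDim P A z
  incl := PolarOrbit.pt
  smooth := contMDiff_pt
  injective _ _ h := PolarOrbit.ext h
  immersion := mfderiv_pt_injective

lemma isIntegral_submanifold (hA : ∀ φ ∈ A, IsPoissonAut P φ) (z : M) :
    IsIntegralOfMaxDim (polarDistribution P A) (submanifold hA z) := by
  intro w
  let L : OrbitModel P A z →L[ℝ] E :=
    mfderiv (𝓡 (orbitDim P A z)) 𝓘(ℝ, E) (PolarOrbit.pt (hA := hA) (z := z)) w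
  let D : Submodule ℝ E := polarDistribution P A (PolarOrbit.pt (hA := hA) (z := z) w)
  have hle : LinearMap.range L.toLinearMap ≤ D := by
    rintro _ ⟨v, rfl⟩
    exact mfderiv_pt_mem w v
  have hdim : Module.finrank ℝ (LinearMap.range L.toLinearMap) = Module.finrank ℝ D :=
    (LinearMap.finrank_range_of_inj (f := L.toLinearMap)
      (show Function.Injective L from mfderiv_pt_injective (hA := hA) (z := z) w)).trans
      (finrank_euclideanSpace_fin.trans ((PolarOrbit.rel w).finrank_eq hA))
  have heq : LinearMap.range L.toLinearMap = D := Submodule.eq_of_le_of_finrank_eq hle hdim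
  exact heq

lemma range_submanifold (hA : ∀ φ ∈ A, IsPoissonAut P φ) (z : M) :
    range (submanifold hA z).incl = {y | PolarRel P A z y} := by
  ext y
  constructor
  · rintro ⟨w, rfl⟩
    exact w.rel
  · intro h
    exact ⟨⟨y, h⟩, rfl⟩

end PolarOrbit

/-- An integral submanifold of maximal dimension is contained in one orbit. -/
lemma IsIntegralOfMaxDim.polarRel (hA : ∀ φ ∈ A, IsPoissonAut P φ) {L : ImmersedSubmanifold E M}
    (hL : IsIntegralOfMaxDim (polarDistribution P A) L) (p q : L.N) :
    PolarRel P A (L.incl p) (L.incl q) := by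
  have hdim : ∀ p, Module.finrank ℝ (polarDistribution P A (L.incl p)) = L.dim := by
    intro p
    rw [← hL p]
    exact (LinearMap.finrank_range_of_inj (L.immersion p)).trans finrank_euclideanSpace_fin
  have hloc : ∀ p, ∀ᶠ q in 𝓝 p, PolarRel P A (L.incl p) (L.incl q) := fun p =>
    eventually_polarRel (F := EuclideanSpace ℝ (Fin L.dim)) hA (Eventually.of_forall fun q =>
      ⟨(L.smooth q).mdifferentiableAt (by simp), fun v => by rw [← hL q]; exact ⟨v, rfl⟩,
        (hdim q).trans (hdim p).symm⟩)
  have hclopen : IsClopen {q | PolarRel P A (L.incl p) (L.incl q)} := by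
    refine ⟨⟨?_⟩, ?_⟩
    · rw [isOpen_iff_mem_nhds]
      intro q hq
      filter_upwards [hloc q] with q' hq' h
      exact hq (PolarRel.trans h hq'.symm)
    · rw [isOpen_iff_mem_nhds]
      intro q hq
      filter_upwards [hloc q] with q' hq'
      exact PolarRel.trans hq hq'
  exact (hclopen.eq_univ ⟨p, polarRel_refl _⟩).ge (mem_univ q)

/-- Orbits are maximal, since a larger integral manifold would still lie in one orbit. -/
lemma isLeaf_submanifold (hA : ∀ φ ∈ A, IsPoissonAut P φ) (z : M) :
    IsLeaf (polarDistribution P A) (PolarOrbit.submanifold hA z) := by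
  refine ⟨PolarOrbit.isIntegral_submanifold hA z, fun L' hL' hsub => hsub.antisymm' ?_⟩
  rintro _ ⟨q, rfl⟩
  rw [PolarOrbit.range_submanifold] at hsub ⊢
  obtain ⟨p, hp⟩ := hsub (polarRel_refl z)
  have := hL'.polarRel hA p q
  rwa [hp] at this

lemma isIntegrable_polarDistribution (hA : ∀ φ ∈ A, IsPoissonAut P φ) :
    IsIntegrable (polarDistribution P A) := fun z =>
  ⟨_, isLeaf_submanifold hA z, by rw [PolarOrbit.range_submanifold]; exact polarRel_refl z⟩

/-- The leaves of the polar distribution are the orbits of the polar pseudogroup. -/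
lemma sameLeaf_iff (hA : ∀ φ ∈ A, IsPoissonAut P φ) {x y : M} :
    SameLeaf (polarDistribution P A) x y ↔ PolarRel P A x y := by
  constructor
  · rintro ⟨L, hL, ⟨p, rfl⟩, ⟨q, rfl⟩⟩
    exact hL.1.polarRel hA p q
  · intro h
    refine ⟨_, isLeaf_submanifold hA x, ?_, ?_⟩
    · rw [PolarOrbit.range_submanifold]
      exact polarRel_refl x
    · rw [PolarOrbit.range_submanifold]
      exact h

end Orbits

/-! ### Quotients by relations that are transported by Poisson maps -/

section PoissonQuotients

variable {E : Type*} [NormedAddCommGroup E] [NormedSpace ℝ E] [FiniteDimensional ℝ E]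
  {M : Type*} [TopologicalSpace M] [T2Space M] [ChartedSpace E M] [IsManifold 𝓘(ℝ, E) ∞ M]
  {P : PoissonStructure E M} {r : M → M → Prop}

/-- An equivalence relation that is transported by Poisson maps: related points can be exchanged by the
germ of a Poisson map that moves each point to a related one. -/
structure IsPoissonRelation (P : PoissonStructure E M) (r : M → M → Prop) : Prop where
  equivalence : Equivalence r
  exists_germ : ∀ {x y}, r x y → ∃ Θ : M → M, IsPoissonAt P Θ x ∧ Θ x = y ∧
    ∀ᶠ x' in 𝓝 x, r x' (Θ x')

lemma mk_eq_mk_iff (hr : Equivalence r) {x y : M} : Quot.mk r x = Quot.mk r y ↔ r x y :=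
  Quot.eq.trans hr.eqvGen_iff

lemma isOpen_preimage_mk {V : Set (Quot r)} (hV : IsOpen V) : IsOpen (Quot.mk r ⁻¹' V) :=
  hV.preimage continuous_quot_mk

lemma QuotSmoothOn.germSmooth {V : Set (Quot r)} (hV : IsOpen V) {f : Quot r → ℝ}
    (hf : QuotSmoothOn E r V f) {m : M} (hm : Quot.mk r m ∈ V) :
    GermSmooth E (f ∘ Quot.mk r) m :=
  germSmooth_of_smoothOn (isOpen_preimage_mk hV) hf.2 hm

lemma quotSmoothOn_of_germSmooth {V : Set (Quot r)} (hV : IsOpen V) {f : Quot r → ℝ}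
    (hf : ∀ m, Quot.mk r m ∈ V → GermSmooth E (f ∘ Quot.mk r) m) : QuotSmoothOn E r V f := by
  have h : SmoothOn E (Quot.mk r ⁻¹' V) (f ∘ Quot.mk r) :=
    (smoothOn_iff_germSmooth (isOpen_preimage_mk hV)).2 hf
  exact ⟨(isQuotientMap_quot_mk.continuousOn_isOpen_iff hV).2 h.continuousOn, h⟩

lemma IsPoissonRelation.quotBracket_mk (hr : IsPoissonRelation P r) {V : Set (Quot r)}
    (hV : IsOpen V) {f g : Quot r → ℝ} (hf : QuotSmoothOn E r V f) (hg : QuotSmoothOn E r V g)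
    {m : M} (hm : Quot.mk r m ∈ V) :
    quotBracket P r f g (Quot.mk r m) = localBracket P (f ∘ Quot.mk r) (g ∘ Quot.mk r) m := by
  have hrel : r m (Quot.mk r m).out := (mk_eq_mk_iff hr.equivalence).1 (Quot.out_eq _).symm
  obtain ⟨Θ, h1, h2, h3⟩ := hr.exists_germ hrel
  have hmk : ∀ f : Quot r → ℝ, (f ∘ Quot.mk r) ∘ Θ =ᶠ[𝓝 m] f ∘ Quot.mk r := by
    intro f
    filter_upwards [h3] with x' hx'
    exact congrArg f ((mk_eq_mk_iff hr.equivalence).2 hx').symm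
  have hm' : Quot.mk r (Θ m) ∈ V := by rwa [h2, Quot.out_eq]
  rw [quotBracket, ← h2, ← h1.2 _ _ (hf.germSmooth hV hm') (hg.germSmooth hV hm')]
  exact localBracket_congr P (hmk f) (hmk g)

lemma IsPoissonRelation.quotBracket_eventuallyEq (hr : IsPoissonRelation P r) {V : Set (Quot r)}
    (hV : IsOpen V) {f g : Quot r → ℝ} (hf : QuotSmoothOn E r V f) (hg : QuotSmoothOn E r V g)
    {m : M} (hm : Quot.mk r m ∈ V) :
    localBracket P (f ∘ Quot.mk r) (g ∘ Quot.mk r) =ᶠ[𝓝 m] quotBracket P r f g ∘ Quot.mk r := by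
  filter_upwards [(isOpen_preimage_mk hV).mem_nhds hm] with m' hm'
  exact (hr.quotBracket_mk hV hf hg hm').symm

/-- The open subsets of a quotient by a relation that is transported by Poisson maps are Poisson
varieties. -/
lemma IsPoissonRelation.isPoissonVariety (hr : IsPoissonRelation P r) {V : Set (Quot r)}
    (hV : IsOpen V) : IsPoissonVariety P r V := by
  have hsm : ∀ f g, QuotSmoothOn E r V f → QuotSmoothOn E r V g →
      QuotSmoothOn E r V (quotBracket P r f g) := fun f g hf hg =>
    quotSmoothOn_of_germSmooth hV fun m hm => ((hf.germSmooth hV hm).localBracket P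
      (hg.germSmooth hV hm)).congr (hr.quotBracket_eventuallyEq hV hf hg hm)
  have hof : ∀ {f}, (∀ m, Quot.mk r m ∈ V → GermSmooth E (f ∘ Quot.mk r) m) →
      QuotSmoothOn E r V f := fun h => quotSmoothOn_of_germSmooth hV h
  constructor
  · exact fun f g hf hg m hm => hr.quotBracket_mk hV hf hg hm
  · exact hsm
  · rintro f g h hf hg hh ⟨m⟩ hm
    have hfg : QuotSmoothOn E r V (f + g) := hof fun m hm =>
      (hf.germSmooth hV hm).add (hg.germSmooth hV hm)
    change quotBracket P r (f + g) h (Quot.mk r m) =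
      quotBracket P r f h (Quot.mk r m) + quotBracket P r g h (Quot.mk r m)
    rw [hr.quotBracket_mk hV hfg hh hm, hr.quotBracket_mk hV hf hh hm,
      hr.quotBracket_mk hV hg hh hm]
    exact localBracket_add_left P (hf.germSmooth hV hm) (hg.germSmooth hV hm) (hh.germSmooth hV hm)
  · rintro c f g hf hg ⟨m⟩ hm
    have hcf : QuotSmoothOn E r V (c • f) := hof fun m hm => (hf.germSmooth hV hm).smul c
    change quotBracket P r (c • f) g (Quot.mk r m) = c * quotBracket P r f g (Quot.mk r m)
    rw [hr.quotBracket_mk hV hcf hg hm, hr.quotBracket_mk hV hf hg hm]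
    exact localBracket_smul_left P c (hf.germSmooth hV hm) (hg.germSmooth hV hm)
  · rintro f g hf hg ⟨m⟩ hm
    change quotBracket P r f g (Quot.mk r m) = -quotBracket P r g f (Quot.mk r m)
    rw [hr.quotBracket_mk hV hf hg hm, hr.quotBracket_mk hV hg hf hm]
    exact localBracket_antisymm P (hf.germSmooth hV hm) (hg.germSmooth hV hm)
  · rintro f g h hf hg hh ⟨m⟩ hm
    have key : ∀ {a b c : Quot r → ℝ}, QuotSmoothOn E r V a → QuotSmoothOn E r V b →
        QuotSmoothOn E r V c → quotBracket P r a (quotBracket P r b c) (Quot.mk r m) =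
          localBracket P (a ∘ Quot.mk r)
            (localBracket P (b ∘ Quot.mk r) (c ∘ Quot.mk r)) m := fun ha hb hc => by
      rw [hr.quotBracket_mk hV ha (hsm _ _ hb hc) hm]
      exact localBracket_congr P EventuallyEq.rfl
        (hr.quotBracket_eventuallyEq hV hb hc hm).symm
    change quotBracket P r f (quotBracket P r g h) (Quot.mk r m) +
      quotBracket P r g (quotBracket P r h f) (Quot.mk r m) +
        quotBracket P r h (quotBracket P r f g) (Quot.mk r m) = 0
    rw [key hf hg hh, key hg hh hf, key hh hf hg]
    exact localBracket_jacobi P (hf.germSmooth hV hm) (hg.germSmooth hV hm) (hh.germSmooth hV hm)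
  · rintro f g h hf hg hh ⟨m⟩ hm
    have hfg : QuotSmoothOn E r V (f * g) := hof fun m hm =>
      (hf.germSmooth hV hm).mul (hg.germSmooth hV hm)
    change quotBracket P r (f * g) h (Quot.mk r m) =
      f (Quot.mk r m) * quotBracket P r g h (Quot.mk r m) +
        quotBracket P r f h (Quot.mk r m) * g (Quot.mk r m)
    rw [hr.quotBracket_mk hV hfg hh hm, hr.quotBracket_mk hV hf hh hm,
      hr.quotBracket_mk hV hg hh hm]
    exact localBracket_leibniz P (hf.germSmooth hV hm) (hg.germSmooth hV hm) (hh.germSmooth hV hm)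

/-- The homeomorphism between open subsets of the quotient that is induced by a homeomorphism
between saturated open subsets. -/
def inducedHomeomorph (hr : Equivalence r) (Φ : OpenPartialHomeomorph M M)
    (h : ∀ x y, r x y → x ∈ Φ.source → y ∈ Φ.source ∧ r (Φ x) (Φ y))
    (h' : ∀ x y, r x y → x ∈ Φ.target → y ∈ Φ.target ∧ r (Φ.symm x) (Φ.symm y)) :
    OpenPartialHomeomorph (Quot r) (Quot r) :=
  have hout : ∀ x, r x (Quot.mk r x).out := fun x => (mk_eq_mk_iff hr).1 (Quot.out_eq _).symm
  have hmk : ∀ x ∈ Φ.source, Quot.mk r (Φ (Quot.mk r x).out) = Quot.mk r (Φ x) := fun x hx =>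
    ((mk_eq_mk_iff hr).2 (h _ _ (hout x) hx).2).symm
  have hmk' : ∀ y ∈ Φ.target, Quot.mk r (Φ.symm (Quot.mk r y).out) = Quot.mk r (Φ.symm y) :=
    fun y hy => ((mk_eq_mk_iff hr).2 (h' _ _ (hout y) hy).2).symm
  have hs : Quot.mk r ⁻¹' (Quot.mk r '' Φ.source) = Φ.source := by
    refine Subset.antisymm ?_ (subset_preimage_image _ _)
    rintro x ⟨y, hy, hyx⟩
    exact (h _ _ ((mk_eq_mk_iff hr).1 hyx) hy).1
  have ht : Quot.mk r ⁻¹' (Quot.mk r '' Φ.target) = Φ.target := by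
    refine Subset.antisymm ?_ (subset_preimage_image _ _)
    rintro x ⟨y, hy, hyx⟩
    exact (h' _ _ ((mk_eq_mk_iff hr).1 hyx) hy).1
  have hso : IsOpen (Quot.mk r '' Φ.source) := by
    rw [← isQuotientMap_quot_mk.isOpen_preimage, hs]
    exact Φ.open_source
  have hto : IsOpen (Quot.mk r '' Φ.target) := by
    rw [← isQuotientMap_quot_mk.isOpen_preimage, ht]
    exact Φ.open_target
  { toFun := fun q => Quot.mk r (Φ q.out)
    invFun := fun q => Quot.mk r (Φ.symm q.out)
    source := Quot.mk r '' Φ.source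
    target := Quot.mk r '' Φ.target
    map_source' := by
      rintro _ ⟨x, hx, rfl⟩
      rw [hmk x hx]
      exact mem_image_of_mem _ (Φ.map_source hx)
    map_target' := by
      rintro _ ⟨y, hy, rfl⟩
      rw [hmk' y hy]
      exact mem_image_of_mem _ (Φ.map_target hy)
    left_inv' := by
      rintro _ ⟨x, hx, rfl⟩
      rw [hmk x hx, hmk' _ (Φ.map_source hx), Φ.left_inv hx]
    right_inv' := by
      rintro _ ⟨y, hy, rfl⟩
      rw [hmk' y hy, hmk _ (Φ.map_target hy), Φ.right_inv hy]
    open_source := hso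
    open_target := hto
    continuousOn_toFun := by
      rw [isQuotientMap_quot_mk.continuousOn_isOpen_iff hso, hs]
      exact (continuous_quot_mk.comp_continuousOn Φ.continuousOn).congr hmk
    continuousOn_invFun := by
      rw [isQuotientMap_quot_mk.continuousOn_isOpen_iff hto, ht]
      exact (continuous_quot_mk.comp_continuousOn Φ.symm.continuousOn).congr hmk' }

/-- A Poisson map between saturated open subsets that is compatible with the relation induces a
local Poisson diffeomorphism of the quotient. -/
lemma IsPoissonRelation.isLocalPoissonDiffeoQuot (hr : IsPoissonRelation P r)
    (Φ : OpenPartialHomeomorph M M)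
    (h : ∀ x y, r x y → x ∈ Φ.source → y ∈ Φ.source ∧ r (Φ x) (Φ y))
    (h' : ∀ x y, r x y → x ∈ Φ.target → y ∈ Φ.target ∧ r (Φ.symm x) (Φ.symm y))
    (hΦ : ∀ x ∈ Φ.source, IsPoissonAt P Φ x) (hΦ' : ∀ y ∈ Φ.target, IsPoissonAt P Φ.symm y)
    {F : Quot r →. Quot r}
    (hF : ∀ q q', q' ∈ F q ↔ ∃ x ∈ Φ.source, Quot.mk r x = q ∧ Quot.mk r (Φ x) = q') :
    IsLocalPoissonDiffeoQuot P r F := by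
  have hout : ∀ x, r x (Quot.mk r x).out := fun x =>
    (mk_eq_mk_iff hr.equivalence).1 (Quot.out_eq _).symm
  set Ψ := inducedHomeomorph hr.equivalence Φ h h' with hΨdef
  have hΨ : ∀ x ∈ Φ.source, Ψ (Quot.mk r x) = Quot.mk r (Φ x) := fun x hx =>
    ((mk_eq_mk_iff hr.equivalence).2 (h _ _ (hout x) hx).2).symm
  have hΨ' : ∀ y ∈ Φ.target, Ψ.symm (Quot.mk r y) = Quot.mk r (Φ.symm y) := fun y hy =>
    ((mk_eq_mk_iff hr.equivalence).2 (h' _ _ (hout y) hy).2).symm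
  have hsrc : ∀ {x}, Quot.mk r x ∈ Ψ.source ↔ x ∈ Φ.source := by
    intro x
    constructor
    · rintro ⟨y, hy, hyx⟩
      exact (h _ _ ((mk_eq_mk_iff hr.equivalence).1 hyx) hy).1
    · exact fun hx => ⟨x, hx, rfl⟩
  have htgt : ∀ {x}, Quot.mk r x ∈ Ψ.target ↔ x ∈ Φ.target := by
    intro x
    constructor
    · rintro ⟨y, hy, hyx⟩
      exact (h' _ _ ((mk_eq_mk_iff hr.equivalence).1 hyx) hy).1
    · exact fun hx => ⟨x, hx, rfl⟩
  have hev : ∀ (f : Quot r → ℝ) {x}, x ∈ Φ.source →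
      (f ∘ Quot.mk r) ∘ Φ =ᶠ[𝓝 x] (f ∘ Ψ) ∘ Quot.mk r := by
    intro f x hx
    filter_upwards [Φ.open_source.mem_nhds hx] with y hy
    exact congrArg f (hΨ y hy).symm
  have hev' : ∀ (f : Quot r → ℝ) {y}, y ∈ Φ.target →
      (f ∘ Quot.mk r) ∘ Φ.symm =ᶠ[𝓝 y] (f ∘ Ψ.symm) ∘ Quot.mk r := by
    intro f x hx
    filter_upwards [Φ.open_target.mem_nhds hx] with y hy
    exact congrArg f (hΨ' y hy).symm
  have hpull : ∀ f, QuotSmoothOn E r Ψ.target f → QuotSmoothOn E r Ψ.source (f ∘ Ψ) := by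
    intro f hf
    refine quotSmoothOn_of_germSmooth Ψ.open_source fun m hm => ?_
    have hm' := hsrc.1 hm
    exact ((hf.germSmooth Ψ.open_target (htgt.2 (Φ.map_source hm'))).comp (hΦ m hm').1).congr
      (hev f hm')
  refine ⟨Ψ, ?_, hpull, ?_, ?_⟩
  · intro q q'
    rw [hF]
    constructor
    · rintro ⟨x, hx, rfl, rfl⟩
      exact ⟨hsrc.2 hx, hΨ x hx⟩
    · rintro ⟨⟨x, hx, rfl⟩, rfl⟩
      exact ⟨x, hx, rfl, (hΨ x hx).symm⟩
  · intro f hf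
    refine quotSmoothOn_of_germSmooth Ψ.open_target fun m hm => ?_
    have hm' := htgt.1 hm
    exact ((hf.germSmooth Ψ.open_source (hsrc.2 (Φ.map_target hm'))).comp (hΦ' m hm').1).congr
      (hev' f hm')
  · rintro f g hf hg _ ⟨x, hx, rfl⟩
    have ht := htgt.2 (Φ.map_source hx)
    rw [hr.quotBracket_mk Ψ.open_source (hpull f hf) (hpull g hg) (hsrc.2 hx), hΨ x hx,
      hr.quotBracket_mk Ψ.open_target hf hg ht,
      ← (hΦ x hx).2 _ _ (hf.germSmooth Ψ.open_target ht) (hg.germSmooth Ψ.open_target ht)]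
    exact localBracket_congr P (hev f hx).symm (hev g hx).symm

end PoissonQuotients

section Descent

variable {X : Type*} {r : X → X → Prop}

/-- The partial map of the quotient induced by a partial map `F`. It is computed at some
representative in the domain of `F`, which does not matter if `F` respects the relation. -/
def descend (r : X → X → Prop) (F : X →. X) : Quot r →. Quot r :=
  fun q => ⟨∃ x, Quot.mk r x = q ∧ x ∈ F.Dom, fun h => Quot.mk r (totalize F h.choose)⟩

lemma descend_dom {F : X →. X} : (descend r F).Dom = Quot.mk r '' F.Dom := by
  ext q
  exact exists_congr fun x => and_comm

/-- `F` takes related points to related points, and its domain is saturated. -/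
def Respects (r : X → X → Prop) (F : X →. X) : Prop :=
  ∀ ⦃x y x'⦄, r x y → x' ∈ F x → ∃ y' ∈ F y, r x' y'

lemma mem_descend (hr : Equivalence r) {F : X →. X} (hF : Respects r F) {q q' : Quot r} :
    q' ∈ descend r F q ↔ ∃ x, Quot.mk r x = q ∧ ∃ x' ∈ F x, Quot.mk r x' = q' := by
  constructor
  · rintro ⟨h, rfl⟩
    exact ⟨h.choose, h.choose_spec.1, _, totalize_mem h.choose_spec.2, rfl⟩
  · rintro ⟨x, rfl, x', hx', rfl⟩
    have hd : ∃ y, Quot.mk r y = Quot.mk r x ∧ y ∈ F.Dom := ⟨x, rfl, mem_pfun_dom.2 ⟨x', hx'⟩⟩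
    refine ⟨hd, ?_⟩
    obtain ⟨y', hy', hr'⟩ := hF ((Quot.eq.trans hr.eqvGen_iff).1 hd.choose_spec.1.symm) hx'
    change Quot.mk r (totalize F hd.choose) = _
    rw [totalize_eq hy']
    exact (Quot.sound hr').symm

lemma descend_comp_mk (hr : Equivalence r) {F : X →. X} (hF : Respects r F) :
    (descend r F).comp (Quot.mk r : X → Quot r) = PFun.comp (Quot.mk r : X → Quot r) F := by
  refine PFun.ext fun x q => ?_
  rw [mem_pfun_comp, mem_pfun_comp]
  constructor
  · rintro ⟨q', hq', h⟩
    rw [mem_pfun_coe] at hq'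
    obtain ⟨y, hy, y', hy', rfl⟩ := (mem_descend hr hF).1 h
    obtain ⟨x', hx', hrel⟩ := hF ((Quot.eq.trans hr.eqvGen_iff).1 (hy.trans hq')) hy'
    exact ⟨x', hx', mem_pfun_coe.2 (Quot.sound hrel)⟩
  · rintro ⟨x', hx', h⟩
    exact ⟨_, mem_pfun_coe.2 rfl,
      (mem_descend hr hF).2 ⟨x, rfl, x', hx', (mem_pfun_coe.1 h).symm⟩⟩

/-- Partial maps of a quotient are determined by their composition with the projection. -/
lemma eq_of_comp_mk {G G' : Quot r →. Quot r}
    (h : G.comp ((Quot.mk r : X → Quot r) : X →. Quot r) =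
      G'.comp ((Quot.mk r : X → Quot r) : X →. Quot r)) :
    G = G' := by
  have key : ∀ (G : Quot r →. Quot r) x q, q ∈ G.comp (Quot.mk r : X → Quot r) x ↔ q ∈ G (Quot.mk r x) := by
    intro G x q
    rw [mem_pfun_comp]
    constructor
    · rintro ⟨q', hq', hq⟩
      rwa [← mem_pfun_coe.1 hq']
    · exact fun hq => ⟨_, mem_pfun_coe.2 rfl, hq⟩
  refine PFun.ext ?_
  rintro ⟨x⟩ q
  rw [← key, ← key, h]

lemma descend_id (hr : Equivalence r) : descend r (PFun.id X) = PFun.id _ := by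
  have h : Respects r (PFun.id X) := by
    intro x y x' hxy hx'
    obtain rfl : x' = x := by simpa using hx'
    exact ⟨y, by simp, hxy⟩
  refine PFun.ext fun q q' => ?_
  rw [mem_descend hr h]
  constructor
  · rintro ⟨x, rfl, x', hx', rfl⟩
    obtain rfl : x' = x := by simpa using hx'
    simp
  · intro hq
    obtain rfl : q' = q := by simpa using hq
    obtain ⟨x, rfl⟩ := Quot.exists_rep q'
    exact ⟨x, rfl, x, by simp, rfl⟩

lemma Respects.comp {F G : X →. X} (hF : Respects r F) (hG : Respects r G) :
    Respects r (F.comp G) := by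
  intro x y x' hxy hx'
  obtain ⟨w, hw, hx'⟩ := mem_pfun_comp.1 hx'
  obtain ⟨v, hv, hwv⟩ := hG hxy hw
  obtain ⟨y', hy', h⟩ := hF hwv hx'
  exact ⟨y', mem_pfun_comp.2 ⟨v, hv, hy'⟩, h⟩

lemma descend_comp (hr : Equivalence r) {F G : X →. X} (hF : Respects r F) (hG : Respects r G) :
    descend r (F.comp G) = (descend r F).comp (descend r G) := by
  refine PFun.ext fun q q' => ?_
  rw [mem_descend hr (hF.comp hG), mem_pfun_comp]
  constructor
  · rintro ⟨x, rfl, x', hx', rfl⟩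
    obtain ⟨w, hw, hx'⟩ := mem_pfun_comp.1 hx'
    exact ⟨Quot.mk r w, (mem_descend hr hG).2 ⟨x, rfl, w, hw, rfl⟩,
      (mem_descend hr hF).2 ⟨w, rfl, x', hx', rfl⟩⟩
  · rintro ⟨q₁, h1, h2⟩
    obtain ⟨x, rfl, w, hw, rfl⟩ := (mem_descend hr hG).1 h1
    obtain ⟨w', hw', x', hx', rfl⟩ := (mem_descend hr hF).1 h2
    obtain ⟨y', hy', h⟩ := hF ((Quot.eq.trans hr.eqvGen_iff).1 hw') hx'
    exact ⟨x, rfl, y', mem_pfun_comp.2 ⟨w, hw, hy'⟩, (Quot.sound h).symm⟩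

end Descent

/-! ### The induced actions -/

section PolarActions

variable {E : Type*} [NormedAddCommGroup E] [NormedSpace ℝ E] [FiniteDimensional ℝ E]
  {M : Type*} [TopologicalSpace M] [T2Space M] [ChartedSpace E M] [IsManifold 𝓘(ℝ, E) ∞ M]
  {P : PoissonStructure E M} {A : Subgroup (Equiv.Perm M)}

lemma equivalence_sameOrbit : Equivalence (SameOrbit A) where
  refl x := ⟨1, A.one_mem, rfl⟩
  symm := by
    rintro x _ ⟨φ, hφ, rfl⟩
    exact ⟨φ⁻¹, A.inv_mem hφ, φ.symm_apply_apply x⟩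
  trans := by
    rintro x _ _ ⟨φ, hφ, rfl⟩ ⟨ψ, hψ, rfl⟩
    exact ⟨ψ * φ, A.mul_mem hψ hφ, rfl⟩

lemma isPoissonRelation_sameOrbit (hA : ∀ φ ∈ A, IsPoissonAut P φ) :
    IsPoissonRelation P (SameOrbit A) where
  equivalence := equivalence_sameOrbit
  exists_germ := by
    rintro x _ ⟨φ, hφ, rfl⟩
    exact ⟨φ, (hA φ hφ).isPoissonAt x, rfl, Eventually.of_forall fun x' => ⟨φ, hφ, rfl⟩⟩

lemma isPoissonRelation_sameLeaf (hA : ∀ φ ∈ A, IsPoissonAut P φ) :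
    IsPoissonRelation P (SameLeaf (polarDistribution P A)) where
  equivalence :=
    { refl := fun x => (sameLeaf_iff hA).2 (polarRel_refl x)
      symm := fun h => (sameLeaf_iff hA).2 ((sameLeaf_iff hA).1 h).symm
      trans := fun h h' => (sameLeaf_iff hA).2
        (((sameLeaf_iff hA).1 h).trans ((sameLeaf_iff hA).1 h')) }
  exists_germ := by
    intro x y h
    obtain ⟨F, hF, h⟩ := (sameLeaf_iff hA).1 h
    obtain ⟨Θ, h1, h2⟩ := polar_germ hF h
    exact ⟨Θ, h1, Part.mem_unique h2.self_of_nhds h,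
      h2.mono fun x' hx' => (sameLeaf_iff hA).2 ⟨F, hF, hx'⟩⟩

lemma respects_sameOrbit (hA : ∀ φ ∈ A, IsPoissonAut P φ) {F : M →. M}
    (hF : F ∈ polarPseudogroup P A) : Respects (SameOrbit A) F := by
  rintro x _ x' ⟨φ, hφ, rfl⟩ hx'
  exact ⟨φ x', polar_equivariant hA hF hφ hx', φ, hφ, rfl⟩

lemma comp_polar (hA : ∀ φ ∈ A, IsPoissonAut P φ) {F : M →. M}
    (hF : F ∈ polarPseudogroup P A) {φ : Equiv.Perm M} (hφ : φ ∈ A) :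
    F.comp (φ : M → M) = PFun.comp (φ : M → M) F := by
  refine PFun.ext fun x y => ?_
  rw [mem_pfun_comp, mem_pfun_comp]
  constructor
  · rintro ⟨w, hw, hy⟩
    rw [mem_pfun_coe.1 hw] at hy
    have h := polar_equivariant hA hF (A.inv_mem hφ) hy
    rw [show φ⁻¹ (φ x) = x from φ.symm_apply_apply x] at h
    exact ⟨_, h, mem_pfun_coe.2 (φ.apply_symm_apply y).symm⟩
  · rintro ⟨w, hw, hy⟩
    rw [mem_pfun_coe.1 hy]
    exact ⟨φ x, mem_pfun_coe.2 rfl, polar_equivariant hA hF hφ hw⟩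

lemma isLocalPoissonDiffeoQuot_descend (hA : ∀ φ ∈ A, IsPoissonAut P φ) {F : M →. M}
    (hF : F ∈ polarPseudogroup P A) :
    IsLocalPoissonDiffeoQuot P (SameOrbit A) (descend (SameOrbit A) F) := by
  obtain ⟨Φ, hΦ, h1, h2⟩ := exists_polar_homeomorph hF
  have hequi : ∀ φ ∈ A, ∀ x ∈ Φ.source, φ x ∈ Φ.source ∧ Φ (φ x) = φ (Φ x) := fun φ hφ x hx =>
    (hΦ _ _).1 (polar_equivariant hA hF hφ ((hΦ _ _).2 ⟨hx, rfl⟩))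
  refine (isPoissonRelation_sameOrbit hA).isLocalPoissonDiffeoQuot Φ ?_ ?_ h1 h2 ?_
  · rintro x _ ⟨φ, hφ, rfl⟩ hx
    obtain ⟨h3, h4⟩ := hequi φ hφ x hx
    exact ⟨h3, φ, hφ, h4.symm⟩
  · rintro y _ ⟨φ, hφ, rfl⟩ hy
    obtain ⟨h3, h4⟩ := hequi φ hφ _ (Φ.map_target hy)
    rw [Φ.right_inv hy] at h4
    rw [← h4]
    exact ⟨Φ.map_source h3, φ, hφ, (Φ.left_inv h3).symm⟩
  · intro q q'
    rw [mem_descend equivalence_sameOrbit (respects_sameOrbit hA hF)]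
    constructor
    · rintro ⟨x, hx, x', hx', hq'⟩
      obtain ⟨h3, rfl⟩ := (hΦ _ _).1 hx'
      exact ⟨x, h3, hx, hq'⟩
    · rintro ⟨x, hx, hq, hq'⟩
      exact ⟨x, hq, Φ x, (hΦ _ _).2 ⟨hx, rfl⟩, hq'⟩

lemma sameLeaf_apply (hA : ∀ φ ∈ A, IsPoissonAut P φ) {φ : Equiv.Perm M} (hφ : φ ∈ A) {x y : M}
    (h : SameLeaf (polarDistribution P A) x y) :
    SameLeaf (polarDistribution P A) (φ x) (φ y) := by
  obtain ⟨F, hF, h⟩ := (sameLeaf_iff hA).1 h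
  exact (sameLeaf_iff hA).2 ⟨F, hF, polar_equivariant hA hF hφ h⟩

/-- The action of `A` on the leaf space. -/
def leafAction (hA : ∀ φ ∈ A, IsPoissonAut P φ) :
    A →* Equiv.Perm (Quot (SameLeaf (polarDistribution P A))) where
  toFun φ :=
    { toFun := Quot.map φ.1 fun _ _ => sameLeaf_apply hA φ.2
      invFun := Quot.map (φ.1⁻¹ : Equiv.Perm M) fun _ _ => sameLeaf_apply hA (A.inv_mem φ.2)
      left_inv := by
        rintro ⟨x⟩
        exact congrArg (Quot.mk _) (φ.1.symm_apply_apply x)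
      right_inv := by
        rintro ⟨x⟩
        exact congrArg (Quot.mk _) (φ.1.apply_symm_apply x) }
  map_one' := by
    ext ⟨x⟩
    rfl
  map_mul' φ ψ := by
    ext ⟨x⟩
    rfl

lemma isLocalPoissonDiffeoQuot_leafAction (hA : ∀ φ ∈ A, IsPoissonAut P φ) (φ : A) :
    IsLocalPoissonDiffeoQuot P (SameLeaf (polarDistribution P A)) (leafAction hA φ : _ → _) := by
  obtain ⟨Φ, hΦ, -⟩ := hA φ.1 φ.2
  have hΦ' : ∀ x, Φ.symm x = (φ.1⁻¹ : Equiv.Perm M) x := fun x => by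
    rw [Equiv.Perm.eq_inv_iff_eq, ← hΦ]
    exact Φ.apply_symm_apply x
  have e : (Φ : M → M) = φ.1 := funext hΦ
  have e' : (Φ.symm : M → M) = (φ.1⁻¹ : Equiv.Perm M) := funext hΦ'
  refine (isPoissonRelation_sameLeaf hA).isLocalPoissonDiffeoQuot
    Φ.toHomeomorph.toOpenPartialHomeomorph ?_ ?_ ?_ ?_ ?_
  · intro x y hxy _
    refine ⟨trivial, ?_⟩
    change SameLeaf _ (Φ x) (Φ y)
    rw [hΦ, hΦ]
    exact sameLeaf_apply hA φ.2 hxy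
  · intro x y hxy _
    refine ⟨trivial, ?_⟩
    change SameLeaf _ (Φ.symm x) (Φ.symm y)
    rw [hΦ', hΦ']
    exact sameLeaf_apply hA (A.inv_mem φ.2) hxy
  · intro x _
    change IsPoissonAt P Φ x
    rw [e]
    exact (hA _ φ.2).isPoissonAt x
  · intro x _
    change IsPoissonAt P Φ.symm x
    rw [e']
    exact (hA _ (A.inv_mem φ.2)).isPoissonAt x
  · intro q q'
    rw [mem_pfun_coe]
    constructor
    · rintro rfl
      obtain ⟨x, rfl⟩ := Quot.exists_rep q
      exact ⟨x, trivial, rfl, congrArg (Quot.mk _) (hΦ x)⟩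
    · rintro ⟨x, -, rfl, rfl⟩
      exact congrArg (Quot.mk _) (hΦ x)

end PolarActions

end Polar

end

theorem proposition3p8 {E : Type*} [NormedAddCommGroup E] [NormedSpace ℝ E] [FiniteDimensional ℝ E]
    {M : Type*} [TopologicalSpace M] [T2Space M] [ChartedSpace E M] [IsManifold 𝓘(ℝ, E) ∞ M]
    (P : Polar.PoissonStructure E M) (A : Subgroup (Equiv.Perm M))
    (hA : ∀ φ ∈ A, Polar.IsPoissonAut P φ) :
    -- the group commutes with its standard polar pseudogroup
    (∀ F ∈ Polar.polarPseudogroup P A, IsOpen F.Dom ∧ Polar.IsInvariant A F.Dom ∧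
      ∀ φ ∈ A, F.comp (φ : M → M) = PFun.comp (φ : M → M) F) ∧
    -- the standard polar pseudogroup acts canonically on the orbit space
    ((∀ V : Set (Quot (Polar.SameOrbit A)), IsOpen V →
        Polar.IsPoissonVariety P (Polar.SameOrbit A) V) ∧
      ∃ ρ : (M →. M) → (Quot (Polar.SameOrbit A) →. Quot (Polar.SameOrbit A)),
        (∀ F ∈ Polar.polarPseudogroup P A,
          (ρ F).Dom = Quot.mk (Polar.SameOrbit A) '' F.Dom ∧
          (ρ F).comp (Quot.mk (Polar.SameOrbit A)) =
            PFun.comp (Quot.mk (Polar.SameOrbit A)) F ∧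
          (∀ G : Quot (Polar.SameOrbit A) →. Quot (Polar.SameOrbit A),
            G.comp (Quot.mk (Polar.SameOrbit A)) = PFun.comp (Quot.mk (Polar.SameOrbit A)) F →
              G = ρ F) ∧
          Polar.IsLocalPoissonDiffeoQuot P (Polar.SameOrbit A) (ρ F)) ∧
        ρ (PFun.id M) = PFun.id _ ∧
        ∀ F ∈ Polar.polarPseudogroup P A, ∀ G ∈ Polar.polarPseudogroup P A,
          ρ (F.comp G) = (ρ F).comp (ρ G)) ∧
    -- the polar distribution is integrable and Poisson; its leaf space is a Poisson variety
    (Polar.IsIntegrable (Polar.polarDistribution P A) ∧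
      Polar.IsPoissonFamily P (Polar.polarFamily P A) ∧
      Polar.IsPoissonVariety P (Polar.SameLeaf (Polar.polarDistribution P A)) univ) ∧
    -- the group acts canonically on the leaf space
    (∃ ρ : A →* Equiv.Perm (Quot (Polar.SameLeaf (Polar.polarDistribution P A))),
      ∀ φ : A,
        (∀ x, ρ φ (Quot.mk _ x) = Quot.mk _ ((φ : Equiv.Perm M) x)) ∧
        (∀ ψ : Quot (Polar.SameLeaf (Polar.polarDistribution P A)) →
            Quot (Polar.SameLeaf (Polar.polarDistribution P A)),
          (∀ x, ψ (Quot.mk _ x) = Quot.mk _ ((φ : Equiv.Perm M) x)) → ψ = ρ φ) ∧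
        Polar.IsLocalPoissonDiffeoQuot P (Polar.SameLeaf (Polar.polarDistribution P A))
          (ρ φ : _ → _)) := by
  refine ⟨fun F hF => ⟨Polar.isOpen_polar_dom hF, fun φ hφ x hx => ?_, fun φ hφ => ?_⟩,
    ⟨fun V hV => (Polar.isPoissonRelation_sameOrbit hA).isPoissonVariety hV,
      Polar.descend (Polar.SameOrbit A), fun F hF => ?_, Polar.descend_id Polar.equivalence_sameOrbit,
      fun F hF G hG => Polar.descend_comp Polar.equivalence_sameOrbit (Polar.respects_sameOrbit hA hF)
        (Polar.respects_sameOrbit hA hG)⟩,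
    ⟨Polar.isIntegrable_polarDistribution hA, Polar.isPoissonFamily_polarFamily,
      (Polar.isPoissonRelation_sameLeaf hA).isPoissonVariety isOpen_univ⟩,
    Polar.leafAction hA, fun φ => ⟨fun x => rfl, fun ψ hψ => ?_, ?_⟩⟩
  · obtain ⟨y, hy⟩ := Polar.mem_pfun_dom.1 hx
    exact Polar.mem_pfun_dom.2 ⟨_, Polar.polar_equivariant hA hF hφ hy⟩
  · exact Polar.comp_polar hA hF hφ
  · have hresp := Polar.respects_sameOrbit hA hF
    refine ⟨Polar.descend_dom, Polar.descend_comp_mk Polar.equivalence_sameOrbit hresp, fun G hG => Polar.eq_of_comp_mk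
      (hG.trans (Polar.descend_comp_mk Polar.equivalence_sameOrbit hresp).symm),
      Polar.isLocalPoissonDiffeoQuot_descend hA hF⟩
  · funext q
    obtain ⟨x, rfl⟩ := Quot.exists_rep q
    exact hψ x
  · exact Polar.isLocalPoissonDiffeoQuot_leafAction hA φ
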